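/- Let $M^n$ be a compact connected smooth $n$-manifold (without boundary), let $\phi:M\to\mathbb S^{n+1}\subset\mathbb R^{n+2}$ be a smooth immersion, and let $\nu:M\to\mathbb S^{n+1}$ be a Gauss map of $\phi$, i.e. a smooth unit vector field along $\phi$ with $\nu(x)\perp\phi(x)$ and $\nu(x)\perp d\phi_x(T_xM)$ for all $x\in M$ (so $M$ is an orientable immersed hypersurface of $\mathbb S^{n+1}$). Equip $M$ with the induced metric, and let $A_x:T_xM\to T_xM$, $d\phi_x(A_xw)=-d\nu_x(w)$, be the shape operator, $H=\frac1n\operatorname{trace}A$ the mean curvature and $\|A\|^2=\operatorname{trace}(A^2)$. With the Jacobi operator $J=\Delta+\|A\|^2+n$ ($\Delta$ the trace of the Hessian) and $Q(f)=-\int_M f\,Jf$, the weak stability index of $M$ is $$\mathrm{Ind}_T(M)=\sup\Big\{\dim V:\ V\le\{f\in C^\infty(M):\textstyle\int_M f=0\}\text{ a linear subspace with } Q(f)<0 \text{ for every } 0\ne f\in V\Big\}.$$ Theorem. Suppose that $M$ has constant mean curvature and constant scalar curvature, that $M$ is not totally umbilical (i.e. it is not the case that $A_x$ is a multiple of the identity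 for every $x\in M$), and that $\phi(M)$ is not a Clifford hypersurface, i.e. it is not the image of $$\mathbb S^{k}(r)\times\mathbb S^{n-k}(\sqrt{1-r^2})\subset\mathbb R^{k+1}\times\mathbb R^{n-k+1}=\mathbb R^{n+2}$$ under a linear isometry of $\mathbb R^{n+2}$ for any integer $1\le k\le n-1$ and any $r\in(0,1)$. Then $\mathrm{Ind}_T(M)\ge 2n+4$. -/

import Mathlib

open scoped Manifold ContDiff

noncomputable section

namespace SphereHypersurface

open MeasureTheory

variable {n : ℕ}

/-! ### Metrics on open sets of `ℝⁿ` -/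

/-- The `i`-th partial derivative `∂ᵢ F` of a map defined on (an open part of) `ℝⁿ`. -/
def pderiv {F : Type*} [NormedAddCommGroup F] [NormedSpace ℝ F] (i : Fin n)
    (f : EuclideanSpace ℝ (Fin n) → F) (y : EuclideanSpace ℝ (Fin n)) : F :=
  fderiv ℝ f y (EuclideanSpace.single i 1)

/-- The Christoffel symbol `Γᵏᵢⱼ = ½ ∑ₗ gᵏˡ (∂ᵢ gⱼₗ + ∂ⱼ gᵢₗ - ∂ₗ gᵢⱼ)` of the metric with
component matrix `G`. -/
def christoffel (G : EuclideanSpace ℝ (Fin n) → Matrix (Fin n) (Fin n) ℝ) (k i j : Fin n)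
    (y : EuclideanSpace ℝ (Fin n)) : ℝ :=
  (1 / 2 : ℝ) * ∑ l, (G y)⁻¹ k l *
    (pderiv i (fun z => G z j l) y + pderiv j (fun z => G z i l) y
      - pderiv l (fun z => G z i j) y)

/-- The component `Rˡₖᵢⱼ = ∂ᵢ Γˡⱼₖ - ∂ⱼ Γˡᵢₖ + ∑ₚ (Γˡᵢₚ Γᵖⱼₖ - Γˡⱼₚ Γᵖᵢₖ)` of the Riemann curvature
tensor, that is, the `l`-th component of `R(∂ᵢ, ∂ⱼ) ∂ₖ`. -/
def riemannTensor (G : EuclideanSpace ℝ (Fin n) → Matrix (Fin n) (Fin n) ℝ) (l k i j : Fin n)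
    (y : EuclideanSpace ℝ (Fin n)) : ℝ :=
  pderiv i (christoffel G l j k) y - pderiv j (christoffel G l i k) y
    + ∑ p, (christoffel G l i p y * christoffel G p j k y
      - christoffel G l j p y * christoffel G p i k y)

/-- The Ricci tensor `Ricₖⱼ = ∑ᵢ Rⁱₖᵢⱼ`. -/
def ricciTensor (G : EuclideanSpace ℝ (Fin n) → Matrix (Fin n) (Fin n) ℝ) (k j : Fin n)
    (y : EuclideanSpace ℝ (Fin n)) : ℝ :=
  ∑ i, riemannTensor G i k i j y

/-- The scalar curvature `∑ gᵏʲ Ricₖⱼ` of the metric `G` (the trace of the Ricci tensor; it is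
`n (n - 1)` for the unit sphere). -/
def coordScalarCurvature (G : EuclideanSpace ℝ (Fin n) → Matrix (Fin n) (Fin n) ℝ)
    (y : EuclideanSpace ℝ (Fin n)) : ℝ :=
  ∑ k, ∑ j, (G y)⁻¹ k j * ricciTensor G k j y

/-- The Laplacian `∑ gⁱʲ (∂ᵢ ∂ⱼ u - ∑ₖ Γᵏᵢⱼ ∂ₖ u)` (trace of the Hessian) for the metric `G`. -/
def coordLaplacian (G : EuclideanSpace ℝ (Fin n) → Matrix (Fin n) (Fin n) ℝ)
    (u : EuclideanSpace ℝ (Fin n) → ℝ) (y : EuclideanSpace ℝ (Fin n)) : ℝ :=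
  ∑ i, ∑ j, (G y)⁻¹ i j *
    (pderiv i (pderiv j u) y - ∑ k, christoffel G k i j y * pderiv k u y)

/-! ### Hypersurfaces of the unit sphere -/

section Hypersurface

variable {M : Type*} [TopologicalSpace M] [ChartedSpace (EuclideanSpace ℝ (Fin n)) M]

/-- `φ : M → 𝕊ⁿ⁺¹ ⊆ ℝⁿ⁺²` is a smooth immersion of the `n`-manifold `M` and `ν : M → 𝕊ⁿ⁺¹` is a
Gauss map of it: a smooth unit vector field along `φ` which at every `x` is orthogonal to `φ x` and
to `dφₓ(TₓM)`. (A hypersurface of a sphere is orientable exactly if it has a Gauss map.) -/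
structure IsOrientedHypersurface (φ ν : M → EuclideanSpace ℝ (Fin (n + 2))) : Prop where
  contMDiff_immersion : ContMDiff (𝓡 n) 𝓘(ℝ, EuclideanSpace ℝ (Fin (n + 2))) ∞ φ
  mem_sphere : ∀ x, ‖φ x‖ = 1
  injective_mfderiv : ∀ x, Function.Injective
    (mfderiv (𝓡 n) 𝓘(ℝ, EuclideanSpace ℝ (Fin (n + 2))) φ x)
  contMDiff_gauss : ContMDiff (𝓡 n) 𝓘(ℝ, EuclideanSpace ℝ (Fin (n + 2))) ∞ ν
  norm_gauss : ∀ x, ‖ν x‖ = 1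
  gauss_orthogonal : ∀ x, inner ℝ (ν x) (φ x) = 0
  gauss_normal : ∀ x, ∀ w : TangentSpace (𝓡 n) x, inner ℝ (ν x)
    (mfderiv (𝓡 n) 𝓘(ℝ, EuclideanSpace ℝ (Fin (n + 2))) φ x w :
      EuclideanSpace ℝ (Fin (n + 2))) = 0

/-- The differential `dψₓ : TₓM → ℝⁿ⁺²` as a linear map. -/
def diff (ψ : M → EuclideanSpace ℝ (Fin (n + 2))) (x : M) :
    TangentSpace (𝓡 n) x →ₗ[ℝ] EuclideanSpace ℝ (Fin (n + 2)) :=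
  (mfderiv (𝓡 n) 𝓘(ℝ, EuclideanSpace ℝ (Fin (n + 2))) ψ x).toLinearMap

/-- The shape operator `Aₓ : TₓM → TₓM`, determined by `dφₓ (Aₓ w) = - dνₓ w`. As `dφₓ` is injective
and `dνₓ` takes its values in the range of `dφₓ`, it is the composition of `-dνₓ` with a left
inverse of `dφₓ`, whichever left inverse is taken. -/
def shapeOperator (φ ν : M → EuclideanSpace ℝ (Fin (n + 2))) (x : M) :
    TangentSpace (𝓡 n) x →ₗ[ℝ] TangentSpace (𝓡 n) x :=
  (diff φ x).leftInverse ∘ₗ (-diff ν x)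

/-- The mean curvature `H = (κ₁ + ⋯ + κₙ) / n`. -/
def meanCurvature (φ ν : M → EuclideanSpace ℝ (Fin (n + 2))) (x : M) : ℝ :=
  LinearMap.trace ℝ (TangentSpace (𝓡 n) x) (shapeOperator φ ν x) / n

/-- `‖A‖² = trace (A²) = κ₁² + ⋯ + κₙ²`. -/
def normSqShape (φ ν : M → EuclideanSpace ℝ (Fin (n + 2))) (x : M) : ℝ :=
  LinearMap.trace ℝ (TangentSpace (𝓡 n) x) (shapeOperator φ ν x ∘ₗ shapeOperator φ ν x)

/-- At every point all the principal curvatures coincide. -/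
def IsTotallyUmbilical (φ ν : M → EuclideanSpace ℝ (Fin (n + 2))) : Prop :=
  ∀ x, ∃ κ : ℝ, shapeOperator φ ν x = κ • LinearMap.id

/-- The components `gᵢⱼ = ⟨∂ᵢ (φ ∘ e⁻¹), ∂ⱼ (φ ∘ e⁻¹)⟩`, in the chart `e`, of the metric that `φ`
induces on `M`. -/
def metricMatrix (φ : M → EuclideanSpace ℝ (Fin (n + 2)))
    (e : OpenPartialHomeomorph M (EuclideanSpace ℝ (Fin n)))
    (y : EuclideanSpace ℝ (Fin n)) : Matrix (Fin n) (Fin n) ℝ :=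
  Matrix.of fun i j => inner ℝ (pderiv i (φ ∘ e.symm) y) (pderiv j (φ ∘ e.symm) y)

/-- The (intrinsic) scalar curvature of `M` with the induced metric. -/
def scalarCurvature (φ : M → EuclideanSpace ℝ (Fin (n + 2))) (x : M) : ℝ :=
  coordScalarCurvature (metricMatrix φ (chartAt (EuclideanSpace ℝ (Fin n)) x))
    (chartAt (EuclideanSpace ℝ (Fin n)) x x)

/-- The Laplacian of `M` with the induced metric. -/
def laplacian (φ : M → EuclideanSpace ℝ (Fin (n + 2))) (f : M → ℝ) (x : M) : ℝ :=
  coordLaplacian (metricMatrix φ (chartAt (EuclideanSpace ℝ (Fin n)) x))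
    (f ∘ (chartAt (EuclideanSpace ℝ (Fin n)) x).symm)
    (chartAt (EuclideanSpace ℝ (Fin n)) x x)

/-- The Jacobi operator `J = Δ + ‖A‖² + n`. -/
def jacobi (φ ν : M → EuclideanSpace ℝ (Fin (n + 2))) (f : M → ℝ) (x : M) : ℝ :=
  laplacian φ f x + (normSqShape φ ν x + n) * f x

/-- The Riemannian volume on the domain of the chart `e`, as a measure on `M`: the measure
`√(det gᵢⱼ) dy` on the target of `e`, carried over to `M` by `e⁻¹`. -/
def chartVolume [MeasurableSpace M] (φ : M → EuclideanSpace ℝ (Fin (n + 2)))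
    (e : OpenPartialHomeomorph M (EuclideanSpace ℝ (Fin n))) : Measure M :=
  Measure.map e.symm ((volume.restrict e.target).withDensity
    fun y => ENNReal.ofReal (Real.sqrt (metricMatrix φ e y).det))

/-- The Riemannian volume measure of `M` with the induced metric. The chart volumes agree on the
overlaps of the charts, so their supremum in the lattice of measures (the least measure which
dominates all of them) is the measure which restricts to each of them on the domain of its chart. -/
def riemannianVolume [MeasurableSpace M] (φ : M → EuclideanSpace ℝ (Fin (n + 2))) : Measure M :=
  ⨆ e ∈ atlas (EuclideanSpace ℝ (Fin n)) M, chartVolume φ e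

/-- The quadratic form `Q(f) = - ∫_M f J f`. -/
def jacobiForm [MeasurableSpace M] (φ ν : M → EuclideanSpace ℝ (Fin (n + 2)))
    (f : M → ℝ) : ℝ :=
  -∫ x, f x * jacobi φ ν f x ∂(riemannianVolume φ)

/-- The weak stability index: the supremum of `dim V` over all linear spaces `V` of smooth functions
with mean value zero on which `Q` is negative definite. -/
def weakIndex [MeasurableSpace M] (φ ν : M → EuclideanSpace ℝ (Fin (n + 2))) : ℕ∞ :=
  ⨆ V ∈ {V : Submodule ℝ (M → ℝ) | ∀ f ∈ V,
      ContMDiff (𝓡 n) 𝓘(ℝ, ℝ) ∞ f ∧ ∫ x, f x ∂(riemannianVolume φ) = 0 ∧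
        (f ≠ 0 → jacobiForm φ ν f < 0)},
    Cardinal.toENat (Module.rank ℝ V)

end Hypersurface

/-- The product `𝕊ᵏ(r) × 𝕊ⁿ⁻ᵏ(√(1 - r²)) ⊆ 𝕊ⁿ⁺¹`, where `ℝⁿ⁺² = ℝᵏ⁺¹ × ℝⁿ⁻ᵏ⁺¹`. -/
def cliffordModel (n k : ℕ) (r : ℝ) : Set (EuclideanSpace ℝ (Fin (n + 2))) :=
  {z | (∑ i with i.val < k + 1, z i ^ 2) = r ^ 2 ∧
    (∑ i with ¬ i.val < k + 1, z i ^ 2) = 1 - r ^ 2}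

/-- `S` is, up to a rigid motion of the sphere, one of the products `𝕊ᵏ(r) × 𝕊ⁿ⁻ᵏ(√(1 - r²))` with
`1 ≤ k ≤ n - 1` and `0 < r < 1`. -/
def IsCliffordHypersurface (S : Set (EuclideanSpace ℝ (Fin (n + 2)))) : Prop :=
  ∃ (k : ℕ) (r : ℝ) (L : EuclideanSpace ℝ (Fin (n + 2)) ≃ₗᵢ[ℝ] EuclideanSpace ℝ (Fin (n + 2))),
    1 ≤ k ∧ k < n ∧ 0 < r ∧ r < 1 ∧ S = L '' cliffordModel n k r

end SphereHypersurface

end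

/-! The test space consists of the height functions f = ⟨a,φ⟩ + ⟨b,ν⟩ with (a,b) ∈ ℝⁿ⁺² × ℝⁿ⁺², a
parameter space of dimension 2n+4. In the proof H stands for tr A (not for its average) and s for
‖A‖². The Gauss equation `coordScalarCurvature_eq` expresses the scalar curvature by H and s, so s
is constant too.

Negativity: Codazzi and the constancy of H give Δφ = Hν − nφ and Δν = Hφ − sν
(`coordLaplacian_height`). Hence Δ and J act on the coefficients (a,b) by constant matrices, and ΔJ
= −δ with δ = ns − H². By Cauchy–Schwarz δ ≥ 0, with equality only in the umbilical case, so δ > 0.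
Since f = −δ⁻¹ Δ(Jf), Green's formula yields ∫ f = 0 and Q(f) = −δ⁻¹ ∫ |∇(Jf)|². This is negative
unless Jf is constant, which forces f = 0 (`jacobiForm_height_neg`).

Independence: suppose ⟨a,φ⟩ + ⟨b,ν⟩ = 0 with (a,b) ≠ 0. Put α = ⟨a,φ⟩, β = ⟨a,ν⟩ + ⟨b,φ⟩, and let X
be the tangential part of b. Differentiating twice and using Codazzi gives ∇_X A = P with P = α(A² −
1) + βA (`fderiv_localShape_of_relation`). Constancy of H and s gives tr P = tr AP = 0, hence 3 tr
P² = α X(tr A³). It turns out that α ∇(tr A³) = 0, by algebra if H ≠ 0 and by an integral identity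
if H = 0. So the symmetric operator P vanishes, and A² + cA = 1 with c = (H − tr A³)/s, at first
where α ≠ 0 and then everywhere (`quadratic_of_height_eq_zero`). It follows that tr A³, and with it
c, is constant.

Rigidity: the ambient operator T with Tφ = ν, T dφ = dν and Tν = φ + cν is then constant
(`hasFDerivAt_transition`) and satisfies T² = cT + 1. So φ takes values in the part of the sphere
where ⟨Tz,z⟩ = 0, which is a Clifford hypersurface. The image is open and closed in it, hence all of
it (`isCliffordHypersurface`), contrary to hypothesis. -/

noncomputable section

namespace SphereHypersurface

open MeasureTheory

variable {n : ℕ}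

/-! ### The pseudo-inverse of an injective linear map -/

section PseudoInverse

variable {E : Type*} [NormedAddCommGroup E] [InnerProductSpace ℝ E]

/-- The Gram matrix `⟨D eᵢ, D eⱼ⟩`. -/
def gram (D : EuclideanSpace ℝ (Fin n) →L[ℝ] E) : Matrix (Fin n) (Fin n) ℝ :=
  Matrix.of fun i j => inner ℝ (D (EuclideanSpace.single i 1)) (D (EuclideanSpace.single j 1))

/-- The pseudo-inverse `(D* D)⁻¹ D*`. -/
def pinv (D : EuclideanSpace ℝ (Fin n) →L[ℝ] E) : E →L[ℝ] EuclideanSpace ℝ (Fin n) :=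
  ∑ i, ∑ j, (gram D)⁻¹ i j •
    (innerSL ℝ (D (EuclideanSpace.single j 1))).smulRight (EuclideanSpace.single i (1 : ℝ))

lemma gram_posDef {D : EuclideanSpace ℝ (Fin n) →L[ℝ] E} (hD : Function.Injective D) :
    (gram D).PosDef := by
  have hli : LinearIndependent ℝ fun i : Fin n => D (EuclideanSpace.single i 1) := by
    have h := (EuclideanSpace.basisFun (Fin n) ℝ).toBasis.linearIndependent
    have := h.map' D.toLinearMap (LinearMap.ker_eq_bot.2 hD)
    convert this using 1
    · ext i
      simp
    · rfl
  exact Matrix.posDef_gram_of_linearIndependent hli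

lemma gram_isUnit_det {D : EuclideanSpace ℝ (Fin n) →L[ℝ] E} (hD : Function.Injective D) :
    IsUnit (gram D).det :=
  (gram_posDef hD).det_pos.ne'.isUnit

lemma pinv_apply_coord (D : EuclideanSpace ℝ (Fin n) →L[ℝ] E) (z : E) (i : Fin n) :
    pinv D z i = ∑ j, (gram D)⁻¹ i j * inner ℝ (D (EuclideanSpace.single j 1)) z := by
  simp [pinv, Finset.sum_apply, Pi.single_apply]

lemma euclidean_eq_sum (w : EuclideanSpace ℝ (Fin n)) :
    w = ∑ i, w i • EuclideanSpace.single i (1 : ℝ) := by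
  ext j
  simp [Finset.sum_apply, Pi.single_apply]

lemma map_eq_sum {F : Type*} [NormedAddCommGroup F] [NormedSpace ℝ F]
    (D : EuclideanSpace ℝ (Fin n) →L[ℝ] F) (w : EuclideanSpace ℝ (Fin n)) :
    D w = ∑ i, w i • D (EuclideanSpace.single i (1 : ℝ)) := by
  conv_lhs => rw [euclidean_eq_sum w]
  simp

/-- These are the normal equations: `D (pinv D z)` is the orthogonal projection of `z` to the range
of `D`. Together with `pinv_unique` they replace computations with the inverse Gram matrix. -/
lemma inner_pinv {D : EuclideanSpace ℝ (Fin n) →L[ℝ] E} (hD : Function.Injective D)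
    (w : EuclideanSpace ℝ (Fin n)) (z : E) :
    inner ℝ (D w) (D (pinv D z)) = inner ℝ (D w) z := by
  have key : ∀ k : Fin n, inner ℝ (D (EuclideanSpace.single k 1)) (D (pinv D z))
      = inner ℝ (D (EuclideanSpace.single k 1)) z := by
    intro k
    rw [map_eq_sum D (pinv D z), inner_sum]
    simp only [inner_smul_right, pinv_apply_coord, Finset.sum_mul]
    rw [Finset.sum_comm]
    have h1 : ∀ j, ∑ i, (gram D)⁻¹ i j * inner ℝ (D (EuclideanSpace.single j 1)) z *
        inner ℝ (D (EuclideanSpace.single k 1)) (D (EuclideanSpace.single i 1))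
        = (1 : Matrix (Fin n) (Fin n) ℝ) k j * inner ℝ (D (EuclideanSpace.single j 1)) z := by
      intro j
      rw [← Matrix.mul_nonsing_inv _ (gram_isUnit_det hD), Matrix.mul_apply, Finset.sum_mul]
      refine Finset.sum_congr rfl fun i _ => ?_
      simp only [gram, Matrix.of_apply]
      ring
    simp [h1, Matrix.one_apply]
  rw [map_eq_sum D w, sum_inner, sum_inner]
  simp only [inner_smul_left, key]

lemma pinv_unique {D : EuclideanSpace ℝ (Fin n) →L[ℝ] E} (hD : Function.Injective D)
    {v : EuclideanSpace ℝ (Fin n)} {z : E} (h : ∀ w, inner ℝ (D w) (D v) = inner ℝ (D w) z) :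
    pinv D z = v := by
  apply hD
  rw [← sub_eq_zero, ← map_sub, ← inner_self_eq_zero (𝕜 := ℝ)]
  nth_rewrite 2 [map_sub]
  rw [inner_sub_right, inner_pinv hD, h, sub_self]

lemma pinv_apply_map {D : EuclideanSpace ℝ (Fin n) →L[ℝ] E} (hD : Function.Injective D)
    (v : EuclideanSpace ℝ (Fin n)) : pinv D (D v) = v :=
  pinv_unique hD fun _ => rfl

lemma pinv_eq_zero {D : EuclideanSpace ℝ (Fin n) →L[ℝ] E} {z : E}
    (h : ∀ w, inner ℝ (D w) z = 0) : pinv D z = 0 := by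
  ext i
  simp [pinv_apply_coord, h]

/-- Naturality under a linear change of coordinates; it lets objects built from `pinv` pass between
charts and the tangent spaces of `M`. -/
lemma pinv_comp_apply {D : EuclideanSpace ℝ (Fin n) →L[ℝ] E} (hD : Function.Injective D)
    (ε : EuclideanSpace ℝ (Fin n) ≃L[ℝ] EuclideanSpace ℝ (Fin n)) (z : E) :
    pinv (D ∘L (ε : EuclideanSpace ℝ (Fin n) →L[ℝ] EuclideanSpace ℝ (Fin n))) z
      = ε.symm (pinv D z) := by
  refine pinv_unique (fun a b h => ε.injective (hD h)) fun w => ?_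
  simp [inner_pinv hD]

end PseudoInverse

/-! ### The ambient shape operator -/

section Frame

/-- The trace of an endomorphism as a continuous linear form. -/
def opTrace {E : Type*} [NormedAddCommGroup E] [NormedSpace ℝ E] [FiniteDimensional ℝ E] :
    (E →L[ℝ] E) →L[ℝ] ℝ :=
  LinearMap.toContinuousLinearMap (LinearMap.trace ℝ E ∘ₗ ContinuousLinearMap.coeLM ℝ)

lemma opTrace_apply {E : Type*} [NormedAddCommGroup E] [NormedSpace ℝ E] [FiniteDimensional ℝ E]
    (T : E →L[ℝ] E) : opTrace T = LinearMap.trace ℝ E T.toLinearMap := rfl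

lemma opTrace_comp_comm {E F : Type*} [NormedAddCommGroup E] [NormedSpace ℝ E]
    [FiniteDimensional ℝ E] [NormedAddCommGroup F] [NormedSpace ℝ F] [FiniteDimensional ℝ F]
    (S : E →L[ℝ] F) (T : F →L[ℝ] E) : opTrace (S ∘L T) = opTrace (T ∘L S) :=
  LinearMap.trace_comp_comm' T.toLinearMap S.toLinearMap

lemma opTrace_smulRight {E : Type*} [NormedAddCommGroup E] [NormedSpace ℝ E]
    [FiniteDimensional ℝ E] (l : E →L[ℝ] ℝ) (z : E) : opTrace (l.smulRight z) = l z :=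
  LinearMap.trace_smulRight l.toLinearMap z

lemma opTrace_euclidean {m : ℕ}
    (T : EuclideanSpace ℝ (Fin m) →L[ℝ] EuclideanSpace ℝ (Fin m)) :
    opTrace T = ∑ i, T (EuclideanSpace.single i 1) i := by
  rw [opTrace_apply, LinearMap.trace_eq_sum_inner _ (EuclideanSpace.basisFun (Fin m) ℝ)]
  simp [EuclideanSpace.inner_single_left]

/-- The ambient extension of the shape operator: `D v ↦ -D' v`, and `0` on the normal space. -/
def ambShape (D D' : EuclideanSpace ℝ (Fin n) →L[ℝ] EuclideanSpace ℝ (Fin (n + 2))) :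
    EuclideanSpace ℝ (Fin (n + 2)) →L[ℝ] EuclideanSpace ℝ (Fin (n + 2)) :=
  -(D' ∘L pinv D)

/-- The algebraic relations between the first derivatives `D`, `D'` of an immersion into the sphere
and of its Gauss map, where `p`, `q` are the values of the two maps. -/
structure IsFrame (D D' : EuclideanSpace ℝ (Fin n) →L[ℝ] EuclideanSpace ℝ (Fin (n + 2)))
    (p q : EuclideanSpace ℝ (Fin (n + 2))) : Prop where
  inj : Function.Injective D
  norm_left : inner ℝ p p = (1 : ℝ)
  norm_right : inner ℝ q q = (1 : ℝ)
  orth : inner ℝ p q = (0 : ℝ)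
  left_left : ∀ v, inner ℝ p (D v) = (0 : ℝ)
  left_right : ∀ v, inner ℝ p (D' v) = (0 : ℝ)
  right_left : ∀ v, inner ℝ q (D v) = (0 : ℝ)
  right_right : ∀ v, inner ℝ q (D' v) = (0 : ℝ)
  symm : ∀ v w, inner ℝ (D' v) (D w) = inner ℝ (D' w) (D v)

namespace IsFrame

variable {D D' : EuclideanSpace ℝ (Fin n) →L[ℝ] EuclideanSpace ℝ (Fin (n + 2))}
  {p q : EuclideanSpace ℝ (Fin (n + 2))}

/-- The range of `D` and the orthonormal vectors `p`, `q` are mutually orthogonal, and n + 1 + 1 = n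
+ 2 is the full dimension, so they span. The coefficients are then read off by inner products. -/
lemma decomp (h : IsFrame D D' p q) (z : EuclideanSpace ℝ (Fin (n + 2))) :
    z = D (pinv D z) + (inner ℝ p z : ℝ) • p + (inner ℝ q z : ℝ) • q := by
  let Φ : (EuclideanSpace ℝ (Fin n) × (ℝ × ℝ)) →ₗ[ℝ] EuclideanSpace ℝ (Fin (n + 2)) :=
    D.toLinearMap.coprod
      ((LinearMap.toSpanSingleton ℝ _ p).coprod (LinearMap.toSpanSingleton ℝ _ q))
  have hΦ : ∀ v s t, Φ (v, s, t) = D v + (s • p + t • q) := by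
    intro v s t
    simp [Φ]
  have hp := h.norm_left
  have hq := h.norm_right
  have hpq := h.orth
  have hqp : inner ℝ q p = (0 : ℝ) := by rw [real_inner_comm, hpq]
  have hi : Function.Injective Φ := by
    rw [← LinearMap.ker_eq_bot, LinearMap.ker_eq_bot']
    rintro ⟨v, s, t⟩ h0
    rw [hΦ] at h0
    have h1 := congrArg (fun z => (inner ℝ p z : ℝ)) h0
    have h2 := congrArg (fun z => (inner ℝ q z : ℝ)) h0
    simp only [inner_add_right, inner_smul_right, h.left_left, h.right_left, hp, hq, hpq, hqp,
      inner_zero_right] at h1 h2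
    have hs : s = 0 := by linarith
    have ht : t = 0 := by linarith
    subst hs ht
    have hv : D v = 0 := by simpa using h0
    have : v = 0 := h.inj (by rw [hv, map_zero])
    simp [this]
  have hsurj : Function.Surjective Φ := by
    refine (LinearMap.injective_iff_surjective_of_finrank_eq_finrank ?_).1 hi
    simp
  obtain ⟨⟨v, s, t⟩, rfl⟩ := hsurj z
  rw [hΦ]
  have hs : inner ℝ p (D v + (s • p + t • q)) = s := by
    simp only [inner_add_right, inner_smul_right, h.left_left, hp, hpq]
    ring
  have ht : inner ℝ q (D v + (s • p + t • q)) = t := by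
    simp only [inner_add_right, inner_smul_right, h.right_left, hq, hqp]
    ring
  have hv : pinv D (D v + (s • p + t • q)) = v := by
    rw [map_add, pinv_apply_map h.inj, pinv_eq_zero, add_zero]
    intro w
    rw [real_inner_comm]
    simp only [inner_add_left, inner_smul_left, h.left_left, h.right_left, mul_zero, add_zero]
  rw [hs, ht, hv, add_assoc]

lemma ext_inner (h : IsFrame D D' p q) {x y : EuclideanSpace ℝ (Fin (n + 2))}
    (hD : ∀ v, inner ℝ x (D v) = (inner ℝ y (D v) : ℝ)) (hp : inner ℝ x p = (inner ℝ y p : ℝ))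
    (hq : inner ℝ x q = (inner ℝ y q : ℝ)) : x = y := by
  refine ext_inner_right ℝ fun z => ?_
  rw [h.decomp z]
  simp only [inner_add_right, inner_smul_right, hD, hp, hq]

lemma pinv_left (h : IsFrame D D' p q) : pinv D p = 0 :=
  pinv_eq_zero fun w => by rw [real_inner_comm, h.left_left]

lemma pinv_right (h : IsFrame D D' p q) : pinv D q = 0 :=
  pinv_eq_zero fun w => by rw [real_inner_comm, h.right_left]

lemma ambShape_map (h : IsFrame D D' p q) (v : EuclideanSpace ℝ (Fin n)) :
    ambShape D D' (D v) = -D' v := by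
  simp [ambShape, pinv_apply_map h.inj]

lemma ambShape_left (h : IsFrame D D' p q) : ambShape D D' p = 0 := by
  simp [ambShape, h.pinv_left]

lemma ambShape_right (h : IsFrame D D' p q) : ambShape D D' q = 0 := by
  simp [ambShape, h.pinv_right]

lemma inner_left_ambShape (h : IsFrame D D' p q) (z : EuclideanSpace ℝ (Fin (n + 2))) :
    inner ℝ p (ambShape D D' z) = (0 : ℝ) := by
  simp [ambShape, h.left_right]

lemma inner_right_ambShape (h : IsFrame D D' p q) (z : EuclideanSpace ℝ (Fin (n + 2))) :
    inner ℝ q (ambShape D D' z) = (0 : ℝ) := by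
  simp [ambShape, h.right_right]

lemma ambShape_symm (h : IsFrame D D' p q) (x y : EuclideanSpace ℝ (Fin (n + 2))) :
    inner ℝ (ambShape D D' x) y = (inner ℝ x (ambShape D D' y) : ℝ) := by
  conv_lhs => rw [h.decomp y]
  conv_rhs => rw [h.decomp x]
  have e1 : ambShape D D' x = -D' (pinv D x) := by simp [ambShape]
  have e2 : ambShape D D' y = -D' (pinv D y) := by simp [ambShape]
  have l1 : inner ℝ (ambShape D D' x) p = (0 : ℝ) := by
    rw [real_inner_comm, h.inner_left_ambShape]
  have l2 : inner ℝ (ambShape D D' x) q = (0 : ℝ) := by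
    rw [real_inner_comm, h.inner_right_ambShape]
  simp only [inner_add_right, inner_add_left, inner_smul_left, inner_smul_right, l1, l2,
    h.inner_left_ambShape, h.inner_right_ambShape, mul_zero, add_zero]
  rw [e1, e2, inner_neg_left, inner_neg_right, h.symm, real_inner_comm]

lemma ambShape_map_eq_map (h : IsFrame D D' p q) (v : EuclideanSpace ℝ (Fin n)) :
    D (pinv D (D' v)) = D' v := by
  have := h.decomp (D' v)
  rw [h.left_right, h.right_right] at this
  simpa using this.symm

/-- The trace over the tangent space in terms of the inverse Gram matrix. -/
lemma sum_gram_inv_inner (h : IsFrame D D' p q)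
    (T : EuclideanSpace ℝ (Fin (n + 2)) →L[ℝ] EuclideanSpace ℝ (Fin (n + 2))) :
    ∑ i, ∑ j, (gram D)⁻¹ i j *
      inner ℝ (T (D (EuclideanSpace.single i 1))) (D (EuclideanSpace.single j 1))
      = opTrace T - inner ℝ p (T p) - inner ℝ q (T q) := by
  -- The identity splits into the tangential projection and two rank-one projections. The trace of
  -- the tangential summand is moved to the n-dimensional side by cyclicity.
  have hid : T = T ∘L (D ∘L pinv D) + (innerSL ℝ p).smulRight (T p)
      + (innerSL ℝ q).smulRight (T q) := by
    ext1 z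
    conv_lhs => rw [h.decomp z]
    simp
  have h1 : opTrace (T ∘L (D ∘L pinv D)) = ∑ i, ∑ j, (gram D)⁻¹ i j *
      inner ℝ (T (D (EuclideanSpace.single i 1))) (D (EuclideanSpace.single j 1)) := by
    rw [← ContinuousLinearMap.comp_assoc, opTrace_comp_comm, opTrace_euclidean]
    refine Finset.sum_congr rfl fun i _ => ?_
    simp only [ContinuousLinearMap.comp_apply, pinv_apply_coord]
    exact Finset.sum_congr rfl fun j _ => by rw [real_inner_comm]
  rw [← h1]
  conv_rhs => rw [hid]
  simp only [map_add, opTrace_smulRight, innerSL_apply_apply]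
  rw [← hid]
  ring

lemma comp_equiv (h : IsFrame D D' p q)
    (ε : EuclideanSpace ℝ (Fin n) ≃L[ℝ] EuclideanSpace ℝ (Fin n)) :
    IsFrame (D ∘L (ε : EuclideanSpace ℝ (Fin n) →L[ℝ] EuclideanSpace ℝ (Fin n)))
      (D' ∘L (ε : EuclideanSpace ℝ (Fin n) →L[ℝ] EuclideanSpace ℝ (Fin n))) p q where
  inj _ _ e := ε.injective (h.inj e)
  norm_left := h.norm_left
  norm_right := h.norm_right
  orth := h.orth
  left_left _ := h.left_left _
  left_right _ := h.left_right _
  right_left _ := h.right_left _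
  right_right _ := h.right_right _
  symm _ _ := h.symm _ _

lemma ambShape_comp_equiv (h : IsFrame D D' p q)
    (ε : EuclideanSpace ℝ (Fin n) ≃L[ℝ] EuclideanSpace ℝ (Fin n)) :
    ambShape (D ∘L (ε : EuclideanSpace ℝ (Fin n) →L[ℝ] EuclideanSpace ℝ (Fin n)))
      (D' ∘L (ε : EuclideanSpace ℝ (Fin n) →L[ℝ] EuclideanSpace ℝ (Fin n)))
      = ambShape D D' := by
  ext1 z
  simp [ambShape, pinv_comp_apply h.inj]

/-- The orthogonal projection to the tangent space. -/
lemma map_pinv (h : IsFrame D D' p q) (z : EuclideanSpace ℝ (Fin (n + 2))) :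
    D (pinv D z) = z - (inner ℝ p z : ℝ) • p - (inner ℝ q z : ℝ) • q := by
  rw [eq_sub_iff_add_eq, eq_sub_iff_add_eq, add_right_comm]
  exact (h.decomp z).symm

/-- Since `D'` takes its values in the range of `D`, the chosen left inverse is only evaluated where
it is forced, and so agrees with `pinv D`. This links the shape operator of the statement with
`ambShape`. -/
lemma leftInverse_comp (h : IsFrame D D' p q) :
    D.toLinearMap.leftInverse ∘ₗ (-D'.toLinearMap) = -(pinv D ∘L D').toLinearMap := by
  ext1 v
  simp only [LinearMap.comp_apply, LinearMap.neg_apply, ContinuousLinearMap.coe_coe, map_neg,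
    ContinuousLinearMap.coe_comp]
  rw [← h.ambShape_map_eq_map v]
  congr 1
  have := LinearMap.leftInverse_apply_of_inj (f := D.toLinearMap)
    (LinearMap.ker_eq_bot.2 h.inj) (pinv D (D' v))
  rw [← ContinuousLinearMap.coe_coe D, this]
  simp

lemma trace_leftInverse (h : IsFrame D D' p q) :
    LinearMap.trace ℝ _ (D.toLinearMap.leftInverse ∘ₗ (-D'.toLinearMap))
      = opTrace (ambShape D D') := by
  rw [h.leftInverse_comp, map_neg, ambShape, map_neg, opTrace_comp_comm]
  rfl

lemma trace_leftInverse_sq (h : IsFrame D D' p q) :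
    LinearMap.trace ℝ _ ((D.toLinearMap.leftInverse ∘ₗ (-D'.toLinearMap)) ∘ₗ
      (D.toLinearMap.leftInverse ∘ₗ (-D'.toLinearMap)))
      = opTrace (ambShape D D' ∘L ambShape D D') := by
  have : ambShape D D' ∘L ambShape D D' = D' ∘L (pinv D ∘L D' ∘L pinv D) := by
    ext1 z
    simp [ambShape]
  rw [h.leftInverse_comp, this, opTrace_comp_comm, opTrace_apply]
  congr 1
  ext1 v
  simp

end IsFrame

end Frame

/-! ### Calculus of a hypersurface in a coordinate domain -/

section Local

variable {U : Set (EuclideanSpace ℝ (Fin n))}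
  {F N : EuclideanSpace ℝ (Fin n) → EuclideanSpace ℝ (Fin (n + 2))}
  {y : EuclideanSpace ℝ (Fin n)}

/-! ### Smooth dependence on the point, and the differentiation of identities. -/

lemma contDiffOn_det {m : Type*} [Fintype m] [DecidableEq m] {X : Type*} [NormedAddCommGroup X]
    [NormedSpace ℝ X] {s : Set X} {G : X → Matrix m m ℝ}
    (hG : ∀ i j, ContDiffOn ℝ ∞ (fun y => G y i j) s) :
    ContDiffOn ℝ ∞ (fun y => (G y).det) s := by
  simp only [Matrix.det_apply]
  refine ContDiffOn.sum fun σ _ => ContDiffOn.const_smul _ ?_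
  exact contDiffOn_prod fun i _ => hG _ _

lemma contDiffOn_matrix_inv {m : Type*} [Fintype m] [DecidableEq m] {X : Type*}
    [NormedAddCommGroup X] [NormedSpace ℝ X] {s : Set X} {G : X → Matrix m m ℝ}
    (hG : ∀ i j, ContDiffOn ℝ ∞ (fun y => G y i j) s) (h0 : ∀ y ∈ s, (G y).det ≠ 0) (i j : m) :
    ContDiffOn ℝ ∞ (fun y => (G y)⁻¹ i j) s := by
  simp only [Matrix.inv_def, Ring.inverse_eq_inv', Matrix.smul_apply, smul_eq_mul]
  refine ((contDiffOn_det hG).inv h0).mul ?_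
  simp only [Matrix.adjugate_apply]
  refine contDiffOn_det fun k l => ?_
  by_cases hk : k = j
  · subst hk
    simpa using contDiffOn_const
  · simpa [Matrix.updateRow_ne hk] using hG k l

/-- The device by which geometric identities are differentiated: each side gets its own derivative
from the calculus rules, and uniqueness of the derivative equates the two. -/
lemma fderiv_eq_of_eqOn {X Y : Type*} [NormedAddCommGroup X] [NormedSpace ℝ X]
    [NormedAddCommGroup Y] [NormedSpace ℝ Y] {s : Set X} (hs : IsOpen s) {x : X} (hx : x ∈ s)
    {f g : X → Y} {f' g' : X →L[ℝ] Y} (hfg : ∀ z ∈ s, f z = g z) (hf : HasFDerivAt f f' x)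
    (hg : HasFDerivAt g g' x) : f' = g' :=
  hf.unique (hg.congr_of_eventuallyEq (Filter.eventually_of_mem (hs.mem_nhds hx) hfg))

lemma hasFDerivAt_of_contDiffOn {X Y : Type*} [NormedAddCommGroup X] [NormedSpace ℝ X]
    [NormedAddCommGroup Y] [NormedSpace ℝ Y] {s : Set X} (hs : IsOpen s) {x : X} (hx : x ∈ s)
    {f : X → Y} (hf : ContDiffOn ℝ ∞ f s) : HasFDerivAt f (fderiv ℝ f x) x :=
  ((hf.contDiffAt (hs.mem_nhds hx)).differentiableAt (by simp)).hasFDerivAt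

lemma contDiffOn_fderiv {X Y : Type*} [NormedAddCommGroup X] [NormedSpace ℝ X]
    [NormedAddCommGroup Y] [NormedSpace ℝ Y] {s : Set X} (hs : IsOpen s)
    {f : X → Y} (hf : ContDiffOn ℝ ∞ f s) : ContDiffOn ℝ ∞ (fderiv ℝ f) s :=
  hf.fderiv_of_isOpen hs (by simp)

/-- A pair `F, N` of maps on an open set `U ⊆ ℝⁿ` which consists of an immersion to the unit sphere
and a Gauss map of it. -/
structure IsLocalHypersurface (U : Set (EuclideanSpace ℝ (Fin n)))
    (F N : EuclideanSpace ℝ (Fin n) → EuclideanSpace ℝ (Fin (n + 2))) : Prop where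
  isOpen : IsOpen U
  smooth_left : ContDiffOn ℝ ∞ F U
  smooth_right : ContDiffOn ℝ ∞ N U
  inj : ∀ y ∈ U, Function.Injective (fderiv ℝ F y)
  norm_left : ∀ y ∈ U, ‖F y‖ = 1
  norm_right : ∀ y ∈ U, ‖N y‖ = 1
  orth : ∀ y ∈ U, inner ℝ (F y) (N y) = (0 : ℝ)
  normal : ∀ y ∈ U, ∀ v, inner ℝ (N y) (fderiv ℝ F y v) = (0 : ℝ)

/-- The ambient shape operator along a map of a coordinate domain. -/
def localShape (F N : EuclideanSpace ℝ (Fin n) → EuclideanSpace ℝ (Fin (n + 2)))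
    (y : EuclideanSpace ℝ (Fin n)) :
    EuclideanSpace ℝ (Fin (n + 2)) →L[ℝ] EuclideanSpace ℝ (Fin (n + 2)) :=
  ambShape (fderiv ℝ F y) (fderiv ℝ N y)

/-- The component matrix of the metric induced by `F`. -/
def inducedMetric (F : EuclideanSpace ℝ (Fin n) → EuclideanSpace ℝ (Fin (n + 2)))
    (y : EuclideanSpace ℝ (Fin n)) : Matrix (Fin n) (Fin n) ℝ :=
  gram (fderiv ℝ F y)

namespace IsLocalHypersurface

lemma hasFDerivAt_left (h : IsLocalHypersurface U F N) (hy : y ∈ U) :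
    HasFDerivAt F (fderiv ℝ F y) y :=
  hasFDerivAt_of_contDiffOn h.isOpen hy h.smooth_left

lemma hasFDerivAt_right (h : IsLocalHypersurface U F N) (hy : y ∈ U) :
    HasFDerivAt N (fderiv ℝ N y) y :=
  hasFDerivAt_of_contDiffOn h.isOpen hy h.smooth_right

lemma hasFDerivAt_fderiv_left (h : IsLocalHypersurface U F N) (hy : y ∈ U) :
    HasFDerivAt (fderiv ℝ F) (fderiv ℝ (fderiv ℝ F) y) y :=
  hasFDerivAt_of_contDiffOn h.isOpen hy (contDiffOn_fderiv h.isOpen h.smooth_left)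

lemma hasFDerivAt_fderiv_right (h : IsLocalHypersurface U F N) (hy : y ∈ U) :
    HasFDerivAt (fderiv ℝ N) (fderiv ℝ (fderiv ℝ N) y) y :=
  hasFDerivAt_of_contDiffOn h.isOpen hy (contDiffOn_fderiv h.isOpen h.smooth_right)

lemma second_symm_left (h : IsLocalHypersurface U F N) (hy : y ∈ U)
    (v w : EuclideanSpace ℝ (Fin n)) :
    fderiv ℝ (fderiv ℝ F) y v w = fderiv ℝ (fderiv ℝ F) y w v :=
  (h.smooth_left.contDiffAt (h.isOpen.mem_nhds hy)).isSymmSndFDerivAt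
    (by simpa using WithTop.coe_le_coe.2 (le_top : (2 : ℕ∞) ≤ ⊤)) v w

lemma second_symm_right (h : IsLocalHypersurface U F N) (hy : y ∈ U)
    (v w : EuclideanSpace ℝ (Fin n)) :
    fderiv ℝ (fderiv ℝ N) y v w = fderiv ℝ (fderiv ℝ N) y w v :=
  (h.smooth_right.contDiffAt (h.isOpen.mem_nhds hy)).isSymmSndFDerivAt
    (by simpa using WithTop.coe_le_coe.2 (le_top : (2 : ℕ∞) ≤ ⊤)) v w

/-- Derivative of ⟨N, dF w⟩ = 0. The left side is symmetric in `v`, `w`, which is what makes the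
shape operator self-adjoint. -/
lemma inner_right_second (h : IsLocalHypersurface U F N) (hy : y ∈ U)
    (v w : EuclideanSpace ℝ (Fin n)) :
    inner ℝ (N y) (fderiv ℝ (fderiv ℝ F) y v w)
      = -(inner ℝ (fderiv ℝ N y v) (fderiv ℝ F y w) : ℝ) := by
  have h1 := (h.hasFDerivAt_right hy).inner ℝ
    ((h.hasFDerivAt_fderiv_left hy).clm_apply (hasFDerivAt_const w y))
  have h2 := fderiv_eq_of_eqOn h.isOpen hy (fun z hz => h.normal z hz w) h1
    (hasFDerivAt_const (0 : ℝ) y)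
  have h3 := DFunLike.congr_fun h2 v
  simp at h3
  linarith

lemma inner_left_first (h : IsLocalHypersurface U F N) (hy : y ∈ U)
    (v : EuclideanSpace ℝ (Fin n)) : inner ℝ (F y) (fderiv ℝ F y v) = (0 : ℝ) := by
  have h1 := (h.hasFDerivAt_left hy).inner ℝ (h.hasFDerivAt_left hy)
  have h2 := fderiv_eq_of_eqOn h.isOpen hy
    (fun z hz => by rw [real_inner_self_eq_norm_sq, h.norm_left z hz]; norm_num) h1
    (hasFDerivAt_const (1 : ℝ) y)
  have h3 := DFunLike.congr_fun h2 v
  simp [real_inner_comm] at h3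
  exact h3

lemma isFrame (h : IsLocalHypersurface U F N) (hy : y ∈ U) :
    IsFrame (fderiv ℝ F y) (fderiv ℝ N y) (F y) (N y) where
  inj := h.inj y hy
  norm_left := by rw [real_inner_self_eq_norm_sq, h.norm_left y hy]; norm_num
  norm_right := by rw [real_inner_self_eq_norm_sq, h.norm_right y hy]; norm_num
  orth := h.orth y hy
  left_left := h.inner_left_first hy
  left_right v := by
    have h1 := (h.hasFDerivAt_left hy).inner ℝ (h.hasFDerivAt_right hy)
    have h2 := fderiv_eq_of_eqOn h.isOpen hy h.orth h1 (hasFDerivAt_const (0 : ℝ) y)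
    have h3 := DFunLike.congr_fun h2 v
    have h4 := h.normal y hy v
    rw [real_inner_comm] at h4
    simpa [h4] using h3
  right_left := h.normal y hy
  right_right v := by
    have h1 := (h.hasFDerivAt_right hy).inner ℝ (h.hasFDerivAt_right hy)
    have h2 := fderiv_eq_of_eqOn h.isOpen hy
      (fun z hz => by rw [real_inner_self_eq_norm_sq, h.norm_right z hz]; norm_num) h1
      (hasFDerivAt_const (1 : ℝ) y)
    have h3 := DFunLike.congr_fun h2 v
    simp [real_inner_comm] at h3
    exact h3
  symm v w := by
    have h1 := h.inner_right_second hy v w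
    have h2 := h.inner_right_second hy w v
    rw [h.second_symm_left hy] at h2
    linarith

lemma inner_left_second (h : IsLocalHypersurface U F N) (hy : y ∈ U)
    (v w : EuclideanSpace ℝ (Fin n)) :
    inner ℝ (F y) (fderiv ℝ (fderiv ℝ F) y v w)
      = -(inner ℝ (fderiv ℝ F y v) (fderiv ℝ F y w) : ℝ) := by
  have h1 := (h.hasFDerivAt_left hy).inner ℝ
    ((h.hasFDerivAt_fderiv_left hy).clm_apply (hasFDerivAt_const w y))
  have h2 := fderiv_eq_of_eqOn h.isOpen hy (fun z hz => (h.isFrame hz).left_left w) h1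
    (hasFDerivAt_const (0 : ℝ) y)
  have h3 := DFunLike.congr_fun h2 v
  simp at h3
  linarith

lemma contDiffOn_inducedMetric (h : IsLocalHypersurface U F N) (i j : Fin n) :
    ContDiffOn ℝ ∞ (fun y => inducedMetric F y i j) U := by
  have h1 := contDiffOn_fderiv h.isOpen h.smooth_left
  exact (h1.clm_apply contDiffOn_const).inner ℝ (h1.clm_apply contDiffOn_const)

lemma posDef_inducedMetric (h : IsLocalHypersurface U F N) (hy : y ∈ U) :
    (inducedMetric F y).PosDef :=
  gram_posDef (h.inj y hy)

lemma contDiffOn_inducedMetric_inv (h : IsLocalHypersurface U F N) (i j : Fin n) :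
    ContDiffOn ℝ ∞ (fun y => (inducedMetric F y)⁻¹ i j) U :=
  contDiffOn_matrix_inv h.contDiffOn_inducedMetric
    (fun _ hy => (h.posDef_inducedMetric hy).det_pos.ne') i j

lemma contDiffOn_pinv (h : IsLocalHypersurface U F N) :
    ContDiffOn ℝ ∞ (fun y => pinv (fderiv ℝ F y)) U := by
  have h1 := contDiffOn_fderiv h.isOpen h.smooth_left
  unfold pinv
  refine ContDiffOn.sum fun i _ => ContDiffOn.sum fun j _ => ?_
  refine (h.contDiffOn_inducedMetric_inv i j).smul ?_
  exact (((innerSL ℝ).contDiff.comp_contDiffOn (h1.clm_apply contDiffOn_const))).smulRight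
    contDiffOn_const

lemma contDiffOn_localShape (h : IsLocalHypersurface U F N) :
    ContDiffOn ℝ ∞ (localShape F N) U :=
  ((contDiffOn_fderiv h.isOpen h.smooth_right).clm_comp h.contDiffOn_pinv).neg

lemma hasFDerivAt_localShape (h : IsLocalHypersurface U F N) (hy : y ∈ U) :
    HasFDerivAt (localShape F N) (fderiv ℝ (localShape F N) y) y :=
  hasFDerivAt_of_contDiffOn h.isOpen hy h.contDiffOn_localShape

lemma fderiv_localShape_map (h : IsLocalHypersurface U F N) (hy : y ∈ U)
    (w v : EuclideanSpace ℝ (Fin n)) :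
    fderiv ℝ (localShape F N) y w (fderiv ℝ F y v)
      = -fderiv ℝ (fderiv ℝ N) y w v - localShape F N y (fderiv ℝ (fderiv ℝ F) y w v) := by
  have h1 := (h.hasFDerivAt_localShape hy).clm_apply
    ((h.hasFDerivAt_fderiv_left hy).clm_apply (hasFDerivAt_const v y))
  have h2 := ((h.hasFDerivAt_fderiv_right hy).clm_apply (hasFDerivAt_const v y)).neg
  have h3 := fderiv_eq_of_eqOn h.isOpen hy (fun z hz => (h.isFrame hz).ambShape_map v) h1 h2
  have h4 := DFunLike.congr_fun h3 w
  simp at h4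
  exact eq_sub_of_add_eq' h4

/-- The Codazzi equation. -/
lemma fderiv_localShape_map_comm (h : IsLocalHypersurface U F N) (hy : y ∈ U)
    (w v : EuclideanSpace ℝ (Fin n)) :
    fderiv ℝ (localShape F N) y w (fderiv ℝ F y v)
      = fderiv ℝ (localShape F N) y v (fderiv ℝ F y w) := by
  rw [h.fderiv_localShape_map hy, h.fderiv_localShape_map hy, h.second_symm_left hy,
    h.second_symm_right hy]

/-- The ambient derivative of A also has normal components: A annihilates F and N at every point, so
differentiating AF = 0 and AN = 0 moves the derivative to F and N. This lemma and the next one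
record these corrections. -/
lemma fderiv_localShape_left (h : IsLocalHypersurface U F N) (hy : y ∈ U)
    (w : EuclideanSpace ℝ (Fin n)) :
    fderiv ℝ (localShape F N) y w (F y) = fderiv ℝ N y w := by
  have h1 := (h.hasFDerivAt_localShape hy).clm_apply (h.hasFDerivAt_left hy)
  have h3 := fderiv_eq_of_eqOn h.isOpen hy (fun z hz => (h.isFrame hz).ambShape_left) h1
    (hasFDerivAt_const _ _)
  have h4 := DFunLike.congr_fun h3 w
  have h5 := (h.isFrame hy).ambShape_map w
  simp only [add_apply, ContinuousLinearMap.comp_apply,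
    ContinuousLinearMap.flip_apply, zero_apply] at h4
  rw [localShape, h5] at h4
  exact (neg_add_eq_zero.1 h4).symm

lemma fderiv_localShape_right (h : IsLocalHypersurface U F N) (hy : y ∈ U)
    (w : EuclideanSpace ℝ (Fin n)) :
    fderiv ℝ (localShape F N) y w (N y)
      = localShape F N y (localShape F N y (fderiv ℝ F y w)) := by
  have h1 := (h.hasFDerivAt_localShape hy).clm_apply (h.hasFDerivAt_right hy)
  have h3 := fderiv_eq_of_eqOn h.isOpen hy (fun z hz => (h.isFrame hz).ambShape_right) h1
    (hasFDerivAt_const _ _)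
  have h4 := DFunLike.congr_fun h3 w
  have h5 : localShape F N y (fderiv ℝ F y w) = _ := (h.isFrame hy).ambShape_map w
  simp only [add_apply, ContinuousLinearMap.comp_apply,
    ContinuousLinearMap.flip_apply, zero_apply] at h4
  rw [h5, map_neg]
  exact (neg_eq_of_add_eq_zero_right h4).symm

lemma fderiv_localShape_symm (h : IsLocalHypersurface U F N) (hy : y ∈ U)
    (w : EuclideanSpace ℝ (Fin n)) (a b : EuclideanSpace ℝ (Fin (n + 2))) :
    inner ℝ (fderiv ℝ (localShape F N) y w a) b
      = (inner ℝ a (fderiv ℝ (localShape F N) y w b) : ℝ) := by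
  have h1 := ((h.hasFDerivAt_localShape hy).clm_apply (hasFDerivAt_const a y)).inner ℝ
    (hasFDerivAt_const b y)
  have h2 := (hasFDerivAt_const a y).inner ℝ
    ((h.hasFDerivAt_localShape hy).clm_apply (hasFDerivAt_const b y))
  have h3 := fderiv_eq_of_eqOn h.isOpen hy (fun z hz => (h.isFrame hz).ambShape_symm a b) h1 h2
  have h4 := DFunLike.congr_fun h3 w
  simpa using h4

/-- The Christoffel symbols are the components of the tangential part of `∂ᵢ ∂ⱼ F`. -/
lemma christoffel_eq (h : IsLocalHypersurface U F N) (hy : y ∈ U) (k i j : Fin n) :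
    christoffel (inducedMetric F) k i j y = pinv (fderiv ℝ F y)
      (fderiv ℝ (fderiv ℝ F) y (EuclideanSpace.single i 1) (EuclideanSpace.single j 1)) k := by
  have hd : ∀ i j l : Fin n, pderiv i (fun z => inducedMetric F z j l) y
      = inner ℝ (fderiv ℝ (fderiv ℝ F) y (EuclideanSpace.single i 1) (EuclideanSpace.single j 1))
          (fderiv ℝ F y (EuclideanSpace.single l 1))
        + inner ℝ (fderiv ℝ F y (EuclideanSpace.single j 1))
          (fderiv ℝ (fderiv ℝ F) y (EuclideanSpace.single i 1) (EuclideanSpace.single l 1)) := by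
    intro i j l
    have h1 := ((h.hasFDerivAt_fderiv_left hy).clm_apply
      (hasFDerivAt_const (EuclideanSpace.single j (1 : ℝ)) y)).inner ℝ
        ((h.hasFDerivAt_fderiv_left hy).clm_apply
          (hasFDerivAt_const (EuclideanSpace.single l (1 : ℝ)) y))
    have h2 : pderiv i (fun z => inducedMetric F z j l) y = _ :=
      DFunLike.congr_fun h1.fderiv (EuclideanSpace.single i 1)
    rw [h2]
    simp
    ring
  rw [christoffel, pinv_apply_coord, Finset.mul_sum]
  refine Finset.sum_congr rfl fun l _ => ?_
  -- By symmetry of second derivatives the three metric derivatives combine to 2⟨∂ᵢ∂ⱼF, ∂ₗF⟩, which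
  -- cancels the factor ½.
  rw [hd, hd, hd, h.second_symm_left hy (EuclideanSpace.single j 1) (EuclideanSpace.single i 1),
    h.second_symm_left hy (EuclideanSpace.single l 1) (EuclideanSpace.single i 1),
    h.second_symm_left hy (EuclideanSpace.single l 1) (EuclideanSpace.single j 1),
    real_inner_comm (fderiv ℝ F y (EuclideanSpace.single l 1)),
    real_inner_comm (fderiv ℝ F y (EuclideanSpace.single j 1)), inducedMetric]
  ring

end IsLocalHypersurface

end Local

/-! ### The Laplacian of the height functions and the Gauss equation -/

section LaplacianGauss

variable {U : Set (EuclideanSpace ℝ (Fin n))}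
  {F N : EuclideanSpace ℝ (Fin n) → EuclideanSpace ℝ (Fin (n + 2))}
  {y : EuclideanSpace ℝ (Fin n)}

namespace IsFrame

variable {D D' : EuclideanSpace ℝ (Fin n) →L[ℝ] EuclideanSpace ℝ (Fin (n + 2))}
  {p q : EuclideanSpace ℝ (Fin (n + 2))}

lemma sum_gram_inv_id (h : IsFrame D D' p q) :
    ∑ i, ∑ j, (gram D)⁻¹ i j *
      (inner ℝ (D (EuclideanSpace.single i 1)) (D (EuclideanSpace.single j 1)) : ℝ) = n := by
  have := h.sum_gram_inv_inner (ContinuousLinearMap.id ℝ _)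
  simp only [ContinuousLinearMap.id_apply, h.norm_left, h.norm_right] at this
  rw [this, opTrace_apply]
  simp
  ring

lemma sum_gram_inv_shape (h : IsFrame D D' p q) :
    ∑ i, ∑ j, (gram D)⁻¹ i j * (inner ℝ (ambShape D D' (D (EuclideanSpace.single i 1)))
      (D (EuclideanSpace.single j 1)) : ℝ) = opTrace (ambShape D D') := by
  rw [h.sum_gram_inv_inner, h.inner_left_ambShape, h.inner_right_ambShape]
  ring

lemma sum_gram_inv_shape_sq (h : IsFrame D D' p q) :
    ∑ i, ∑ j, (gram D)⁻¹ i j *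
      (inner ℝ (ambShape D D' (ambShape D D' (D (EuclideanSpace.single i 1))))
        (D (EuclideanSpace.single j 1)) : ℝ) = opTrace (ambShape D D' ∘L ambShape D D') := by
  have := h.sum_gram_inv_inner (ambShape D D' ∘L ambShape D D')
  simp only [ContinuousLinearMap.comp_apply, h.inner_left_ambShape, h.inner_right_ambShape] at this
  rw [this]
  ring

end IsFrame

namespace IsLocalHypersurface

lemma opTrace_fderiv_localShape (h : IsLocalHypersurface U F N) (hy : y ∈ U) {H : ℝ}
    (hH : ∀ z ∈ U, opTrace (localShape F N z) = H) (w : EuclideanSpace ℝ (Fin n)) :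
    opTrace (fderiv ℝ (localShape F N) y w) = 0 := by
  have h1 := opTrace.hasFDerivAt.comp y (h.hasFDerivAt_localShape hy)
  have h2 := fderiv_eq_of_eqOn h.isOpen hy hH h1 (hasFDerivAt_const _ _)
  simpa using DFunLike.congr_fun h2 w

/-- The contracted Codazzi equation div A = ∇H = 0. Only the normal components survive, and they are
those created by the ambient derivative. This is the source of the formula for Δν. -/
lemma sum_gram_inv_fderiv_localShape (h : IsLocalHypersurface U F N) (hy : y ∈ U) {H : ℝ}
    (hH : ∀ z ∈ U, opTrace (localShape F N z) = H) :
    ∑ i, ∑ j, (inducedMetric F y)⁻¹ i j •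
      fderiv ℝ (localShape F N) y (EuclideanSpace.single i 1)
        (fderiv ℝ F y (EuclideanSpace.single j 1))
      = opTrace (localShape F N y ∘L localShape F N y) • N y - H • F y := by
  have hf := h.isFrame hy
  have key : ∀ z, inner ℝ (∑ i, ∑ j, (inducedMetric F y)⁻¹ i j •
      fderiv ℝ (localShape F N) y (EuclideanSpace.single i 1)
        (fderiv ℝ F y (EuclideanSpace.single j 1))) z
      = ∑ i, ∑ j, (inducedMetric F y)⁻¹ i j *
        (inner ℝ (fderiv ℝ (localShape F N) y (EuclideanSpace.single i 1) z)
          (fderiv ℝ F y (EuclideanSpace.single j 1)) : ℝ) := by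
    intro z
    simp only [sum_inner, inner_smul_left, RCLike.conj_to_real]
    refine Finset.sum_congr rfl fun i _ => Finset.sum_congr rfl fun j _ => ?_
    rw [h.fderiv_localShape_symm hy, real_inner_comm]
  have hqp : inner ℝ (N y) (F y) = (0 : ℝ) := by rw [real_inner_comm, hf.orth]
  -- Tested on `dF v`, Codazzi turns the contraction into the trace of the derivative of A along
  -- `v`, which is zero; its diagonal entries on F and N vanish as well. Tested on F and N, the
  -- corrections give −tr A and tr A².
  refine hf.ext_inner (fun v => ?_) ?_ ?_
  · rw [key]
    simp only [h.fderiv_localShape_map_comm hy _ v]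
    have h1 := hf.sum_gram_inv_inner (fderiv ℝ (localShape F N) y v)
    rw [h.fderiv_localShape_left hy, h.fderiv_localShape_right hy, hf.left_right,
      localShape, hf.inner_right_ambShape] at h1
    have h2 := h.opTrace_fderiv_localShape hy hH v
    unfold inducedMetric
    rw [h1, show fderiv ℝ (localShape F N) y v
      = fderiv ℝ (fun y => ambShape (fderiv ℝ F y) (fderiv ℝ N y)) y v from rfl] at *
    rw [h2]
    simp [inner_sub_left, inner_smul_left, hf.left_left, hf.right_left]
  · rw [key]
    have h1 := hf.sum_gram_inv_shape
    have h2 : ∀ i, fderiv ℝ (localShape F N) y (EuclideanSpace.single i 1) (F y)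
        = - ambShape (fderiv ℝ F y) (fderiv ℝ N y) (fderiv ℝ F y (EuclideanSpace.single i 1)) := by
      intro i
      rw [h.fderiv_localShape_left hy, hf.ambShape_map, neg_neg]
    simp only [h2, inner_neg_left, mul_neg, Finset.sum_neg_distrib]
    unfold inducedMetric
    rw [h1, inner_sub_left, inner_smul_left, inner_smul_left, hqp, hf.norm_left, ← hH y hy]
    simp [localShape]
  · rw [key]
    have h1 := hf.sum_gram_inv_shape_sq
    simp only [h.fderiv_localShape_right hy]
    unfold inducedMetric localShape
    rw [h1, inner_sub_left, inner_smul_left, inner_smul_left, hf.orth, hf.norm_right]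
    simp

/-- The Laplacian of `⟨a, F⟩ + ⟨b, N⟩` when the mean curvature is constant. -/
lemma coordLaplacian_height (h : IsLocalHypersurface U F N) (hy : y ∈ U) {H : ℝ}
    (hH : ∀ z ∈ U, opTrace (localShape F N z) = H) (a b : EuclideanSpace ℝ (Fin (n + 2))) :
    coordLaplacian (inducedMetric F) (fun z => inner ℝ a (F z) + inner ℝ b (N z)) y
      = inner ℝ a (H • N y - (n : ℝ) • F y)
        + inner ℝ b (H • F y - opTrace (localShape F N y ∘L localShape F N y) • N y) := by
  have hf := h.isFrame hy
  have hu : ∀ z ∈ U, HasFDerivAt (fun z => (inner ℝ a (F z) + inner ℝ b (N z) : ℝ))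
      (innerSL ℝ a ∘L fderiv ℝ F z + innerSL ℝ b ∘L fderiv ℝ N z) z := fun z hz =>
    ((innerSL ℝ a).hasFDerivAt.comp z (h.hasFDerivAt_left hz)).add
      ((innerSL ℝ b).hasFDerivAt.comp z (h.hasFDerivAt_right hz))
  have hp : ∀ j, ∀ z ∈ U, pderiv j (fun z => (inner ℝ a (F z) + inner ℝ b (N z) : ℝ)) z
      = inner ℝ a (fderiv ℝ F z (EuclideanSpace.single j 1))
        + inner ℝ b (fderiv ℝ N z (EuclideanSpace.single j 1)) := by
    intro j z hz
    rw [pderiv, (hu z hz).fderiv]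
    simp
  have hpp : ∀ i j, pderiv i (pderiv j (fun z => (inner ℝ a (F z) + inner ℝ b (N z) : ℝ))) y
      = inner ℝ a (fderiv ℝ (fderiv ℝ F) y (EuclideanSpace.single i 1) (EuclideanSpace.single j 1))
        + inner ℝ b (fderiv ℝ (fderiv ℝ N) y (EuclideanSpace.single i 1)
          (EuclideanSpace.single j 1)) := by
    intro i j
    have h1 := ((innerSL ℝ a).hasFDerivAt.comp y ((h.hasFDerivAt_fderiv_left hy).clm_apply
      (hasFDerivAt_const (EuclideanSpace.single j (1 : ℝ)) y))).add
        ((innerSL ℝ b).hasFDerivAt.comp y ((h.hasFDerivAt_fderiv_right hy).clm_apply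
      (hasFDerivAt_const (EuclideanSpace.single j (1 : ℝ)) y)))
    rw [pderiv, (h1.congr_of_eventuallyEq
      (Filter.eventually_of_mem (h.isOpen.mem_nhds hy) (hp j))).fderiv]
    simp
  -- The covariant Hessian: subtracting the Christoffel term removes the tangential part of ∂ᵢ∂ⱼF,
  -- leaving −gᵢⱼF + hᵢⱼN, where hᵢⱼ = ⟨A ∂ᵢF, ∂ⱼF⟩. On N the same subtraction leaves minus the
  -- derivative of A.
  have hterm : ∀ i j, pderiv i (pderiv j (fun z => (inner ℝ a (F z) + inner ℝ b (N z) : ℝ))) y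
      - ∑ k, christoffel (inducedMetric F) k i j y *
        pderiv k (fun z => (inner ℝ a (F z) + inner ℝ b (N z) : ℝ)) y
      = -(inner ℝ (fderiv ℝ F y (EuclideanSpace.single i 1))
          (fderiv ℝ F y (EuclideanSpace.single j 1)) * inner ℝ a (F y))
        + inner ℝ (ambShape (fderiv ℝ F y) (fderiv ℝ N y)
          (fderiv ℝ F y (EuclideanSpace.single i 1)))
            (fderiv ℝ F y (EuclideanSpace.single j 1)) * inner ℝ a (N y)
        - inner ℝ b (fderiv ℝ (localShape F N) y (EuclideanSpace.single i 1)
        (fderiv ℝ F y (EuclideanSpace.single j 1))) := by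
    intro i j
    set w := fderiv ℝ (fderiv ℝ F) y (EuclideanSpace.single i 1) (EuclideanSpace.single j 1)
      with hw
    have h1 : ∑ k, christoffel (inducedMetric F) k i j y *
        pderiv k (fun z => (inner ℝ a (F z) + inner ℝ b (N z) : ℝ)) y
        = inner ℝ a (fderiv ℝ F y (pinv (fderiv ℝ F y) w))
          + inner ℝ b (fderiv ℝ N y (pinv (fderiv ℝ F y) w)) := by
      have := map_eq_sum (innerSL ℝ a ∘L fderiv ℝ F y + innerSL ℝ b ∘L fderiv ℝ N y)
        (pinv (fderiv ℝ F y) w)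
      simp only [add_apply, ContinuousLinearMap.comp_apply, innerSL_apply_apply] at this
      rw [this]
      refine Finset.sum_congr rfl fun k _ => ?_
      rw [h.christoffel_eq hy, hp k y hy, smul_eq_mul]
    rw [h1, hpp, h.fderiv_localShape_map hy, hf.map_pinv, h.inner_left_second hy,
      h.inner_right_second hy, hf.ambShape_map]
    simp only [← hw, localShape, ambShape, inner_sub_right, inner_smul_right, inner_neg_right,
      inner_neg_left, neg_apply, ContinuousLinearMap.comp_apply]
    ring
  have hZ := congrArg (fun z => (inner ℝ b z : ℝ)) (h.sum_gram_inv_fderiv_localShape hy hH)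
  simp only [inner_sum, inner_smul_right, inner_sub_right] at hZ
  have hI := hf.sum_gram_inv_id
  have hA := hf.sum_gram_inv_shape
  rw [show opTrace (ambShape (fderiv ℝ F y) (fderiv ℝ N y)) = H from hH y hy] at hA
  simp only [coordLaplacian, hterm, mul_add, mul_sub, Finset.sum_add_distrib,
    Finset.sum_sub_distrib, hZ, mul_neg, Finset.sum_neg_distrib, ← mul_assoc, ← Finset.sum_mul]
  rw [show inducedMetric F y = gram (fderiv ℝ F y) from rfl, hI, hA]
  simp only [inner_sub_right, inner_smul_right]
  ring

/-- Half of the curvature tensor, found by differentiating the Gauss formula. The third derivative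
of F is symmetric in `i` and `j`, so it disappears on antisymmetrising and only the products of
fundamental forms remain. -/
lemma fderiv_christoffel (h : IsLocalHypersurface U F N) (hy : y ∈ U) (l i j k : Fin n) :
    pderiv i (christoffel (inducedMetric F) l j k) y
      + ∑ p, christoffel (inducedMetric F) l i p y * christoffel (inducedMetric F) p j k y
      = pinv (fderiv ℝ F y) (fderiv ℝ (fderiv ℝ fun z => fderiv ℝ F z (EuclideanSpace.single k 1)) y
          (EuclideanSpace.single i 1) (EuclideanSpace.single j 1)) l
        + inner ℝ (fderiv ℝ F y (EuclideanSpace.single j 1))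
          (fderiv ℝ F y (EuclideanSpace.single k 1)) * (EuclideanSpace.single i (1 : ℝ)) l
        - inner ℝ (localShape F N y (fderiv ℝ F y (EuclideanSpace.single j 1)))
          (fderiv ℝ F y (EuclideanSpace.single k 1))
          * pinv (fderiv ℝ F y) (fderiv ℝ N y (EuclideanSpace.single i 1)) l := by
  have hf := h.isFrame hy
  have hsF := contDiffOn_fderiv h.isOpen h.smooth_left
  have hsFk : ContDiffOn ℝ ∞ (fun z => fderiv ℝ F z (EuclideanSpace.single k 1)) U :=
    hsF.clm_apply contDiffOn_const
  have hD2 : ∀ z ∈ U, fderiv ℝ (fun z => fderiv ℝ F z (EuclideanSpace.single k 1)) z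
      (EuclideanSpace.single j 1) = fderiv ℝ (fderiv ℝ F) z (EuclideanSpace.single j 1)
        (EuclideanSpace.single k 1) := by
    intro z hz
    rw [((h.hasFDerivAt_fderiv_left hz).clm_apply (hasFDerivAt_const _ z)).fderiv]
    simp
  have hsW : ContDiffOn ℝ ∞ (fun z => fderiv ℝ (fderiv ℝ F) z (EuclideanSpace.single j 1)
      (EuclideanSpace.single k 1)) U :=
    ((contDiffOn_fderiv h.isOpen hsF).clm_apply contDiffOn_const).clm_apply contDiffOn_const
  set W := fun z => fderiv ℝ (fderiv ℝ F) z (EuclideanSpace.single j 1)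
    (EuclideanSpace.single k 1) with hW
  have hsΓ : ContDiffOn ℝ ∞ (fun z => pinv (fderiv ℝ F z) (W z)) U :=
    h.contDiffOn_pinv.clm_apply hsW
  have hΓ := hasFDerivAt_of_contDiffOn h.isOpen hy hsΓ
  have hWd := hasFDerivAt_of_contDiffOn h.isOpen hy hsW
  have hF := h.hasFDerivAt_left hy
  have hN := h.hasFDerivAt_right hy
  have lhs := (h.hasFDerivAt_fderiv_left hy).clm_apply hΓ
  have rhs := (hWd.sub ((hF.inner ℝ hWd).smul hF)).sub ((hN.inner ℝ hWd).smul hN)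
  -- The identity being differentiated is dF(Γ) = ∂ⱼ∂ₖF minus its components along F and N.
  -- Projecting the result back to the tangent space kills the derivatives of these two
  -- coefficients.
  have e1 := fderiv_eq_of_eqOn h.isOpen hy (fun z hz => (h.isFrame hz).map_pinv (W z)) lhs rhs
  have e2 := congrArg (fun z => pinv (fderiv ℝ F y) z l)
    (DFunLike.congr_fun e1 (EuclideanSpace.single i 1))
  have hWi : fderiv ℝ W y (EuclideanSpace.single i 1) = fderiv ℝ (fderiv ℝ fun z =>
      fderiv ℝ F z (EuclideanSpace.single k 1)) y
          (EuclideanSpace.single i 1) (EuclideanSpace.single j 1) := by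
    have h3 := (hasFDerivAt_of_contDiffOn h.isOpen hy
      (contDiffOn_fderiv h.isOpen hsFk)).clm_apply
        (hasFDerivAt_const (EuclideanSpace.single j (1 : ℝ)) y)
    rw [fderiv_eq_of_eqOn h.isOpen hy (fun z hz => (hD2 z hz).symm) hWd h3]
    simp
  have hΓi : pderiv i (christoffel (inducedMetric F) l j k) y
      = fderiv ℝ (fun z => pinv (fderiv ℝ F z) (W z)) y (EuclideanSpace.single i 1) l := by
    have h3 := (EuclideanSpace.proj l : EuclideanSpace ℝ (Fin n) →L[ℝ] ℝ).hasFDerivAt.comp y hΓ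
    rw [pderiv, (h3.congr_of_eventuallyEq (Filter.eventually_of_mem (h.isOpen.mem_nhds hy)
      fun z hz => h.christoffel_eq hz l j k)).fderiv]
    simp
  have hsum : pinv (fderiv ℝ F y) (fderiv ℝ (fderiv ℝ F) y (EuclideanSpace.single i 1)
      (pinv (fderiv ℝ F y) (W y))) l
      = ∑ p, christoffel (inducedMetric F) l i p y * christoffel (inducedMetric F) p j k y := by
    rw [map_eq_sum (fderiv ℝ (fderiv ℝ F) y (EuclideanSpace.single i 1)), map_sum]
    simp only [map_smul, WithLp.ofLp_sum, Finset.sum_apply, WithLp.ofLp_smul, Pi.smul_apply,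
      smul_eq_mul]
    refine Finset.sum_congr rfl fun p _ => ?_
    rw [h.christoffel_eq hy, h.christoffel_eq hy, mul_comm]
  have hb1 : inner ℝ (F y) (W y) = _ := h.inner_left_second hy _ _
  have hb2 : inner ℝ (N y) (W y) = _ := h.inner_right_second hy _ _
  have hb3 : localShape F N y (fderiv ℝ F y (EuclideanSpace.single j 1)) = _ := hf.ambShape_map _
  simp only [add_apply, sub_apply, ContinuousLinearMap.comp_apply,
    ContinuousLinearMap.flip_apply, smul_apply,
    ContinuousLinearMap.smulRight_apply, map_add, map_sub, map_smul,
    hf.pinv_left, hf.pinv_right, pinv_apply_map hf.inj, PiLp.add_apply, PiLp.sub_apply,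
    PiLp.smul_apply, smul_zero, PiLp.zero_apply, hb1, hb2, hWi, hsum, smul_eq_mul] at e2
  rw [hΓi, hb3, inner_neg_left]
  linarith

/-- The Gauss equation for the curvature tensor. -/
lemma riemannTensor_eq (h : IsLocalHypersurface U F N) (hy : y ∈ U) (l k i j : Fin n) :
    riemannTensor (inducedMetric F) l k i j y
      = inner ℝ (fderiv ℝ F y (EuclideanSpace.single j 1))
          (fderiv ℝ F y (EuclideanSpace.single k 1)) * (EuclideanSpace.single i (1 : ℝ)) l
        - inner ℝ (localShape F N y (fderiv ℝ F y (EuclideanSpace.single j 1)))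
          (fderiv ℝ F y (EuclideanSpace.single k 1))
          * pinv (fderiv ℝ F y) (fderiv ℝ N y (EuclideanSpace.single i 1)) l
        - (inner ℝ (fderiv ℝ F y (EuclideanSpace.single i 1))
          (fderiv ℝ F y (EuclideanSpace.single k 1)) * (EuclideanSpace.single j (1 : ℝ)) l
        - inner ℝ (localShape F N y (fderiv ℝ F y (EuclideanSpace.single i 1)))
          (fderiv ℝ F y (EuclideanSpace.single k 1))
          * pinv (fderiv ℝ F y) (fderiv ℝ N y (EuclideanSpace.single j 1)) l) := by
  have h1 := h.fderiv_christoffel hy l i j k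
  have h2 := h.fderiv_christoffel hy l j i k
  have hs : ContDiffAt ℝ ∞ (fun z => fderiv ℝ F z (EuclideanSpace.single k 1)) y :=
    ((contDiffOn_fderiv h.isOpen h.smooth_left).clm_apply contDiffOn_const).contDiffAt
      (h.isOpen.mem_nhds hy)
  rw [hs.isSymmSndFDerivAt (by simpa using WithTop.coe_le_coe.2 (le_top : (2 : ℕ∞) ≤ ⊤))
    (EuclideanSpace.single j 1) (EuclideanSpace.single i 1)] at h2
  rw [riemannTensor, Finset.sum_sub_distrib]
  linarith

lemma ricciTensor_eq (h : IsLocalHypersurface U F N) (hy : y ∈ U) (k j : Fin n) :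
    ricciTensor (inducedMetric F) k j y
      = ((n : ℝ) - 1) * inner ℝ (fderiv ℝ F y (EuclideanSpace.single k 1))
          (fderiv ℝ F y (EuclideanSpace.single j 1))
        + opTrace (localShape F N y) * inner ℝ
          (localShape F N y (fderiv ℝ F y (EuclideanSpace.single k 1)))
          (fderiv ℝ F y (EuclideanSpace.single j 1))
        - inner ℝ (localShape F N y (localShape F N y (fderiv ℝ F y (EuclideanSpace.single k 1))))
          (fderiv ℝ F y (EuclideanSpace.single j 1)) := by
  have hf := h.isFrame hy
  have hsym : ∀ a b, inner ℝ (localShape F N y a) b = (inner ℝ a (localShape F N y b) : ℝ) :=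
    hf.ambShape_symm
  have htr : ∑ i, pinv (fderiv ℝ F y) (fderiv ℝ N y (EuclideanSpace.single i 1)) i
      = -opTrace (localShape F N y) := by
    have : opTrace (localShape F N y) = -opTrace (fderiv ℝ N y ∘L pinv (fderiv ℝ F y)) :=
      map_neg _ _
    rw [this, opTrace_comp_comm, opTrace_euclidean, neg_neg]
    rfl
  have hsq : ∑ i, inner ℝ (localShape F N y (fderiv ℝ F y (EuclideanSpace.single i 1)))
      (fderiv ℝ F y (EuclideanSpace.single k 1))
        * pinv (fderiv ℝ F y) (fderiv ℝ N y (EuclideanSpace.single j 1)) i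
      = -inner ℝ (localShape F N y (localShape F N y (fderiv ℝ F y (EuclideanSpace.single k 1))))
          (fderiv ℝ F y (EuclideanSpace.single j 1)) := by
    have h1 := map_eq_sum (fderiv ℝ F y)
      (pinv (fderiv ℝ F y) (fderiv ℝ N y (EuclideanSpace.single j 1)))
    rw [hf.ambShape_map_eq_map] at h1
    generalize pinv (fderiv ℝ F y) (fderiv ℝ N y (EuclideanSpace.single j 1)) = c at h1 ⊢
    rw [hsym, show localShape F N y (fderiv ℝ F y (EuclideanSpace.single j 1)) = _ from
      hf.ambShape_map _, h1, inner_neg_right, neg_neg, inner_sum]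
    refine Finset.sum_congr rfl fun i _ => ?_
    rw [inner_smul_right, hsym, real_inner_comm, mul_comm]
  simp only [ricciTensor, h.riemannTensor_eq hy, Finset.sum_sub_distrib, hsq, ← Finset.mul_sum,
    htr]
  have h3 : ∑ i, inner ℝ (fderiv ℝ F y (EuclideanSpace.single i 1))
      (fderiv ℝ F y (EuclideanSpace.single k 1)) * (EuclideanSpace.single j (1 : ℝ)) i
      = inner ℝ (fderiv ℝ F y (EuclideanSpace.single k 1))
          (fderiv ℝ F y (EuclideanSpace.single j 1)) := by
    rw [real_inner_comm]
    simp
  rw [h3, hsym (fderiv ℝ F y (EuclideanSpace.single k 1)),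
    real_inner_comm (fderiv ℝ F y (EuclideanSpace.single k 1)),
    real_inner_comm (fderiv ℝ F y (EuclideanSpace.single k 1))]
  simp
  ring

/-- The Gauss equation for the scalar curvature. -/
lemma coordScalarCurvature_eq (h : IsLocalHypersurface U F N) (hy : y ∈ U) :
    coordScalarCurvature (inducedMetric F) y
      = n * ((n : ℝ) - 1) + opTrace (localShape F N y) ^ 2
        - opTrace (localShape F N y ∘L localShape F N y) := by
  have hf := h.isFrame hy
  have h1 := hf.sum_gram_inv_id
  have h2 := hf.sum_gram_inv_shape
  have h3 := hf.sum_gram_inv_shape_sq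
  simp only [coordScalarCurvature, h.ricciTensor_eq hy, mul_add, mul_sub,
    mul_left_comm ((inducedMetric F y)⁻¹ _ _), Finset.sum_add_distrib, Finset.sum_sub_distrib,
    ← Finset.mul_sum]
  unfold inducedMetric localShape
  rw [h1, h2, h3]
  ring

end IsLocalHypersurface

end LaplacianGauss

/-! ### Green's formula in a coordinate domain -/

section LocalGreen

/-- Jacobi's formula. The determinant is multilinear in the rows, and by Cramer's rule replacing one
row by its derivative pairs that derivative with a column of the adjugate. -/
lemma hasFDerivAt_det {m X : Type*} [Fintype m] [DecidableEq m] [NormedAddCommGroup X]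
    [NormedSpace ℝ X] {G : X → Matrix m m ℝ} {x : X} {G' : m → m → X →L[ℝ] ℝ}
    (hG : ∀ i j, HasFDerivAt (fun y => G y i j) (G' i j) x) (hdet : (G x).det ≠ 0) :
    HasFDerivAt (fun y => (G y).det) (∑ i, ∑ j, ((G x).det * (G x)⁻¹ j i) • G' i j) x := by
  let Φ : ContinuousMultilinearMap ℝ (fun _ : m => m → ℝ) ℝ :=
    ⟨(Matrix.detRowAlternating (R := ℝ) (n := m)).toMultilinearMap,
      (continuous_id (X := Matrix m m ℝ)).matrix_det⟩
  have h1 : HasFDerivAt (fun y => (fun i j => G y i j : m → m → ℝ))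
      (ContinuousLinearMap.pi fun i => ContinuousLinearMap.pi fun j => G' i j) x :=
    hasFDerivAt_pi.2 fun i => hasFDerivAt_pi.2 fun j => hG i j
  have h2 := (Φ.hasFDerivAt (fun i j => G x i j)).comp x h1
  refine h2.congr_fderiv ?_
  ext1 w
  rw [ContinuousLinearMap.comp_apply, ContinuousMultilinearMap.linearDeriv_apply, sum_apply]
  refine Finset.sum_congr rfl fun i _ => ?_
  have h3 : Φ (Function.update (fun i j => G x i j) i fun j => G' i j w)
      = ((G x).updateRow i fun j => G' i j w).det := rfl
  have h4 : ((ContinuousLinearMap.pi fun i => ContinuousLinearMap.pi fun j => G' i j) w) i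
      = fun j => G' i j w := rfl
  rw [h4, h3, ← Matrix.cramer_transpose_apply, Matrix.cramer_eq_adjugate_mulVec,
    Matrix.mulVec, dotProduct, sum_apply]
  refine Finset.sum_congr rfl fun j _ => ?_
  rw [← Matrix.adjugate_transpose, Matrix.transpose_apply, smul_apply, Matrix.inv_def,
    Matrix.smul_apply, Ring.inverse_eq_inv', smul_eq_mul, smul_eq_mul]
  field_simp

/-- A Riemannian metric on an open set of `ℝⁿ`, given by its component matrix. -/
structure IsLocalMetric (U : Set (EuclideanSpace ℝ (Fin n)))
    (G : EuclideanSpace ℝ (Fin n) → Matrix (Fin n) (Fin n) ℝ) : Prop where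
  isOpen : IsOpen U
  smooth : ∀ i j, ContDiffOn ℝ ∞ (fun y => G y i j) U
  posDef : ∀ y ∈ U, (G y).PosDef

variable {U : Set (EuclideanSpace ℝ (Fin n))}
  {G : EuclideanSpace ℝ (Fin n) → Matrix (Fin n) (Fin n) ℝ} {y : EuclideanSpace ℝ (Fin n)}

lemma IsLocalHypersurface.isLocalMetric
    {F N : EuclideanSpace ℝ (Fin n) → EuclideanSpace ℝ (Fin (n + 2))}
    (h : IsLocalHypersurface U F N) : IsLocalMetric U (inducedMetric F) where
  isOpen := h.isOpen
  smooth := h.contDiffOn_inducedMetric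
  posDef _ hy := h.posDef_inducedMetric hy

lemma contDiffOn_pderiv {F : Type*} [NormedAddCommGroup F] [NormedSpace ℝ F] (hU : IsOpen U)
    {f : EuclideanSpace ℝ (Fin n) → F} (hf : ContDiffOn ℝ ∞ f U) (i : Fin n) :
    ContDiffOn ℝ ∞ (pderiv i f) U :=
  (contDiffOn_fderiv hU hf).clm_apply contDiffOn_const

namespace IsLocalMetric

lemma det_pos (h : IsLocalMetric U G) (hy : y ∈ U) : 0 < (G y).det := (h.posDef y hy).det_pos

lemma inv_comm (h : IsLocalMetric U G) (hy : y ∈ U) (i j : Fin n) :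
    (G y)⁻¹ i j = (G y)⁻¹ j i := by
  simpa using (h.posDef y hy).inv.1.apply j i

lemma smooth_inv (h : IsLocalMetric U G) (i j : Fin n) :
    ContDiffOn ℝ ∞ (fun y => (G y)⁻¹ i j) U :=
  contDiffOn_matrix_inv h.smooth (fun _ hy => (h.det_pos hy).ne') i j

lemma smooth_sqrt_det (h : IsLocalMetric U G) :
    ContDiffOn ℝ ∞ (fun y => √(G y).det) U :=
  (contDiffOn_det h.smooth).sqrt fun _ hy => (h.det_pos hy).ne'

lemma pderiv_sqrt_det (h : IsLocalMetric U G) (hy : y ∈ U) (k : Fin n) :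
    pderiv k (fun z => √(G z).det) y
      = √(G y).det * ((1 / 2 : ℝ) * ∑ i, ∑ j, (G y)⁻¹ i j * pderiv k (fun z => G z i j) y) := by
  have h1 := hasFDerivAt_det (fun i j => hasFDerivAt_of_contDiffOn h.isOpen hy (h.smooth i j))
    (h.det_pos hy).ne'
  have hd := h.det_pos hy
  have hs := Real.mul_self_sqrt hd.le
  have hs0 := Real.sqrt_pos.2 hd
  rw [pderiv, (h1.sqrt hd.ne').fderiv]
  simp only [smul_apply, sum_apply, smul_eq_mul, mul_assoc, ← Finset.mul_sum]
  rw [Finset.sum_congr rfl fun i _ => Finset.sum_congr rfl fun j _ => by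
    rw [h.inv_comm hy j i]]
  change _ = √(G y).det * (1 / 2 * ∑ i, ∑ j, (G y)⁻¹ i j *
    fderiv ℝ (fun z => G z i j) y (EuclideanSpace.single k 1))
  generalize ∑ i, ∑ j, (G y)⁻¹ i j *
    fderiv ℝ (fun z => G z i j) y (EuclideanSpace.single k 1) = S
  field_simp
  rw [pow_two, hs]

/-- Differentiate G⁻¹G = 1 and multiply by G⁻¹ on the right. -/
lemma pderiv_inv (h : IsLocalMetric U G) (hy : y ∈ U) (a b k : Fin n) :
    pderiv k (fun z => (G z)⁻¹ a b) y
      = -∑ i, ∑ j, (G y)⁻¹ a i * pderiv k (fun z => G z i j) y * (G y)⁻¹ j b := by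
  let I' : Matrix (Fin n) (Fin n) ℝ := Matrix.of fun a b => pderiv k (fun z => (G z)⁻¹ a b) y
  let G' : Matrix (Fin n) (Fin n) ℝ := Matrix.of fun a b => pderiv k (fun z => G z a b) y
  have hu : IsUnit (G y).det := (h.det_pos hy).ne'.isUnit
  have h1 : I' * G y + (G y)⁻¹ * G' = 0 := by
    ext a c
    have e1 : HasFDerivAt (fun z => ∑ j, (G z)⁻¹ a j * G z j c) _ y :=
      HasFDerivAt.fun_sum fun j _ =>
        (hasFDerivAt_of_contDiffOn h.isOpen hy (h.smooth_inv a j)).mul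
          (hasFDerivAt_of_contDiffOn h.isOpen hy (h.smooth j c))
    have e2 := fderiv_eq_of_eqOn h.isOpen hy (fun z hz => by
      rw [← Matrix.mul_apply, Matrix.nonsing_inv_mul _ (h.det_pos hz).ne'.isUnit]) e1
      (hasFDerivAt_const ((1 : Matrix (Fin n) (Fin n) ℝ) a c) y)
    have e3 := DFunLike.congr_fun e2 (EuclideanSpace.single k 1)
    simp only [sum_apply, add_apply, smul_apply, smul_eq_mul, zero_apply,
      Finset.sum_add_distrib] at e3
    simp only [Matrix.add_apply, Matrix.mul_apply, Matrix.zero_apply, I', G', Matrix.of_apply,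
      pderiv]
    rw [← e3, add_comm]
    congr 1
    exact Finset.sum_congr rfl fun j _ => mul_comm _ _
  have h2 : I' = -((G y)⁻¹ * G' * (G y)⁻¹) := by
    rw [← eq_neg_iff_add_eq_zero] at h1
    rw [← neg_mul, ← h1, Matrix.mul_assoc, Matrix.mul_nonsing_inv _ hu, Matrix.mul_one]
  have h3 := congrFun (congrFun h2 a) b
  simp only [Matrix.neg_apply, Matrix.mul_apply, Finset.sum_mul] at h3
  rw [Finset.sum_comm] at h3
  exact h3

/-- After contraction the first two of the three terms of Γ agree by exchanging `i` and `j`. The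
third is the logarithmic derivative of √det G, so the right side is what the divergence of the
gradient produces. -/
lemma sum_christoffel (h : IsLocalMetric U G) (hy : y ∈ U) (k : Fin n) :
    ∑ i, ∑ j, (G y)⁻¹ i j * christoffel G k i j y
      = ∑ i, ∑ j, ∑ l, (G y)⁻¹ i j * pderiv i (fun z => G z j l) y * (G y)⁻¹ l k
        - ∑ l, (G y)⁻¹ l k *
          ((1 / 2 : ℝ) * ∑ i, ∑ j, (G y)⁻¹ i j * pderiv l (fun z => G z i j) y) := by
  have e1 : ∀ i j, (G y)⁻¹ i j * christoffel G k i j y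
      = (1 / 2 : ℝ) * ∑ l, (G y)⁻¹ i j * pderiv i (fun z => G z j l) y * (G y)⁻¹ l k
        + (1 / 2 : ℝ) * ∑ l, (G y)⁻¹ j i * pderiv j (fun z => G z i l) y * (G y)⁻¹ l k
        - (1 / 2 : ℝ) * ∑ l, (G y)⁻¹ l k * ((G y)⁻¹ i j * pderiv l (fun z => G z i j) y) := by
    intro i j
    rw [christoffel, ← mul_add, ← mul_sub, ← Finset.sum_add_distrib, ← Finset.sum_sub_distrib,
      mul_left_comm, Finset.mul_sum]
    congr 1
    refine Finset.sum_congr rfl fun l _ => ?_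
    rw [h.inv_comm hy j i, h.inv_comm hy k l]
    ring
  simp only [e1, Finset.sum_add_distrib, Finset.sum_sub_distrib, ← Finset.mul_sum]
  rw [Finset.sum_comm (f := fun i j => ∑ l, (G y)⁻¹ j i * pderiv j (fun z => G z i l) y *
    (G y)⁻¹ l k)]
  have e2 : ∑ i, ∑ j, ∑ l, (G y)⁻¹ l k * ((G y)⁻¹ i j * pderiv l (fun z => G z i j) y)
      = ∑ l, (G y)⁻¹ l k * ∑ i, ∑ j, (G y)⁻¹ i j * pderiv l (fun z => G z i j) y := by
    simp only [Finset.mul_sum]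
    rw [Finset.sum_congr rfl fun i _ => Finset.sum_comm, Finset.sum_comm]
  rw [e2]
  simp only [mul_left_comm _ (1 / 2 : ℝ), ← Finset.mul_sum]
  ring

/-- The Laplacian in divergence form. -/
lemma sum_pderiv_gradient (h : IsLocalMetric U G) {v : EuclideanSpace ℝ (Fin n) → ℝ}
    (hv : ContDiffOn ℝ ∞ v U) (hy : y ∈ U) :
    ∑ i, pderiv i (fun z => √(G z).det * ∑ j, (G z)⁻¹ i j * pderiv j v z) y
      = √(G y).det * coordLaplacian G v y := by
  have hp : ∀ i, pderiv i (fun z => √(G z).det * ∑ j, (G z)⁻¹ i j * pderiv j v z) y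
      = √(G y).det * (∑ j, (G y)⁻¹ i j * pderiv i (pderiv j v) y
        + ∑ j, pderiv i (fun z => (G z)⁻¹ i j) y * pderiv j v y
        + ∑ j, ((G y)⁻¹ i j * ((1 / 2 : ℝ) * ∑ a, ∑ b, (G y)⁻¹ a b *
          pderiv i (fun z => G z a b) y)) * pderiv j v y) := by
    intro i
    have e1 := (hasFDerivAt_of_contDiffOn h.isOpen hy h.smooth_sqrt_det).mul
      (HasFDerivAt.fun_sum (u := Finset.univ) fun j _ =>
        (hasFDerivAt_of_contDiffOn h.isOpen hy (h.smooth_inv i j)).mul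
          (hasFDerivAt_of_contDiffOn h.isOpen hy (contDiffOn_pderiv h.isOpen hv j)))
    have e2 : pderiv i (fun z => √(G z).det * ∑ j, (G z)⁻¹ i j * pderiv j v z) y = _ :=
      DFunLike.congr_fun e1.fderiv (EuclideanSpace.single i 1)
    have e3 := h.pderiv_sqrt_det hy i
    rw [pderiv] at e3
    rw [e2]
    simp only [sum_apply, add_apply, smul_apply, smul_eq_mul, Finset.sum_add_distrib, e3,
      Pi.mul_apply]
    have e4 : ∀ S : ℝ, ∑ j, (G y)⁻¹ i j * S * pderiv j v y
        = S * ∑ j, (G y)⁻¹ i j * pderiv j v y := by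
      intro S
      rw [Finset.mul_sum]
      exact Finset.sum_congr rfl fun j _ => by ring
    have e5 : ∑ j, pderiv j v y * fderiv ℝ (fun z => (G z)⁻¹ i j) y (EuclideanSpace.single i 1)
        = ∑ j, pderiv i (fun z => (G z)⁻¹ i j) y * pderiv j v y :=
      Finset.sum_congr rfl fun j _ => mul_comm _ _
    rw [e4, e5]
    simp only [pderiv]
    ring
  simp only [hp, ← Finset.mul_sum]
  congr 1
  have hΓ : ∑ i, ∑ j, (G y)⁻¹ i j * ∑ k, christoffel G k i j y * pderiv k v y
      = ∑ k, (∑ i, ∑ j, (G y)⁻¹ i j * christoffel G k i j y) * pderiv k v y := by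
    simp only [Finset.mul_sum, Finset.sum_mul, ← mul_assoc]
    rw [Finset.sum_congr rfl fun i _ => Finset.sum_comm, Finset.sum_comm]
  simp only [coordLaplacian, mul_sub, Finset.sum_sub_distrib, hΓ, h.sum_christoffel hy,
    Finset.sum_add_distrib, sub_mul, h.pderiv_inv hy]
  have e6 : ∑ i, ∑ j, (-∑ a, ∑ b, (G y)⁻¹ i a * pderiv i (fun z => G z a b) y * (G y)⁻¹ b j) *
      pderiv j v y = -∑ j, (∑ i, ∑ a, ∑ b, (G y)⁻¹ i a * pderiv i (fun z => G z a b) y *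
        (G y)⁻¹ b j) * pderiv j v y := by
    rw [Finset.sum_comm, ← Finset.sum_neg_distrib]
    refine Finset.sum_congr rfl fun j _ => ?_
    rw [Finset.sum_mul, ← Finset.sum_neg_distrib]
    exact Finset.sum_congr rfl fun i _ => by ring
  have e7 : ∑ i, ∑ j, (G y)⁻¹ i j * ((1 / 2 : ℝ) * ∑ a, ∑ b, (G y)⁻¹ a b *
      pderiv i (fun z => G z a b) y) * pderiv j v y = ∑ j, (∑ i, (G y)⁻¹ i j *
        ((1 / 2 : ℝ) * ∑ a, ∑ b, (G y)⁻¹ a b * pderiv i (fun z => G z a b) y)) * pderiv j v y := by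
    rw [Finset.sum_comm]
    exact Finset.sum_congr rfl fun j _ => (Finset.sum_mul _ _ _).symm
  rw [e6, e7]
  ring

end IsLocalMetric

lemma integral_fderiv_eq_zero {X : Type*} [NormedAddCommGroup X] [NormedSpace ℝ X]
    [FiniteDimensional ℝ X] [MeasurableSpace X] [BorelSpace X] (μ : Measure X)
    [μ.IsAddHaarMeasure] {f : X → ℝ} (hf : ContDiff ℝ 1 f) (hc : HasCompactSupport f) (v : X) :
    ∫ x, fderiv ℝ f x v ∂μ = 0 := by
  have hi : Integrable (fun x => fderiv ℝ f x v) μ :=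
    ((hf.continuous_fderiv one_ne_zero).clm_apply continuous_const).integrable_of_hasCompactSupport
      (hc.fderiv_apply ℝ v)
  have h := integral_mul_fderiv_eq_neg_fderiv_mul_of_integrable (μ := μ) (f := fun _ => (1 : ℝ))
    (g := f) (v := v) (by simp) (by simpa using hi)
    (by simpa using hf.continuous.integrable_of_hasCompactSupport hc)
    (fun _ _ => differentiableAt_const _) (fun x _ => hf.differentiable one_ne_zero x)
  simpa using h

namespace IsLocalMetric

/-- Green's formula for a function with compact support in a coordinate domain. -/
lemma integral_green (h : IsLocalMetric U G) {u v : EuclideanSpace ℝ (Fin n) → ℝ}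
    (hu : ContDiff ℝ ∞ u) (hc : HasCompactSupport u) (hs : tsupport u ⊆ U)
    (hv : ContDiffOn ℝ ∞ v U) :
    ∫ y, √(G y).det * (u y * coordLaplacian G v y
      + ∑ i, ∑ j, (G y)⁻¹ i j * (pderiv i u y * pderiv j v y)) = 0 := by
  have hW : ∀ i, ContDiffOn ℝ ∞ (fun z => √(G z).det * ∑ j, (G z)⁻¹ i j * pderiv j v z) U :=
    fun i => h.smooth_sqrt_det.mul (ContDiffOn.sum fun j _ =>
      (h.smooth_inv i j).mul (contDiffOn_pderiv h.isOpen hv j))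
  have hzero : ∀ y ∉ U, u =ᶠ[nhds y] 0 := fun y hy =>
    notMem_tsupport_iff_eventuallyEq.1 fun hy' => hy (hs hy')
  -- The vector field is controlled only on `U`, but the factor `u` vanishes near every point
  -- outside `U`, so the product is smooth on all of ℝⁿ and its partial derivatives integrate to
  -- zero.
  have hsm : ∀ i, ContDiff ℝ 1
      (fun z => u z * (√(G z).det * ∑ j, (G z)⁻¹ i j * pderiv j v z)) := by
    intro i
    rw [contDiff_iff_contDiffAt]
    intro y
    by_cases hy : y ∈ U
    · exact (hu.contDiffAt.mul ((hW i).contDiffAt (h.isOpen.mem_nhds hy))).of_le (by simp)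
    · refine (contDiffAt_const (c := (0 : ℝ))).congr_of_eventuallyEq ?_
      filter_upwards [hzero y hy] with z hz
      simp [hz]
  have hcs : ∀ i, HasCompactSupport
      (fun z => u z * (√(G z).det * ∑ j, (G z)⁻¹ i j * pderiv j v z)) := fun i => hc.mul_right
  have hint : ∀ i : Fin n, Integrable fun y => fderiv ℝ
      (fun z => u z * (√(G z).det * ∑ j, (G z)⁻¹ i j * pderiv j v z)) y
        (EuclideanSpace.single i 1) := fun i =>
    (((hsm i).continuous_fderiv one_ne_zero).clm_apply
      continuous_const).integrable_of_hasCompactSupport ((hcs i).fderiv_apply ℝ _)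
  have hsum : ∑ i : Fin n, ∫ y, fderiv ℝ
      (fun z => u z * (√(G z).det * ∑ j, (G z)⁻¹ i j * pderiv j v z)) y
        (EuclideanSpace.single i 1) = 0 :=
    Finset.sum_eq_zero fun i _ => integral_fderiv_eq_zero _ (hsm i) (hcs i) _
  rw [← integral_finsetSum _ fun i _ => hint i] at hsum
  rw [← hsum]
  refine integral_congr_ae (Filter.Eventually.of_forall fun y => ?_)
  by_cases hy : y ∈ U
  · have e1 : ∀ i, fderiv ℝ (fun z => u z * (√(G z).det * ∑ j, (G z)⁻¹ i j * pderiv j v z)) y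
        (EuclideanSpace.single i 1)
        = u y * pderiv i (fun z => √(G z).det * ∑ j, (G z)⁻¹ i j * pderiv j v z) y
          + (√(G y).det * ∑ j, (G y)⁻¹ i j * pderiv j v y) * pderiv i u y := by
      intro i
      have h1 := ((hu.differentiable (by simp) y).hasFDerivAt).mul
        (hasFDerivAt_of_contDiffOn h.isOpen hy (hW i))
      exact DFunLike.congr_fun h1.fderiv (EuclideanSpace.single i 1)
    simp only [e1, Finset.sum_add_distrib, ← Finset.mul_sum, h.sum_pderiv_gradient hv hy]
    rw [mul_add, mul_left_comm]
    congr 1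
    rw [Finset.mul_sum]
    refine Finset.sum_congr rfl fun i _ => ?_
    rw [mul_assoc, Finset.sum_mul]
    congr 1
    exact Finset.sum_congr rfl fun j _ => by ring
  · have e1 := hzero y hy
    have e2 : ∀ i, pderiv i u y = 0 := fun i => by
      rw [pderiv, e1.fderiv_eq]
      simp
    have e3 : ∀ i, fderiv ℝ (fun z => u z * (√(G z).det * ∑ j, (G z)⁻¹ i j * pderiv j v z)) y
        = 0 := by
      intro i
      have : (fun z => u z * (√(G z).det * ∑ j, (G z)⁻¹ i j * pderiv j v z))
          =ᶠ[nhds y] fun _ => (0 : ℝ) := by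
        filter_upwards [e1] with z hz
        simp [hz]
      rw [this.fderiv_eq]
      simp
    simp [e1.eq_of_nhds, e2, e3]

end IsLocalMetric

end LocalGreen

/-! ### Charts of a hypersurface -/

section Charts

lemma metricMatrix_eq {M : Type*} [TopologicalSpace M]
    (φ : M → EuclideanSpace ℝ (Fin (n + 2)))
    (e : OpenPartialHomeomorph M (EuclideanSpace ℝ (Fin n))) :
    metricMatrix φ e = inducedMetric (φ ∘ e.symm) := rfl

variable {M : Type*} [TopologicalSpace M] [ChartedSpace (EuclideanSpace ℝ (Fin n)) M]
  {φ ν : M → EuclideanSpace ℝ (Fin (n + 2))}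

/-- The differential as a map between the model spaces. -/
def dmap (ψ : M → EuclideanSpace ℝ (Fin (n + 2))) (x : M) :
    EuclideanSpace ℝ (Fin n) →L[ℝ] EuclideanSpace ℝ (Fin (n + 2)) :=
  mfderiv (𝓡 n) 𝓘(ℝ, EuclideanSpace ℝ (Fin (n + 2))) ψ x

/-- The ambient shape operator of a hypersurface. -/
def globalShape (φ ν : M → EuclideanSpace ℝ (Fin (n + 2))) (x : M) :
    EuclideanSpace ℝ (Fin (n + 2)) →L[ℝ] EuclideanSpace ℝ (Fin (n + 2)) :=
  ambShape (dmap φ x) (dmap ν x)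

variable [IsManifold (𝓡 n) ∞ M]

lemma isManifold_one : IsManifold (𝓡 n) 1 M :=
  IsManifold.of_le (n := ∞) (by simp)

lemma mdifferentiable_chart {e : OpenPartialHomeomorph M (EuclideanSpace ℝ (Fin n))}
    (he : e ∈ atlas (EuclideanSpace ℝ (Fin n)) M) : e.MDifferentiable (𝓡 n) (𝓡 n) :=
  haveI := isManifold_one (n := n) (M := M)
  mdifferentiable_of_mem_atlas he

/-- The derivative of the inverse of a chart. -/
def chartDeriv {e : OpenPartialHomeomorph M (EuclideanSpace ℝ (Fin n))}
    (he : e ∈ atlas (EuclideanSpace ℝ (Fin n)) M) {y : EuclideanSpace ℝ (Fin n)}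
    (hy : y ∈ e.target) : EuclideanSpace ℝ (Fin n) ≃L[ℝ] EuclideanSpace ℝ (Fin n) :=
  (mdifferentiable_chart he).symm.mfderiv hy

variable {e : OpenPartialHomeomorph M (EuclideanSpace ℝ (Fin n))}
  {y : EuclideanSpace ℝ (Fin n)}

lemma fderiv_comp_chart_symm {Y : Type*} [NormedAddCommGroup Y] [NormedSpace ℝ Y]
    (he : e ∈ atlas (EuclideanSpace ℝ (Fin n)) M) (hy : y ∈ e.target) {ψ : M → Y}
    (hψ : ContMDiff (𝓡 n) 𝓘(ℝ, Y) ∞ ψ) (w : EuclideanSpace ℝ (Fin n)) :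
    fderiv ℝ (ψ ∘ e.symm) y w
      = mfderiv (𝓡 n) 𝓘(ℝ, Y) ψ (e.symm y) (chartDeriv he hy w) := by
  rw [← mfderiv_eq_fderiv]
  have h1 := mfderiv_comp y (hψ.mdifferentiable (by simp) (e.symm y))
    ((mdifferentiable_chart he).symm.mdifferentiableAt hy)
  exact DFunLike.congr_fun h1 w

lemma fderiv_comp_chart_symm_eq (he : e ∈ atlas (EuclideanSpace ℝ (Fin n)) M) (hy : y ∈ e.target)
    {ψ : M → EuclideanSpace ℝ (Fin (n + 2))}
    (hψ : ContMDiff (𝓡 n) 𝓘(ℝ, EuclideanSpace ℝ (Fin (n + 2))) ∞ ψ) :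
    fderiv ℝ (ψ ∘ e.symm) y = dmap ψ (e.symm y) ∘L
      (chartDeriv he hy : EuclideanSpace ℝ (Fin n) →L[ℝ] EuclideanSpace ℝ (Fin n)) := by
  ext1 w
  exact fderiv_comp_chart_symm he hy hψ w

lemma contDiffOn_comp_chart_symm {Y : Type*} [NormedAddCommGroup Y] [NormedSpace ℝ Y]
    (he : e ∈ atlas (EuclideanSpace ℝ (Fin n)) M) {ψ : M → Y}
    (hψ : ContMDiff (𝓡 n) 𝓘(ℝ, Y) ∞ ψ) : ContDiffOn ℝ ∞ (ψ ∘ e.symm) e.target :=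
  contMDiffOn_iff_contDiffOn.1 (hψ.comp_contMDiffOn (contMDiffOn_symm_of_mem_maximalAtlas
    (StructureGroupoid.subset_maximalAtlas _ he)))

lemma contMDiff_of_charts {Y : Type*} [NormedAddCommGroup Y] [NormedSpace ℝ Y] {ψ : M → Y}
    (h : ∀ e ∈ atlas (EuclideanSpace ℝ (Fin n)) M, ContDiffOn ℝ ∞ (ψ ∘ e.symm) e.target) :
    ContMDiff (𝓡 n) 𝓘(ℝ, Y) ∞ ψ := by
  intro x
  set e := chartAt (EuclideanSpace ℝ (Fin n)) x with hedef
  have he : e ∈ atlas (EuclideanSpace ℝ (Fin n)) M := chart_mem_atlas _ x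
  have hx : x ∈ e.source := mem_chart_source _ x
  have h1 : ContMDiffOn (𝓡 n) 𝓘(ℝ, Y) ∞ ((ψ ∘ e.symm) ∘ e) e.source :=
    (contMDiffOn_iff_contDiffOn.2 (h e he)).comp (contMDiffOn_of_mem_maximalAtlas
      (StructureGroupoid.subset_maximalAtlas _ he)) fun z hz => e.map_source hz
  refine ((h1.contMDiffAt (e.open_source.mem_nhds hx))).congr_of_eventuallyEq ?_
  filter_upwards [e.open_source.mem_nhds hx] with z hz
  simp [e.left_inv hz]

/-! ### The hypersurface read in its charts. -/

lemma IsOrientedHypersurface.chart (hM : IsOrientedHypersurface φ ν)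
    (he : e ∈ atlas (EuclideanSpace ℝ (Fin n)) M) :
    IsLocalHypersurface e.target (φ ∘ e.symm) (ν ∘ e.symm) where
  isOpen := e.open_target
  smooth_left := contDiffOn_comp_chart_symm he hM.contMDiff_immersion
  smooth_right := contDiffOn_comp_chart_symm he hM.contMDiff_gauss
  inj y hy := by
    intro v w hvw
    rw [fderiv_comp_chart_symm he hy hM.contMDiff_immersion,
      fderiv_comp_chart_symm he hy hM.contMDiff_immersion] at hvw
    exact (chartDeriv he hy).injective (hM.injective_mfderiv _ hvw)
  norm_left y _ := hM.mem_sphere _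
  norm_right y _ := hM.norm_gauss _
  orth y _ := by
    rw [real_inner_comm]
    exact hM.gauss_orthogonal _
  normal y hy v := by
    rw [fderiv_comp_chart_symm he hy hM.contMDiff_immersion]
    exact hM.gauss_normal _ _

lemma IsOrientedHypersurface.isFrame (hM : IsOrientedHypersurface φ ν) (x : M) :
    IsFrame (dmap φ x) (dmap ν x) (φ x) (ν x) := by
  have he := chart_mem_atlas (EuclideanSpace ℝ (Fin n)) x
  have hx := mem_chart_source (EuclideanSpace ℝ (Fin n)) x
  have hy := mem_chart_target (EuclideanSpace ℝ (Fin n)) x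
  have h := ((hM.chart he).isFrame hy).comp_equiv (chartDeriv he hy).symm
  rw [fderiv_comp_chart_symm_eq he hy hM.contMDiff_immersion,
    fderiv_comp_chart_symm_eq he hy hM.contMDiff_gauss] at h
  have hinv : (chartAt (EuclideanSpace ℝ (Fin n)) x).symm (chartAt _ x x) = x :=
    (chartAt (EuclideanSpace ℝ (Fin n)) x).left_inv hx
  simp only [Function.comp_apply, hinv] at h
  convert h using 1 <;>
  · ext1 v
    simp

/-- As an operator of ℝⁿ⁺² the shape operator does not depend on the parametrisation, so the
operators of all charts are restrictions of one map on `M`. This is the purpose of the ambient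
extension. -/
lemma IsOrientedHypersurface.localShape_eq (hM : IsOrientedHypersurface φ ν)
    (he : e ∈ atlas (EuclideanSpace ℝ (Fin n)) M) (hy : y ∈ e.target) :
    localShape (φ ∘ e.symm) (ν ∘ e.symm) y = globalShape φ ν (e.symm y) := by
  rw [localShape, fderiv_comp_chart_symm_eq he hy hM.contMDiff_immersion,
    fderiv_comp_chart_symm_eq he hy hM.contMDiff_gauss,
    (hM.isFrame (e.symm y)).ambShape_comp_equiv]
  rfl

lemma IsOrientedHypersurface.contMDiff_globalShape (hM : IsOrientedHypersurface φ ν) :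
    ContMDiff (𝓡 n) 𝓘(ℝ, EuclideanSpace ℝ (Fin (n + 2)) →L[ℝ] EuclideanSpace ℝ (Fin (n + 2))) ∞
      (globalShape φ ν) :=
  contMDiff_of_charts fun _ he => (hM.chart he).contDiffOn_localShape.congr
    fun _ hy => (hM.localShape_eq he hy).symm

lemma IsOrientedHypersurface.meanCurvature_eq (hM : IsOrientedHypersurface φ ν) (x : M) :
    meanCurvature φ ν x = opTrace (globalShape φ ν x) / n := by
  rw [meanCurvature]
  congr 1
  exact (hM.isFrame x).trace_leftInverse

lemma IsOrientedHypersurface.normSqShape_eq (hM : IsOrientedHypersurface φ ν) (x : M) :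
    normSqShape φ ν x = opTrace (globalShape φ ν x ∘L globalShape φ ν x) :=
  (hM.isFrame x).trace_leftInverse_sq

lemma IsOrientedHypersurface.scalarCurvature_eq (hM : IsOrientedHypersurface φ ν) (x : M) :
    scalarCurvature φ x = n * ((n : ℝ) - 1) + opTrace (globalShape φ ν x) ^ 2
      - opTrace (globalShape φ ν x ∘L globalShape φ ν x) := by
  have he := chart_mem_atlas (EuclideanSpace ℝ (Fin n)) x
  have hy := mem_chart_target (EuclideanSpace ℝ (Fin n)) x
  have hx := mem_chart_source (EuclideanSpace ℝ (Fin n)) x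
  rw [scalarCurvature, metricMatrix_eq, (hM.chart he).coordScalarCurvature_eq hy,
    hM.localShape_eq he hy, (chartAt (EuclideanSpace ℝ (Fin n)) x).left_inv hx]

lemma IsOrientedHypersurface.coordLaplacian_height (hM : IsOrientedHypersurface φ ν) {H : ℝ}
    (hH : ∀ x, opTrace (globalShape φ ν x) = H) (a b : EuclideanSpace ℝ (Fin (n + 2)))
    (he : e ∈ atlas (EuclideanSpace ℝ (Fin n)) M) (hy : y ∈ e.target) :
    coordLaplacian (metricMatrix φ e) ((fun x => inner ℝ a (φ x) + inner ℝ b (ν x)) ∘ e.symm) y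
      = inner ℝ a (H • ν (e.symm y) - (n : ℝ) • φ (e.symm y))
        + inner ℝ b (H • φ (e.symm y) - opTrace (globalShape φ ν (e.symm y) ∘L
            globalShape φ ν (e.symm y)) • ν (e.symm y)) := by
  have := (hM.chart he).coordLaplacian_height hy (H := H)
    (fun z hz => by rw [hM.localShape_eq he hz, hH]) a b
  rw [hM.localShape_eq he hy] at this
  exact this

end Charts

/-! ### The Riemannian volume -/

section Volume

/-- The Gram matrix becomes JᵀGJ. With the square root of this identity the change-of-variables
formula shows the Riemannian density to be independent of the chart. -/
lemma det_gram_comp {E : Type*} [NormedAddCommGroup E] [InnerProductSpace ℝ E]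
    (D : EuclideanSpace ℝ (Fin n) →L[ℝ] E)
    (J : EuclideanSpace ℝ (Fin n) →L[ℝ] EuclideanSpace ℝ (Fin n)) :
    (gram (D ∘L J)).det = J.det ^ 2 * (gram D).det := by
  let b := (EuclideanSpace.basisFun (Fin n) ℝ).toBasis
  let A := LinearMap.toMatrix b b J.toLinearMap
  have hA : ∀ i j, A i j = J (EuclideanSpace.single j 1) i := by
    intro i j
    simp [A, b, LinearMap.toMatrix_apply]
  have h1 : gram (D ∘L J) = A.transpose * gram D * A := by
    ext i j
    simp only [gram, Matrix.of_apply, Matrix.mul_apply, Matrix.transpose_apply, hA,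
      ContinuousLinearMap.comp_apply]
    rw [map_eq_sum D (J (EuclideanSpace.single i 1)), map_eq_sum D (J (EuclideanSpace.single j 1)),
      inner_sum]
    refine Finset.sum_congr rfl fun k _ => ?_
    rw [sum_inner, Finset.sum_mul]
    refine Finset.sum_congr rfl fun l _ => ?_
    rw [inner_smul_left, inner_smul_right]
    simp only [RCLike.conj_to_real]
    ring
  have h2 : A.det = J.det := LinearMap.det_toMatrix b _
  rw [h1, Matrix.det_mul, Matrix.det_mul, Matrix.det_transpose, h2]
  ring

end Volume

section Volume

lemma measurableSet_target_inter_preimage {M : Type*} [TopologicalSpace M] [MeasurableSpace M]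
    [BorelSpace M] (e : OpenPartialHomeomorph M (EuclideanSpace ℝ (Fin n))) {s : Set M}
    (hs : MeasurableSet s) : MeasurableSet (e.target ∩ e.symm ⁻¹' s) := by
  have h1 : Measurable (e.target.domRestrict e.symm) :=
    (continuousOn_iff_continuous_domRestrict.1 e.continuousOn_symm).measurable
  have h2 := e.open_target.measurableSet.subtype_image (h1 hs)
  convert h2 using 1
  ext z
  constructor
  · rintro ⟨hz, hzs⟩
    exact ⟨⟨z, hz⟩, hzs, rfl⟩
  · rintro ⟨⟨w, hw⟩, hws, rfl⟩
    exact ⟨hw, hws⟩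

/-- Off `e.target` the map `e.symm` has arbitrary values, so only measurability almost everywhere is
available. It suffices to keep `Measure.map` from taking its default value zero. -/
lemma aemeasurable_chart_symm {M : Type*} [TopologicalSpace M] [MeasurableSpace M]
    [BorelSpace M] (e : OpenPartialHomeomorph M (EuclideanSpace ℝ (Fin n)))
    (ρ : EuclideanSpace ℝ (Fin n) → ENNReal) :
    AEMeasurable e.symm ((volume.restrict e.target).withDensity ρ) :=
  (e.continuousOn_symm.aemeasurable e.open_target.measurableSet).mono_ac
    (withDensity_absolutelyContinuous _ _)

lemma chartVolume_apply {M : Type*} [TopologicalSpace M] [MeasurableSpace M]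
    [BorelSpace M] (φ : M → EuclideanSpace ℝ (Fin (n + 2)))
    (e : OpenPartialHomeomorph M (EuclideanSpace ℝ (Fin n))) {s : Set M} (hs : MeasurableSet s) :
    chartVolume φ e s = ∫⁻ y in e.target ∩ e.symm ⁻¹' s,
      ENNReal.ofReal (√(metricMatrix φ e y).det) := by
  rw [chartVolume, Measure.map_apply_of_aemeasurable (aemeasurable_chart_symm e _) hs]
  have h1 := measurableSet_target_inter_preimage e hs
  have h2 : ((volume.restrict e.target).withDensity
      fun y => ENNReal.ofReal √(metricMatrix φ e y).det) e.targetᶜ = 0 := by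
    rw [withDensity_apply _ e.open_target.measurableSet.compl,
      Measure.restrict_restrict e.open_target.measurableSet.compl, Set.compl_inter_self,
      Measure.restrict_empty, lintegral_zero_measure]
  rw [← measure_inter_add_sdiff₀ (e.symm ⁻¹' s) e.open_target.measurableSet.nullMeasurableSet,
    measure_mono_null (s := (e.symm ⁻¹' s) \ e.target) (fun z hz => hz.2) h2, add_zero, Set.inter_comm,
    withDensity_apply _ h1, Measure.restrict_restrict h1, Set.inter_right_comm, Set.inter_self]

lemma chartVolume_inter_source {M : Type*} [TopologicalSpace M] [MeasurableSpace M]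
    [BorelSpace M] (φ : M → EuclideanSpace ℝ (Fin (n + 2)))
    (e : OpenPartialHomeomorph M (EuclideanSpace ℝ (Fin n))) {s : Set M} (hs : MeasurableSet s) :
    chartVolume φ e (s ∩ e.source) = chartVolume φ e s := by
  rw [chartVolume_apply φ e hs, chartVolume_apply φ e (hs.inter e.open_source.measurableSet)]
  congr 2
  ext z
  constructor
  · rintro ⟨h1, h2⟩
    exact ⟨h1, h2.1⟩
  · rintro ⟨h1, h2⟩
    exact ⟨h1, h2, e.map_target h1⟩

lemma IsOrientedHypersurface.continuousOn_density {M : Type*} [TopologicalSpace M]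
    [ChartedSpace (EuclideanSpace ℝ (Fin n)) M] [IsManifold (𝓡 n) ∞ M]
    {φ ν : M → EuclideanSpace ℝ (Fin (n + 2))}
    {e : OpenPartialHomeomorph M (EuclideanSpace ℝ (Fin n))} (hM : IsOrientedHypersurface φ ν)
    (he : e ∈ atlas (EuclideanSpace ℝ (Fin n)) M) :
    ContinuousOn (fun y => √(metricMatrix φ e y).det) e.target :=
  ((hM.chart he).isLocalMetric.smooth_sqrt_det).continuousOn

variable {M : Type*} [TopologicalSpace M] [ChartedSpace (EuclideanSpace ℝ (Fin n)) M]
  [IsManifold (𝓡 n) ∞ M] [MeasurableSpace M] [BorelSpace M]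
  {φ ν : M → EuclideanSpace ℝ (Fin (n + 2))}
  {e e' : OpenPartialHomeomorph M (EuclideanSpace ℝ (Fin n))}

/-- The chart volumes agree on the overlaps of charts. -/
lemma IsOrientedHypersurface.chartVolume_eq (hM : IsOrientedHypersurface φ ν)
    (he : e ∈ atlas (EuclideanSpace ℝ (Fin n)) M)
    (he' : e' ∈ atlas (EuclideanSpace ℝ (Fin n)) M) {s : Set M} (hs : MeasurableSet s)
    (hse : s ⊆ e.source) (hse' : s ⊆ e'.source) : chartVolume φ e' s = chartVolume φ e s := by
  rw [chartVolume_apply φ e hs, chartVolume_apply φ e' hs]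
  set T := e.target ∩ e.symm ⁻¹' s with hT
  have hTm : MeasurableSet T := measurableSet_target_inter_preimage e hs
  have himg : (e' ∘ e.symm) '' T = e'.target ∩ e'.symm ⁻¹' s := by
    ext z
    constructor
    · rintro ⟨y, ⟨hy, hys⟩, rfl⟩
      refine ⟨e'.map_source (hse' hys), ?_⟩
      simpa [e'.left_inv (hse' hys)] using hys
    · rintro ⟨hz, hzs⟩
      refine ⟨e (e'.symm z), ⟨e.map_source (hse hzs), ?_⟩, ?_⟩
      · simpa [e.left_inv (hse hzs)] using hzs
      · simp [e.left_inv (hse hzs), e'.right_inv hz]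
  have hinj : Set.InjOn (e' ∘ e.symm) T := by
    rintro y ⟨hy, hys⟩ z ⟨hz, hzs⟩ h
    exact e.symm.injOn hy hz (e'.injOn (hse' hys) (hse' hzs) h)
  have hd : ∀ y ∈ T, HasFDerivAt (e' ∘ e.symm) (fderiv ℝ (e' ∘ e.symm) y) y := by
    rintro y ⟨hy, hys⟩
    have h1 : MDifferentiableAt (𝓡 n) (𝓡 n) (e' ∘ e.symm) y :=
      ((mdifferentiable_chart he').mdifferentiableAt (hse' hys)).comp y
        ((mdifferentiable_chart he).symm.mdifferentiableAt hy)
    exact (mdifferentiableAt_iff_differentiableAt.1 h1).hasFDerivAt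
  -- Change of variables by the transition map: its Jacobian is absorbed by the factor |det| between
  -- the two Gram densities.
  rw [← himg, lintegral_image_eq_lintegral_abs_det_fderiv_mul volume hTm
    (fun y hy => (hd y hy).hasFDerivWithinAt) hinj]
  refine setLIntegral_congr_fun hTm fun y hy => ?_
  have hy' : (e' ∘ e.symm) y ∈ e'.target := e'.map_source (hse' hy.2)
  have hnear : φ ∘ e.symm =ᶠ[nhds y] (φ ∘ e'.symm) ∘ (e' ∘ e.symm) := by
    have h1 : e.symm ⁻¹' e'.source ∈ nhds y :=
      (e.continuousAt_symm hy.1).preimage_mem_nhds (e'.open_source.mem_nhds (hse' hy.2))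
    filter_upwards [h1] with z hz
    simp [e'.left_inv hz]
  have hD : fderiv ℝ (φ ∘ e.symm) y = fderiv ℝ (φ ∘ e'.symm) ((e' ∘ e.symm) y) ∘L
      fderiv ℝ (e' ∘ e.symm) y := by
    rw [hnear.fderiv_eq]
    exact (((hM.chart he').hasFDerivAt_left hy').comp y (hd y hy)).fderiv
  simp only [metricMatrix_eq, inducedMetric]
  rw [hD, det_gram_comp, Real.sqrt_mul (sq_nonneg _), Real.sqrt_sq_eq_abs,
    ENNReal.ofReal_mul (abs_nonneg _)]

/-- The upper bound needs one measure that dominates every chart volume: the volume of `e` plus the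
top measure on the complement of `e.source`. On sets inside the source the second summand vanishes.
-/
lemma IsOrientedHypersurface.riemannianVolume_apply (hM : IsOrientedHypersurface φ ν)
    (he : e ∈ atlas (EuclideanSpace ℝ (Fin n)) M) {s : Set M} (hs : MeasurableSet s)
    (hse : s ⊆ e.source) : riemannianVolume φ s = chartVolume φ e s := by
  have hms := e.open_source.measurableSet
  refine le_antisymm ?_ (Measure.le_iff'.1 (le_iSup₂_of_le e he le_rfl) s)
  have h1 : riemannianVolume φ
      ≤ chartVolume φ e + (⊤ : Measure M).restrict e.sourceᶜ := by
    refine iSup₂_le fun e' he' => Measure.le_iff.2 fun t ht => ?_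
    rw [← measure_inter_add_sdiff t hms, Measure.add_apply]
    refine add_le_add ?_ ?_
    · rw [← chartVolume_inter_source φ e' (ht.inter hms), hM.chartVolume_eq he he'
        ((ht.inter hms).inter e'.open_source.measurableSet) (fun z hz => hz.1.2) (fun z hz => hz.2)]
      exact measure_mono fun z hz => hz.1.1
    · rw [Measure.restrict_apply ht, ← Set.sdiff_eq]
      exact Measure.le_iff'.1 le_top _
  refine (Measure.le_iff'.1 h1 s).trans ?_
  rw [Measure.add_apply, Measure.restrict_apply hs, Set.disjoint_iff_inter_eq_empty.1
    (Set.disjoint_compl_right_iff_subset.2 hse), measure_empty, add_zero]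

lemma IsOrientedHypersurface.riemannianVolume_restrict (hM : IsOrientedHypersurface φ ν)
    (he : e ∈ atlas (EuclideanSpace ℝ (Fin n)) M) :
    (riemannianVolume φ).restrict e.source = chartVolume φ e := by
  refine Measure.ext fun s hs => ?_
  rw [Measure.restrict_apply hs, hM.riemannianVolume_apply he
    (hs.inter e.open_source.measurableSet) Set.inter_subset_right, chartVolume_inter_source φ e hs]

/-! ### Finiteness, positivity and coordinate expression of the Riemannian volume. -/

lemma IsOrientedHypersurface.isLocallyFiniteMeasure (hM : IsOrientedHypersurface φ ν) :
    IsLocallyFiniteMeasure (riemannianVolume φ) := by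
  refine ⟨fun x => ?_⟩
  set e := chartAt (EuclideanSpace ℝ (Fin n)) x
  have he : e ∈ atlas (EuclideanSpace ℝ (Fin n)) M := chart_mem_atlas _ x
  have hx : x ∈ e.source := mem_chart_source _ x
  have hex : e x ∈ e.target := mem_chart_target _ x
  have hev : ∀ᶠ y in nhds (e x), √(metricMatrix φ e y).det < √(metricMatrix φ e (e x)).det + 1 :=
    ((hM.continuousOn_density he).continuousAt (e.open_target.mem_nhds hex)).eventually_lt_const
      (lt_add_one _)
  obtain ⟨r, hr, hrs⟩ := Metric.mem_nhds_iff.1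
    (Filter.inter_mem (e.open_target.mem_nhds hex) hev)
  have hop : IsOpen (e.source ∩ e ⁻¹' Metric.ball (e x) r) :=
    e.isOpen_inter_preimage Metric.isOpen_ball
  refine ⟨e.source ∩ e ⁻¹' Metric.ball (e x) r,
    hop.mem_nhds ⟨hx, Metric.mem_ball_self hr⟩, ?_⟩
  rw [hM.riemannianVolume_apply he hop.measurableSet Set.inter_subset_left,
    chartVolume_apply φ e hop.measurableSet]
  have hsub : e.target ∩ e.symm ⁻¹' (e.source ∩ e ⁻¹' Metric.ball (e x) r)
      ⊆ Metric.ball (e x) r := by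
    rintro z ⟨hz, -, hz2⟩
    simpa [e.right_inv hz] using hz2
  refine (lintegral_mono_set hsub).trans_lt ?_
  refine (setLIntegral_mono' (g := fun _ => ENNReal.ofReal (√(metricMatrix φ e (e x)).det + 1))
    measurableSet_ball fun z hz => ENNReal.ofReal_le_ofReal (le_of_lt (hrs hz).2)).trans_lt ?_
  rw [setLIntegral_const]
  exact ENNReal.mul_lt_top ENNReal.ofReal_lt_top measure_ball_lt_top

lemma IsOrientedHypersurface.isOpenPosMeasure (hM : IsOrientedHypersurface φ ν) :
    (riemannianVolume φ).IsOpenPosMeasure := by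
  refine ⟨fun U hU ⟨x, hx⟩ h0 => ?_⟩
  set e := chartAt (EuclideanSpace ℝ (Fin n)) x
  have he : e ∈ atlas (EuclideanSpace ℝ (Fin n)) M := chart_mem_atlas _ x
  have hxs : x ∈ e.source := mem_chart_source _ x
  have hm : IsOpen (e.target ∩ e.symm ⁻¹' U) := e.symm.isOpen_inter_preimage hU
  have h1 : chartVolume φ e U = 0 :=
    le_antisymm ((Measure.le_iff'.1 (le_iSup₂_of_le e he le_rfl) U).trans h0.le) zero_le
  rw [chartVolume_apply φ e hU.measurableSet, setLIntegral_eq_zero_iff' hm.measurableSet] at h1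
  · have h2 : volume (e.target ∩ e.symm ⁻¹' U) = 0 := by
      rw [measure_eq_zero_iff_ae_notMem]
      filter_upwards [h1] with y hy hyU
      have := hy hyU
      rw [ENNReal.ofReal_eq_zero] at this
      exact absurd this (not_le.2 (Real.sqrt_pos.2
        ((hM.chart he).isLocalMetric.det_pos hyU.1)))
    exact (hm.measure_pos volume ⟨e x, e.map_source hxs, by simpa [e.left_inv hxs] using hx⟩).ne' h2
  · exact (ENNReal.continuous_ofReal.comp_continuousOn ((hM.continuousOn_density he).mono
      Set.inter_subset_left)).aemeasurable hm.measurableSet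

lemma IsOrientedHypersurface.integral_eq_of_support (hM : IsOrientedHypersurface φ ν)
    (he : e ∈ atlas (EuclideanSpace ℝ (Fin n)) M) {f : M → ℝ} (hf : Continuous f)
    (hs : ∀ x ∉ e.source, f x = 0) :
    ∫ x, f x ∂(riemannianVolume φ)
      = ∫ y in e.target, √(metricMatrix φ e y).det * f (e.symm y) := by
  have hρ : AEMeasurable (fun y => ENNReal.ofReal √(metricMatrix φ e y).det)
      (volume.restrict e.target) :=
    (ENNReal.continuous_ofReal.comp_continuousOn
      (hM.continuousOn_density he)).aemeasurable e.open_target.measurableSet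
  rw [← setIntegral_eq_integral_of_forall_compl_eq_zero hs, hM.riemannianVolume_restrict he,
    chartVolume, integral_map (aemeasurable_chart_symm e _) hf.aestronglyMeasurable,
    integral_withDensity_eq_integral_toReal_smul₀ hρ
      (Filter.Eventually.of_forall fun _ => ENNReal.ofReal_lt_top)]
  refine integral_congr_ae (Filter.Eventually.of_forall fun y => ?_)
  simp [ENNReal.toReal_ofReal (Real.sqrt_nonneg _)]

end Volume

/-! ### Green's formula on a compact hypersurface -/

section Green

variable {M : Type*} [TopologicalSpace M] [ChartedSpace (EuclideanSpace ℝ (Fin n)) M]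
  {φ ν : M → EuclideanSpace ℝ (Fin (n + 2))}

/-- The height function `⟨a, φ⟩ + ⟨b, ν⟩`. -/
def height (φ ν : M → EuclideanSpace ℝ (Fin (n + 2))) (a b : EuclideanSpace ℝ (Fin (n + 2)))
    (x : M) : ℝ :=
  inner ℝ a (φ x) + inner ℝ b (ν x)

/-- The ambient vector whose tangential part is the gradient of `height φ ν a b`. -/
def heightGrad (φ ν : M → EuclideanSpace ℝ (Fin (n + 2))) (a b : EuclideanSpace ℝ (Fin (n + 2)))
    (x : M) : EuclideanSpace ℝ (Fin (n + 2)) :=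
  a - globalShape φ ν x b

/-- The product `⟨∇u, ∇v⟩` of the gradients of `u` and of the height function `v` of `a, b`. -/
def gradPair (φ ν : M → EuclideanSpace ℝ (Fin (n + 2))) (u : M → ℝ)
    (a b : EuclideanSpace ℝ (Fin (n + 2))) (x : M) : ℝ :=
  mfderiv (𝓡 n) 𝓘(ℝ, ℝ) u x (pinv (dmap φ x) (heightGrad φ ν a b x))

variable [IsManifold (𝓡 n) ∞ M] {e : OpenPartialHomeomorph M (EuclideanSpace ℝ (Fin n))}
  {y : EuclideanSpace ℝ (Fin n)}

lemma IsOrientedHypersurface.contMDiff_height (hM : IsOrientedHypersurface φ ν)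
    (a b : EuclideanSpace ℝ (Fin (n + 2))) :
    ContMDiff (𝓡 n) 𝓘(ℝ, ℝ) ∞ (height φ ν a b) :=
  contMDiff_of_charts fun _ he =>
    ((innerSL ℝ a).contDiff.comp_contDiffOn (hM.chart he).smooth_left).add
      ((innerSL ℝ b).contDiff.comp_contDiffOn (hM.chart he).smooth_right)

lemma IsOrientedHypersurface.pinv_chart (hM : IsOrientedHypersurface φ ν)
    (he : e ∈ atlas (EuclideanSpace ℝ (Fin n)) M) (hy : y ∈ e.target)
    (z : EuclideanSpace ℝ (Fin (n + 2))) :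
    pinv (fderiv ℝ (φ ∘ e.symm) y) z
      = (chartDeriv he hy).symm (pinv (dmap φ (e.symm y)) z) := by
  rw [fderiv_comp_chart_symm_eq he hy hM.contMDiff_immersion,
    pinv_comp_apply (hM.isFrame (e.symm y)).inj]

lemma IsOrientedHypersurface.gradPair_chart (hM : IsOrientedHypersurface φ ν)
    (he : e ∈ atlas (EuclideanSpace ℝ (Fin n)) M) (hy : y ∈ e.target) {u : M → ℝ}
    (hu : ContMDiff (𝓡 n) 𝓘(ℝ, ℝ) ∞ u) (a b : EuclideanSpace ℝ (Fin (n + 2))) :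
    gradPair φ ν u a b (e.symm y) = fderiv ℝ (u ∘ e.symm) y
      (pinv (fderiv ℝ (φ ∘ e.symm) y) (a - localShape (φ ∘ e.symm) (ν ∘ e.symm) y b)) := by
  rw [fderiv_comp_chart_symm he hy hu, hM.pinv_chart he hy, hM.localShape_eq he hy,
    ContinuousLinearEquiv.apply_symm_apply]
  rfl

/-- As dN = −A dF and A is self-adjoint, the coefficient `b` of N acts as −Ab on dF. This justifies
the form of `heightGrad`. -/
lemma IsOrientedHypersurface.fderiv_height_chart (hM : IsOrientedHypersurface φ ν)
    (he : e ∈ atlas (EuclideanSpace ℝ (Fin n)) M) (hy : y ∈ e.target)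
    (a b : EuclideanSpace ℝ (Fin (n + 2))) (w : EuclideanSpace ℝ (Fin n)) :
    fderiv ℝ (height φ ν a b ∘ e.symm) y w
      = inner ℝ (fderiv ℝ (φ ∘ e.symm) y w)
        (a - localShape (φ ∘ e.symm) (ν ∘ e.symm) y b) := by
  have h := hM.chart he
  have h1 : HasFDerivAt (height φ ν a b ∘ e.symm) _ y :=
    ((innerSL ℝ a).hasFDerivAt.comp y (h.hasFDerivAt_left hy)).add
      ((innerSL ℝ b).hasFDerivAt.comp y (h.hasFDerivAt_right hy))
  have h2 : localShape (φ ∘ e.symm) (ν ∘ e.symm) y (fderiv ℝ (φ ∘ e.symm) y w) = _ :=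
    (h.isFrame hy).ambShape_map w
  have h3 : inner ℝ _ b = (inner ℝ _ (localShape (φ ∘ e.symm) (ν ∘ e.symm) y b) : ℝ) :=
    (h.isFrame hy).ambShape_symm (fderiv ℝ (φ ∘ e.symm) y w) b
  rw [h1.fderiv, inner_sub_right, ← h3]
  have h4 : ambShape (fderiv ℝ (φ ∘ e.symm) y) (fderiv ℝ (ν ∘ e.symm) y)
      (fderiv ℝ (φ ∘ e.symm) y w) = -fderiv ℝ (ν ∘ e.symm) y w := h2
  rw [h4, inner_neg_left, sub_neg_eq_add, real_inner_comm, real_inner_comm b]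
  rfl

lemma IsOrientedHypersurface.contMDiff_gradPair (hM : IsOrientedHypersurface φ ν) {u : M → ℝ}
    (hu : ContMDiff (𝓡 n) 𝓘(ℝ, ℝ) ∞ u) (a b : EuclideanSpace ℝ (Fin (n + 2))) :
    ContMDiff (𝓡 n) 𝓘(ℝ, ℝ) ∞ (gradPair φ ν u a b) :=
  contMDiff_of_charts fun e he => by
    refine ContDiffOn.congr ?_ fun y hy => hM.gradPair_chart he hy hu a b
    exact (contDiffOn_fderiv e.open_target (contDiffOn_comp_chart_symm he hu)).clm_apply
      ((hM.chart he).contDiffOn_pinv.clm_apply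
        (contDiffOn_const.sub ((hM.chart he).contDiffOn_localShape.clm_apply contDiffOn_const)))

lemma IsOrientedHypersurface.gradPair_height (hM : IsOrientedHypersurface φ ν)
    (a b c d : EuclideanSpace ℝ (Fin (n + 2))) (x : M) :
    gradPair φ ν (height φ ν c d) a b x
      = inner ℝ (dmap φ x (pinv (dmap φ x) (heightGrad φ ν c d x)))
        (dmap φ x (pinv (dmap φ x) (heightGrad φ ν a b x))) := by
  have he := chart_mem_atlas (EuclideanSpace ℝ (Fin n)) x
  have hy := mem_chart_target (EuclideanSpace ℝ (Fin n)) x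
  have hx := (chartAt (EuclideanSpace ℝ (Fin n)) x).left_inv
    (mem_chart_source (EuclideanSpace ℝ (Fin n)) x)
  have h1 := hM.gradPair_chart he hy (hM.contMDiff_height c d) a b
  rw [hM.fderiv_height_chart he hy, hM.pinv_chart he hy, hM.localShape_eq he hy,
    fderiv_comp_chart_symm_eq he hy hM.contMDiff_immersion, ContinuousLinearMap.comp_apply,
    ContinuousLinearEquiv.coe_coe, ContinuousLinearEquiv.apply_symm_apply, hx] at h1
  rw [h1, real_inner_comm (dmap φ x (pinv (dmap φ x) (heightGrad φ ν a b x))),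
    inner_pinv (hM.isFrame x).inj]
  rfl

lemma IsOrientedHypersurface.gradPair_mul (hM : IsOrientedHypersurface φ ν) {u v : M → ℝ}
    (hu : ContMDiff (𝓡 n) 𝓘(ℝ, ℝ) ∞ u) (hv : ContMDiff (𝓡 n) 𝓘(ℝ, ℝ) ∞ v)
    (a b : EuclideanSpace ℝ (Fin (n + 2))) (x : M) :
    gradPair φ ν (fun x => u x * v x) a b x
      = u x * gradPair φ ν v a b x + v x * gradPair φ ν u a b x := by
  have he := chart_mem_atlas (EuclideanSpace ℝ (Fin n)) x
  have hy := mem_chart_target (EuclideanSpace ℝ (Fin n)) x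
  have hx := (chartAt (EuclideanSpace ℝ (Fin n)) x).left_inv
    (mem_chart_source (EuclideanSpace ℝ (Fin n)) x)
  have hop := (chartAt (EuclideanSpace ℝ (Fin n)) x).open_target
  have h1 := hM.gradPair_chart he hy (hu.mul hv) a b
  have h2 := hM.gradPair_chart he hy hu a b
  have h3 := hM.gradPair_chart he hy hv a b
  have h4 := (hasFDerivAt_of_contDiffOn hop hy (contDiffOn_comp_chart_symm he hu)).mul
    (hasFDerivAt_of_contDiffOn hop hy (contDiffOn_comp_chart_symm he hv))
  rw [show (u * v) ∘ (chartAt (EuclideanSpace ℝ (Fin n)) x).symm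
    = (u ∘ (chartAt (EuclideanSpace ℝ (Fin n)) x).symm) *
      (v ∘ (chartAt (EuclideanSpace ℝ (Fin n)) x).symm) from rfl, h4.fderiv] at h1
  simp only [add_apply, smul_apply, ← h2, ← h3, Function.comp_apply, hx, smul_eq_mul] at h1
  exact h1

lemma IsOrientedHypersurface.gradPair_sum (hM : IsOrientedHypersurface φ ν) {ι : Type*}
    [Fintype ι] {u : ι → M → ℝ} (hu : ∀ i, ContMDiff (𝓡 n) 𝓘(ℝ, ℝ) ∞ (u i))
    (hs : ContMDiff (𝓡 n) 𝓘(ℝ, ℝ) ∞ fun x => ∑ i, u i x)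
    (a b : EuclideanSpace ℝ (Fin (n + 2))) (x : M) :
    gradPair φ ν (fun x => ∑ i, u i x) a b x = ∑ i, gradPair φ ν (u i) a b x := by
  have he := chart_mem_atlas (EuclideanSpace ℝ (Fin n)) x
  have hy := mem_chart_target (EuclideanSpace ℝ (Fin n)) x
  have hx := (chartAt (EuclideanSpace ℝ (Fin n)) x).left_inv
    (mem_chart_source (EuclideanSpace ℝ (Fin n)) x)
  have hop := (chartAt (EuclideanSpace ℝ (Fin n)) x).open_target
  have h1 := hM.gradPair_chart he hy hs a b
  have h4 : HasFDerivAt ((fun x => ∑ i, u i x) ∘ (chartAt (EuclideanSpace ℝ (Fin n)) x).symm) _ _ :=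
    HasFDerivAt.fun_sum (u := Finset.univ) fun i _ =>
      hasFDerivAt_of_contDiffOn hop hy (contDiffOn_comp_chart_symm he (hu i))
  rw [h4.fderiv, sum_apply, hx] at h1
  rw [h1]
  refine Finset.sum_congr rfl fun i _ => ?_
  have := hM.gradPair_chart he hy (hu i) a b
  rw [hx] at this
  exact this.symm

lemma IsOrientedHypersurface.sum_pderiv_eq_gradPair (hM : IsOrientedHypersurface φ ν)
    (he : e ∈ atlas (EuclideanSpace ℝ (Fin n)) M) (hy : y ∈ e.target) {u : M → ℝ}
    (hu : ContMDiff (𝓡 n) 𝓘(ℝ, ℝ) ∞ u) (a b : EuclideanSpace ℝ (Fin (n + 2))) :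
    ∑ i, ∑ j, (metricMatrix φ e y)⁻¹ i j *
      (pderiv i (u ∘ e.symm) y * pderiv j (height φ ν a b ∘ e.symm) y)
      = gradPair φ ν u a b (e.symm y) := by
  rw [hM.gradPair_chart he hy hu, map_eq_sum (fderiv ℝ (u ∘ e.symm) y)]
  refine Finset.sum_congr rfl fun i _ => ?_
  rw [pinv_apply_coord, smul_eq_mul, Finset.sum_mul]
  refine Finset.sum_congr rfl fun j _ => ?_
  rw [pderiv, pderiv, hM.fderiv_height_chart he hy, metricMatrix_eq, inducedMetric]
  ring

/-- The composite `u ∘ e.symm` has junk values off the target, so it is cut off by an indicator.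
Smoothness survives because the support lies in the compact image of `tsupport u`. -/
lemma contDiff_indicator_chart [CompactSpace M] (he : e ∈ atlas (EuclideanSpace ℝ (Fin n)) M) {u : M → ℝ}
    (hu : ContMDiff (𝓡 n) 𝓘(ℝ, ℝ) ∞ u) (hs : tsupport u ⊆ e.source) :
    ContDiff ℝ ∞ (e.target.indicator (u ∘ e.symm)) ∧
      HasCompactSupport (e.target.indicator (u ∘ e.symm)) ∧
      tsupport (e.target.indicator (u ∘ e.symm)) ⊆ e.target := by
  have hK : IsCompact (e '' tsupport u) :=
    (isClosed_tsupport u).isCompact.image_of_continuousOn (e.continuousOn.mono hs)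
  have hKt : e '' tsupport u ⊆ e.target := by
    rintro _ ⟨x, hx, rfl⟩
    exact e.map_source (hs hx)
  have hsupp : Function.support (e.target.indicator (u ∘ e.symm)) ⊆ e '' tsupport u := by
    intro z hz
    have hzt : z ∈ e.target := Set.mem_of_indicator_ne_zero hz
    rw [Function.mem_support, Set.indicator_of_mem hzt] at hz
    exact ⟨e.symm z, subset_tsupport u hz, e.right_inv hzt⟩
  have hts : tsupport (e.target.indicator (u ∘ e.symm)) ⊆ e '' tsupport u :=
    closure_minimal hsupp hK.isClosed
  refine ⟨?_, hK.of_isClosed_subset (isClosed_tsupport _) hts, hts.trans hKt⟩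
  rw [contDiff_iff_contDiffAt]
  intro z
  by_cases hz : z ∈ e.target
  · refine ((contDiffOn_comp_chart_symm he hu).contDiffAt
      (e.open_target.mem_nhds hz)).congr_of_eventuallyEq ?_
    filter_upwards [e.open_target.mem_nhds hz] with w hw
    exact Set.indicator_of_mem hw _
  · exact (contDiffAt_const (c := (0 : ℝ))).congr_of_eventuallyEq
      (notMem_tsupport_iff_eventuallyEq.1 fun h => hz (hKt (hts h)))

/-- The Laplacian of `height φ ν a b` if the mean curvature is `H / n`. -/
def heightLaplacian (φ ν : M → EuclideanSpace ℝ (Fin (n + 2))) (H : ℝ)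
    (a b : EuclideanSpace ℝ (Fin (n + 2))) (x : M) : ℝ :=
  inner ℝ a (H • ν x - (n : ℝ) • φ x)
    + inner ℝ b (H • φ x - opTrace (globalShape φ ν x ∘L globalShape φ ν x) • ν x)

lemma IsOrientedHypersurface.continuous_heightLaplacian (hM : IsOrientedHypersurface φ ν) (H : ℝ)
    (a b : EuclideanSpace ℝ (Fin (n + 2))) : Continuous (heightLaplacian φ ν H a b) := by
  have h1 := hM.contMDiff_immersion.continuous
  have h2 := hM.contMDiff_gauss.continuous
  have h3 := hM.contMDiff_globalShape.continuous
  have h4 : Continuous fun x => opTrace (globalShape φ ν x ∘L globalShape φ ν x) :=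
    opTrace.continuous.comp (h3.clm_comp h3)
  unfold heightLaplacian
  fun_prop

variable [CompactSpace M] [MeasurableSpace M] [BorelSpace M]

lemma IsOrientedHypersurface.integral_green_of_tsupport (hM : IsOrientedHypersurface φ ν) {H : ℝ}
    (hH : ∀ x, opTrace (globalShape φ ν x) = H) (a b : EuclideanSpace ℝ (Fin (n + 2)))
    (he : e ∈ atlas (EuclideanSpace ℝ (Fin n)) M) {u : M → ℝ}
    (hu : ContMDiff (𝓡 n) 𝓘(ℝ, ℝ) ∞ u) (hs : tsupport u ⊆ e.source) :
    ∫ x, (u x * heightLaplacian φ ν H a b x + gradPair φ ν u a b x) ∂(riemannianVolume φ) = 0 := by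
  obtain ⟨h1, h2, h3⟩ := contDiff_indicator_chart he hu hs
  have hg := (hM.chart he).isLocalMetric.integral_green h1 h2 h3
    (contDiffOn_comp_chart_symm he (hM.contMDiff_height a b))
  have hcont : Continuous fun x => u x * heightLaplacian φ ν H a b x + gradPair φ ν u a b x :=
    (hu.continuous.mul (hM.continuous_heightLaplacian H a b)).add
      (hM.contMDiff_gradPair hu a b).continuous
  rw [hM.integral_eq_of_support he hcont]
  · refine Eq.trans (setIntegral_congr_fun e.open_target.measurableSet fun y hy => ?_)
      ((setIntegral_eq_integral_of_forall_compl_eq_zero fun y hy => ?_).trans hg)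
    · show _ = √(inducedMetric (φ ∘ e.symm) y).det * _
      have hind : e.target.indicator (u ∘ e.symm) =ᶠ[nhds y] u ∘ e.symm := by
        filter_upwards [e.open_target.mem_nhds hy] with w hw
        exact Set.indicator_of_mem hw _
      have hp : ∀ i, pderiv i (e.target.indicator (u ∘ e.symm)) y = pderiv i (u ∘ e.symm) y :=
        fun i => by rw [pderiv, hind.fderiv_eq, pderiv]
      have hL : coordLaplacian (metricMatrix φ e) (height φ ν a b ∘ e.symm) y
          = heightLaplacian φ ν H a b (e.symm y) := hM.coordLaplacian_height hH a b he hy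
      have hG := hM.sum_pderiv_eq_gradPair he hy hu a b
      simp only [hp, hind.eq_of_nhds, hL, ← metricMatrix_eq, hG, Function.comp_apply]
    · have hz : e.target.indicator (u ∘ e.symm) =ᶠ[nhds y] 0 :=
        notMem_tsupport_iff_eventuallyEq.1 fun h => hy (h3 h)
      have hp : ∀ i, pderiv i (e.target.indicator (u ∘ e.symm)) y = 0 :=
        fun i => by
          rw [pderiv, hz.fderiv_eq]
          simp
      simp [hp, hz.eq_of_nhds]
  · intro x hx
    have hz : u =ᶠ[nhds x] fun _ => (0 : ℝ) :=
      notMem_tsupport_iff_eventuallyEq.1 fun h => hx (hs h)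
    rw [gradPair, hz.mfderiv_eq, hz.eq_of_nhds, mfderiv_const, zero_mul]
    exact add_zero (0 : ℝ)

variable [T2Space M]

/-- **Green's formula** on a compact hypersurface of constant mean curvature. -/
lemma IsOrientedHypersurface.integral_green (hM : IsOrientedHypersurface φ ν) {H : ℝ}
    (hH : ∀ x, opTrace (globalShape φ ν x) = H) (a b : EuclideanSpace ℝ (Fin (n + 2)))
    {u : M → ℝ} (hu : ContMDiff (𝓡 n) 𝓘(ℝ, ℝ) ∞ u) :
    ∫ x, (u x * heightLaplacian φ ν H a b x + gradPair φ ν u a b x) ∂(riemannianVolume φ) = 0 := by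
  obtain ⟨t, ht⟩ := CompactSpace.elim_nhds_subcover
    (fun x : M => (chartAt (EuclideanSpace ℝ (Fin n)) x).source)
    fun x => chart_source_mem_nhds _ x
  -- Only the factor `u` is cut into pieces supported in charts; the height function stays global.
  -- The identity is linear in `u`, so the pieces add up.
  obtain ⟨f, hf⟩ := SmoothPartitionOfUnity.exists_isSubordinate (𝓡 n) isClosed_univ
    (fun i : t => (chartAt (EuclideanSpace ℝ (Fin n)) (i : M)).source)
    (fun i => (chartAt (EuclideanSpace ℝ (Fin n)) (i : M)).open_source)
    (fun x _ => by
      have : x ∈ ⋃ x ∈ t, (chartAt (EuclideanSpace ℝ (Fin n)) x).source := by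
        rw [ht]
        trivial
      simpa using this)
  have hsum : ∀ x, ∑ i, f i x = 1 := fun x => by
    rw [← finsum_eq_sum_of_fintype]
    exact f.sum_eq_one (Set.mem_univ x)
  have hfs : ∀ i, ContMDiff (𝓡 n) 𝓘(ℝ, ℝ) ∞ fun x => f i x * u x := fun i =>
    (f i).contMDiff.mul hu
  have hdec : u = fun x => ∑ i, f i x * u x := by
    ext x
    rw [← Finset.sum_mul, hsum, one_mul]
  have hzero : ∀ i, ∫ x, (f i x * u x * heightLaplacian φ ν H a b x
      + gradPair φ ν (fun x => f i x * u x) a b x) ∂(riemannianVolume φ) = 0 := fun i =>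
    hM.integral_green_of_tsupport hH a b (chart_mem_atlas _ (i : M)) (hfs i)
      ((tsupport_mul_subset_left).trans (hf i))
  have := hM.isLocallyFiniteMeasure
  have hint : ∀ i, Integrable (fun x => f i x * u x * heightLaplacian φ ν H a b x
      + gradPair φ ν (fun x => f i x * u x) a b x) (riemannianVolume φ) := fun i =>
    (((hfs i).continuous.mul (hM.continuous_heightLaplacian H a b)).add
      (hM.contMDiff_gradPair (hfs i) a b).continuous).integrable_of_hasCompactSupport
        (HasCompactSupport.of_compactSpace _)
  have hg : ∀ x, u x * heightLaplacian φ ν H a b x + gradPair φ ν u a b x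
      = ∑ i, (f i x * u x * heightLaplacian φ ν H a b x
        + gradPair φ ν (fun x => f i x * u x) a b x) := by
    intro x
    rw [Finset.sum_add_distrib, ← Finset.sum_mul, ← Finset.sum_mul, hsum, one_mul,
      ← hM.gradPair_sum hfs (hdec ▸ hu), ← hdec]
  simp only [hg]
  rw [integral_finsetSum _ fun i _ => hint i]
  exact Finset.sum_eq_zero fun i _ => hzero i

end Green

/-! ### The index form on the height functions -/

section Index

/-- For symmetric T the trace of T² is the sum of ‖T eᵢ‖² over an orthonormal basis. It serves both
the umbilicity criterion and the vanishing of `relationOp`. -/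
lemma eq_zero_of_opTrace_comp_self {m : ℕ}
    {T : EuclideanSpace ℝ (Fin m) →L[ℝ] EuclideanSpace ℝ (Fin m)}
    (hT : ∀ x y, inner ℝ (T x) y = (inner ℝ x (T y) : ℝ)) (h : opTrace (T ∘L T) ≤ 0) : T = 0 := by
  rw [opTrace_apply, LinearMap.trace_eq_sum_inner _ (EuclideanSpace.basisFun (Fin m) ℝ)] at h
  have h1 : ∀ i, inner ℝ (EuclideanSpace.basisFun (Fin m) ℝ i)
      ((T ∘L T).toLinearMap (EuclideanSpace.basisFun (Fin m) ℝ i))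
      = ‖T (EuclideanSpace.basisFun (Fin m) ℝ i)‖ ^ 2 := by
    intro i
    rw [← real_inner_self_eq_norm_sq, hT]
    rfl
  simp only [h1] at h
  have h2 := (Finset.sum_eq_zero_iff_of_nonneg fun i _ => sq_nonneg _).1
    (le_antisymm h (Finset.sum_nonneg fun i _ => sq_nonneg _))
  ext1 v
  rw [map_eq_sum T v]
  refine Finset.sum_eq_zero fun i _ => ?_
  have h3 := h2 i (Finset.mem_univ _)
  rw [sq_eq_zero_iff, norm_eq_zero, EuclideanSpace.basisFun_apply] at h3
  rw [h3, smul_zero]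

namespace IsFrame

variable {D D' : EuclideanSpace ℝ (Fin n) →L[ℝ] EuclideanSpace ℝ (Fin (n + 2))}
  {p q : EuclideanSpace ℝ (Fin (n + 2))}

lemma ambShape_comp_proj (D D' : EuclideanSpace ℝ (Fin n) →L[ℝ] EuclideanSpace ℝ (Fin (n + 2)))
    (hD : Function.Injective D) : ambShape D D' ∘L (D ∘L pinv D) = ambShape D D' := by
  ext1 z
  simp [ambShape, pinv_apply_map hD]

lemma proj_comp_ambShape (h : IsFrame D D' p q) :
    (D ∘L pinv D) ∘L ambShape D D' = ambShape D D' := by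
  ext1 z
  simp [ambShape, h.ambShape_map_eq_map]

lemma proj_symm (h : IsFrame D D' p q) (x y : EuclideanSpace ℝ (Fin (n + 2))) :
    inner ℝ (D (pinv D x)) y = (inner ℝ x (D (pinv D y)) : ℝ) :=
   (inner_pinv h.inj _ y).symm.trans ((real_inner_comm _ _).trans
    ((inner_pinv h.inj _ x).trans (real_inner_comm _ _)))

lemma opTrace_proj (h : IsFrame D D' p q) : opTrace (D ∘L pinv D) = n := by
  have h1 : pinv D ∘L D = ContinuousLinearMap.id ℝ _ := by
    ext1 v
    simp [pinv_apply_map h.inj]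
  rw [opTrace_comp_comm, h1, opTrace_apply]
  simp

/-- Equality in the inequality `(tr A)² ≤ n tr (A²)` characterises the umbilical points. -/
lemma leftInverse_eq_smul (h : IsFrame D D' p q) (hn : n ≠ 0)
    (hle : n * opTrace (ambShape D D' ∘L ambShape D D') ≤ opTrace (ambShape D D') ^ 2) :
    D.toLinearMap.leftInverse ∘ₗ (-D'.toLinearMap)
      = (opTrace (ambShape D D') / n) • LinearMap.id := by
  set A := ambShape D D' with hA
  set κ := opTrace A / n with hκ
  have hn' : (0 : ℝ) < n := by positivity
  -- The traceless part of A has square of trace s − H²/n, which is at most zero by `hle`.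
  have hT : A - κ • (D ∘L pinv D) = 0 := by
    refine eq_zero_of_opTrace_comp_self (fun x y => ?_) ?_
    · have := h.ambShape_symm x y
      have h2 := h.proj_symm x y
      simp only [sub_apply, smul_apply, ContinuousLinearMap.comp_apply, inner_sub_left,
        inner_sub_right, inner_smul_left, inner_smul_right, RCLike.conj_to_real]
      rw [this, h2]
    · have h1 : (A - κ • (D ∘L pinv D)) ∘L (A - κ • (D ∘L pinv D))
          = A ∘L A - (2 * κ) • A + κ ^ 2 • (D ∘L pinv D) := by
        have e1 := ambShape_comp_proj D D' h.inj
        have e2 := h.proj_comp_ambShape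
        have e3 : (D ∘L pinv D) ∘L (D ∘L pinv D) = D ∘L pinv D := by
          ext1 z
          simp [pinv_apply_map h.inj]
        rw [← hA] at e1 e2
        rw [ContinuousLinearMap.sub_comp, ContinuousLinearMap.comp_sub,
          ContinuousLinearMap.comp_sub, ContinuousLinearMap.comp_smul,
          ContinuousLinearMap.smul_comp, ContinuousLinearMap.smul_comp,
          ContinuousLinearMap.comp_smul, e1, e2, e3]
        module
      rw [h1, map_add, map_sub, map_smul, map_smul, h.opTrace_proj, smul_eq_mul, smul_eq_mul]
      have h3 : opTrace A = n * κ := by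
        rw [hκ]
        field_simp
      rw [h3] at hle ⊢
      nlinarith
  rw [h.leftInverse_comp]
  ext1 v
  apply h.inj
  have h4 := DFunLike.congr_fun hT (D v)
  simp only [sub_apply, smul_apply, ContinuousLinearMap.comp_apply, pinv_apply_map h.inj,
    zero_apply, sub_eq_zero] at h4
  rw [hA, h.ambShape_map] at h4
  simp only [LinearMap.neg_apply, ContinuousLinearMap.coe_coe, ContinuousLinearMap.comp_apply,
    map_neg, h.ambShape_map_eq_map, LinearMap.smul_apply, LinearMap.id_apply, map_smul]
  exact h4

end IsFrame

variable {M : Type*} [TopologicalSpace M] [ChartedSpace (EuclideanSpace ℝ (Fin n)) M]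
  {φ ν : M → EuclideanSpace ℝ (Fin (n + 2))}

/-- The coefficients on the left are those of J applied to the height function. On (a,b) the
matrices of Δ and J are (−n, H; H, −s) and (s, H; H, n), and their product is the scalar −(ns − H²).
-/
lemma heightLaplacian_jacobi {H s : ℝ}
    (hs : ∀ x, opTrace (globalShape φ ν x ∘L globalShape φ ν x) = s)
    (a b : EuclideanSpace ℝ (Fin (n + 2))) (x : M) :
    heightLaplacian φ ν H (s • a + H • b) (H • a + (n : ℝ) • b) x
      = -(n * s - H ^ 2) * height φ ν a b x := by
  simp only [heightLaplacian, height, hs, inner_add_left, inner_smul_left, inner_sub_right,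
    inner_smul_right, RCLike.conj_to_real]
  ring

/-- The linear map which sends `a, b` to the height function. -/
def heightLinear (φ ν : M → EuclideanSpace ℝ (Fin (n + 2))) :
    (EuclideanSpace ℝ (Fin (n + 2)) × EuclideanSpace ℝ (Fin (n + 2))) →ₗ[ℝ] (M → ℝ) where
  toFun p := height φ ν p.1 p.2
  map_add' p q := by
    ext x
    simp only [height, Prod.fst_add, Prod.snd_add, inner_add_left, Pi.add_apply]
    ring
  map_smul' c p := by
    ext x
    simp only [height, Prod.smul_fst, Prod.smul_snd, inner_smul_left, Pi.smul_apply,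
      RCLike.conj_to_real, RingHom.id_apply, smul_eq_mul]
    ring

variable [IsManifold (𝓡 n) ∞ M]

lemma IsOrientedHypersurface.isTotallyUmbilical (hM : IsOrientedHypersurface φ ν)
    (h : ∀ x, n * opTrace (globalShape φ ν x ∘L globalShape φ ν x)
      ≤ opTrace (globalShape φ ν x) ^ 2) : IsTotallyUmbilical φ ν := by
  intro x
  rcases eq_or_ne n 0 with rfl | hn
  · refine ⟨0, LinearMap.ext fun v => ?_⟩
    exact Subsingleton.elim (α := EuclideanSpace ℝ (Fin 0)) _ _
  · exact ⟨_, (hM.isFrame x).leftInverse_eq_smul hn (h x)⟩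

lemma IsOrientedHypersurface.jacobi_height (hM : IsOrientedHypersurface φ ν) {H s : ℝ}
    (hH : ∀ x, opTrace (globalShape φ ν x) = H)
    (hs : ∀ x, opTrace (globalShape φ ν x ∘L globalShape φ ν x) = s)
    (a b : EuclideanSpace ℝ (Fin (n + 2))) (x : M) :
    jacobi φ ν (height φ ν a b) x
      = height φ ν (s • a + H • b) (H • a + (n : ℝ) • b) x := by
  have hx := (chartAt (EuclideanSpace ℝ (Fin n)) x).left_inv
    (mem_chart_source (EuclideanSpace ℝ (Fin n)) x)
  have h1 : laplacian φ (height φ ν a b) x = _ := hM.coordLaplacian_height hH a b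
    (chart_mem_atlas (EuclideanSpace ℝ (Fin n)) x) (mem_chart_target _ x)
  rw [jacobi, h1, hx, hM.normSqShape_eq, hs]
  simp only [height, inner_add_left, inner_smul_left, inner_sub_right, inner_smul_right,
    RCLike.conj_to_real]
  ring

lemma IsOrientedHypersurface.gradPair_height_self_nonneg (hM : IsOrientedHypersurface φ ν)
    (a b : EuclideanSpace ℝ (Fin (n + 2))) (x : M) :
    0 ≤ gradPair φ ν (height φ ν a b) a b x := by
  rw [hM.gradPair_height]
  exact real_inner_self_nonneg

variable [CompactSpace M] [MeasurableSpace M] [BorelSpace M]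

lemma IsOrientedHypersurface.eq_zero_of_integral_eq_zero (hM : IsOrientedHypersurface φ ν)
    {f : M → ℝ} (hf : Continuous f) (h0 : ∀ x, 0 ≤ f x)
    (hi : ∫ x, f x ∂(riemannianVolume φ) = 0) (x : M) : f x = 0 := by
  have := hM.isLocallyFiniteMeasure
  have := hM.isOpenPosMeasure
  have hint : Integrable f (riemannianVolume φ) :=
    hf.integrable_of_hasCompactSupport (HasCompactSupport.of_compactSpace _)
  have h1 := (integral_eq_zero_iff_of_nonneg h0 hint).1 hi
  exact congrFun ((Continuous.ae_eq_iff_eq (riemannianVolume φ) hf continuous_const).1 h1) x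

variable [T2Space M]

/-- The index form is negative definite on the height functions, and these have mean value zero. -/
lemma IsOrientedHypersurface.jacobiForm_height_neg (hM : IsOrientedHypersurface φ ν) {H s : ℝ}
    (hH : ∀ x, opTrace (globalShape φ ν x) = H)
    (hs : ∀ x, opTrace (globalShape φ ν x ∘L globalShape φ ν x) = s) (hδ : 0 < n * s - H ^ 2)
    (a b : EuclideanSpace ℝ (Fin (n + 2))) :
    ∫ x, height φ ν a b x ∂(riemannianVolume φ) = 0 ∧
      (height φ ν a b ≠ 0 → jacobiForm φ ν (height φ ν a b) < 0) := by
  have := hM.isLocallyFiniteMeasure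
  set c := s • a + H • b with hc
  set d := H • a + (n : ℝ) • b with hd
  set δ := n * s - H ^ 2 with hδdef
  have hL : ∀ x, heightLaplacian φ ν H c d x = -δ * height φ ν a b x :=
    heightLaplacian_jacobi hs a b
  -- Write f for the height of `a`, `b`, so that Jf is the height of `c`, `d`. As Δ(Jf) = −δf,
  -- Green's formula reads ∫⟨∇u, ∇Jf⟩ = δ ∫ u f; the cases used below are u = 1, u = Jf and u = f.
  have hgreen : ∀ u : M → ℝ, ContMDiff (𝓡 n) 𝓘(ℝ, ℝ) ∞ u →
      ∫ x, gradPair φ ν u c d x ∂(riemannianVolume φ)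
        = δ * ∫ x, u x * height φ ν a b x ∂(riemannianVolume φ) := by
    intro u hu
    have h1 := hM.integral_green hH c d hu
    have i1 : Integrable (fun x => u x * heightLaplacian φ ν H c d x) (riemannianVolume φ) :=
      (hu.continuous.mul (hM.continuous_heightLaplacian H c d)).integrable_of_hasCompactSupport
        (HasCompactSupport.of_compactSpace _)
    have i2 : Integrable (gradPair φ ν u c d) (riemannianVolume φ) :=
      (hM.contMDiff_gradPair hu c d).continuous.integrable_of_hasCompactSupport
        (HasCompactSupport.of_compactSpace _)
    rw [integral_add i1 i2] at h1
    have h2 : ∫ x, u x * heightLaplacian φ ν H c d x ∂(riemannianVolume φ)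
        = -δ * ∫ x, u x * height φ ν a b x ∂(riemannianVolume φ) := by
      rw [← integral_const_mul]
      refine integral_congr_ae (Filter.Eventually.of_forall fun x => ?_)
      simp only [hL]
      ring
    linarith
  constructor
  · have h1 := hgreen (fun _ => 1) contMDiff_const
    have h2 : ∀ x, gradPair φ ν (fun _ => (1 : ℝ)) c d x = 0 := fun x => by
      rw [gradPair, mfderiv_const]
      rfl
    simp only [h2, integral_zero, one_mul] at h1
    exact (mul_eq_zero.1 h1.symm).resolve_left hδ.ne'
  · intro hne
    have h1 := hgreen _ (hM.contMDiff_height c d)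
    have hcont := (hM.contMDiff_gradPair (hM.contMDiff_height c d) c d).continuous
    have hnn := hM.gradPair_height_self_nonneg c d
    have h2 : 0 < ∫ x, gradPair φ ν (height φ ν c d) c d x ∂(riemannianVolume φ) := by
      -- If the integral of |∇Jf|² were zero, then ∇Jf = 0 everywhere, and the formula with u = f
      -- would give δ ∫ f² = 0, that is f = 0.
      refine lt_of_le_of_ne (integral_nonneg hnn) fun h0 => hne ?_
      have h3 := hM.eq_zero_of_integral_eq_zero hcont hnn h0.symm
      have h4 : ∀ x, pinv (dmap φ x) (heightGrad φ ν c d x) = 0 := by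
        intro x
        have := h3 x
        rw [hM.gradPair_height, inner_self_eq_zero] at this
        exact (hM.isFrame x).inj (this.trans (map_zero _).symm)
      have h5 := hgreen _ (hM.contMDiff_height a b)
      have h6 : ∀ x, gradPair φ ν (height φ ν a b) c d x = 0 := fun x => by
        rw [gradPair, h4]
        exact map_zero (mfderiv (𝓡 n) 𝓘(ℝ, ℝ) (height φ ν a b) x)
      simp only [h6, integral_zero] at h5
      have h7 := hM.eq_zero_of_integral_eq_zero
        ((hM.contMDiff_height a b).continuous.mul (hM.contMDiff_height a b).continuous)
        (fun x => mul_self_nonneg _) ((mul_eq_zero.1 h5.symm).resolve_left hδ.ne')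
      ext x
      exact mul_self_eq_zero.1 (h7 x)
    rw [h1] at h2
    have h8 := pos_of_mul_pos_right h2 hδ.le
    rw [jacobiForm, neg_lt_zero]
    refine h8.trans_eq (integral_congr_ae (Filter.Eventually.of_forall fun x => ?_))
    simp only [hM.jacobi_height hH hs]
    exact mul_comm _ _

lemma IsOrientedHypersurface.le_weakIndex (hM : IsOrientedHypersurface φ ν) {H s : ℝ}
    (hH : ∀ x, opTrace (globalShape φ ν x) = H)
    (hs : ∀ x, opTrace (globalShape φ ν x ∘L globalShape φ ν x) = s) (hδ : 0 < n * s - H ^ 2)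
    (hinj : ∀ a b, height φ ν a b = 0 → a = 0 ∧ b = 0) :
    ((2 * n + 4 : ℕ) : ℕ∞) ≤ weakIndex φ ν := by
  have hi : Function.Injective (heightLinear φ ν) := by
    rw [← LinearMap.ker_eq_bot, LinearMap.ker_eq_bot']
    rintro ⟨a, b⟩ h
    obtain ⟨rfl, rfl⟩ := hinj a b h
    rfl
  have hrank : Cardinal.toENat (Module.rank ℝ (LinearMap.range (heightLinear φ ν)))
      = ((2 * n + 4 : ℕ) : ℕ∞) := by
    have h1 := LinearMap.finrank_range_of_inj hi
    rw [← Module.finrank_eq_rank, h1]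
    simp
    norm_cast
    ring
  rw [← hrank]
  refine le_iSup₂_of_le (LinearMap.range (heightLinear φ ν)) ?_ le_rfl
  rintro f ⟨⟨a, b⟩, rfl⟩
  obtain ⟨h1, h2⟩ := hM.jacobiForm_height_neg hH hs hδ a b
  exact ⟨hM.contMDiff_height a b, h1, h2⟩

end Index

/-! ### Linear relations between the position vector and the Gauss map -/

section Relation

variable {U : Set (EuclideanSpace ℝ (Fin n))}
  {F N : EuclideanSpace ℝ (Fin n) → EuclideanSpace ℝ (Fin (n + 2))}
  {y : EuclideanSpace ℝ (Fin n)}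

/-- The orthogonal projection to the complement of two orthonormal vectors. -/
def tanProj (p q : EuclideanSpace ℝ (Fin (n + 2))) :
    EuclideanSpace ℝ (Fin (n + 2)) →L[ℝ] EuclideanSpace ℝ (Fin (n + 2)) :=
  ContinuousLinearMap.id ℝ _ - (innerSL ℝ p).smulRight p - (innerSL ℝ q).smulRight q

namespace IsFrame

variable {D D' : EuclideanSpace ℝ (Fin n) →L[ℝ] EuclideanSpace ℝ (Fin (n + 2))}
  {p q : EuclideanSpace ℝ (Fin (n + 2))}

lemma proj_eq (h : IsFrame D D' p q) : D ∘L pinv D = tanProj p q := by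
  ext1 z
  simp [tanProj, h.map_pinv]

/-- Only the tangential block of C enters the trace against a tangential B. So the ambient
derivative of A may be replaced by the covariant one inside such traces. -/
lemma opTrace_comp_of_sandwich
    {B C P : EuclideanSpace ℝ (Fin (n + 2)) →L[ℝ] EuclideanSpace ℝ (Fin (n + 2))}
    (hB : tanProj p q ∘L B = B) (hB' : B ∘L tanProj p q = B)
    (hC : tanProj p q ∘L C ∘L tanProj p q = P) : opTrace (B ∘L C) = opTrace (B ∘L P) := by
  have h1 : B ∘L P = (B ∘L C) ∘L tanProj p q := by
    rw [← hC, ← ContinuousLinearMap.comp_assoc, hB', ContinuousLinearMap.comp_assoc]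
  rw [h1, ← opTrace_comp_comm (tanProj p q), ← ContinuousLinearMap.comp_assoc, hB]

end IsFrame

namespace IsLocalHypersurface

lemma mono (h : IsLocalHypersurface U F N) {W : Set (EuclideanSpace ℝ (Fin n))} (hW : IsOpen W)
    (hWU : W ⊆ U) : IsLocalHypersurface W F N where
  isOpen := hW
  smooth_left := h.smooth_left.mono hWU
  smooth_right := h.smooth_right.mono hWU
  inj y hy := h.inj y (hWU hy)
  norm_left y hy := h.norm_left y (hWU hy)
  norm_right y hy := h.norm_right y (hWU hy)
  orth y hy := h.orth y (hWU hy)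
  normal y hy := h.normal y (hWU hy)

lemma fderiv_inner_left (h : IsLocalHypersurface U F N) (hy : y ∈ U)
    (a : EuclideanSpace ℝ (Fin (n + 2))) :
    HasFDerivAt (fun z => (inner ℝ a (F z) : ℝ)) (innerSL ℝ a ∘L fderiv ℝ F y) y :=
  (innerSL ℝ a).hasFDerivAt.comp y (h.hasFDerivAt_left hy)

lemma fderiv_inner_right (h : IsLocalHypersurface U F N) (hy : y ∈ U)
    (a : EuclideanSpace ℝ (Fin (n + 2))) :
    HasFDerivAt (fun z => (inner ℝ a (N z) : ℝ)) (innerSL ℝ a ∘L fderiv ℝ N y) y :=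
  (innerSL ℝ a).hasFDerivAt.comp y (h.hasFDerivAt_right hy)

/-- The gradient of the relation: Ab is the tangential part of a. -/
lemma localShape_eq_of_relation (h : IsLocalHypersurface U F N)
    {a b : EuclideanSpace ℝ (Fin (n + 2))}
    (hab : ∀ z ∈ U, inner ℝ a (F z) + inner ℝ b (N z) = (0 : ℝ)) (hy : y ∈ U) :
    localShape F N y b = a - (inner ℝ a (F y) : ℝ) • F y - (inner ℝ a (N y) : ℝ) • N y := by
  have hf := h.isFrame hy
  have h1 := fderiv_eq_of_eqOn h.isOpen hy hab
    ((h.fderiv_inner_left hy a).add (h.fderiv_inner_right hy b)) (hasFDerivAt_const _ _)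
  have hqp : inner ℝ (N y) (F y) = (0 : ℝ) := by rw [real_inner_comm, hf.orth]
  refine hf.ext_inner (fun v => ?_) ?_ ?_
  · have h2 := DFunLike.congr_fun h1 v
    simp only [add_apply, ContinuousLinearMap.comp_apply, innerSL_apply_apply, zero_apply] at h2
    rw [localShape, hf.ambShape_symm, hf.ambShape_map, inner_neg_right, inner_sub_left,
      inner_sub_left, inner_smul_left, inner_smul_left, hf.left_left, hf.right_left]
    linarith
  · rw [localShape, real_inner_comm, hf.inner_left_ambShape, inner_sub_left,
      inner_sub_left, inner_smul_left, inner_smul_left, hf.norm_left, hqp]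
    simp
  · rw [localShape, real_inner_comm, hf.inner_right_ambShape, inner_sub_left,
      inner_sub_left, inner_smul_left, inner_smul_left, hf.norm_right, hf.orth]
    simp

/-- The covariant derivative of the shape operator in the direction of the tangential part of `b`
if `⟨a, F⟩ + ⟨b, N⟩ = 0`. -/
lemma fderiv_localShape_of_relation (h : IsLocalHypersurface U F N)
    {a b : EuclideanSpace ℝ (Fin (n + 2))}
    (hab : ∀ z ∈ U, inner ℝ a (F z) + inner ℝ b (N z) = (0 : ℝ)) (hy : y ∈ U) :
    tanProj (F y) (N y) ∘L fderiv ℝ (localShape F N) y (pinv (fderiv ℝ F y) b) ∘L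
        tanProj (F y) (N y)
      = (inner ℝ a (F y) : ℝ) • (localShape F N y ∘L localShape F N y - tanProj (F y) (N y))
        + (inner ℝ a (N y) + inner ℝ b (F y) : ℝ) • localShape F N y := by
  have hf := h.isFrame hy
  set A := localShape F N y with hA
  have key : ∀ v, fderiv ℝ (localShape F N) y (pinv (fderiv ℝ F y) b) (fderiv ℝ F y v)
      = (inner ℝ a (F y) : ℝ) • (A (A (fderiv ℝ F y v)) - fderiv ℝ F y v)
        + (inner ℝ a (N y) + inner ℝ b (F y) : ℝ) • A (fderiv ℝ F y v)
        - (inner ℝ a (fderiv ℝ F y v) : ℝ) • F y - (inner ℝ a (fderiv ℝ N y v) : ℝ) • N y := by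
    intro v
    have lhs := (h.hasFDerivAt_localShape hy).clm_apply (hasFDerivAt_const b y)
    have rhs := ((hasFDerivAt_const a y).sub
      ((h.fderiv_inner_left hy a).smul (h.hasFDerivAt_left hy))).sub
        ((h.fderiv_inner_right hy a).smul (h.hasFDerivAt_right hy))
    have e1 := DFunLike.congr_fun (fderiv_eq_of_eqOn h.isOpen hy
      (fun z hz => h.localShape_eq_of_relation hab hz) lhs rhs) v
    simp only [add_apply, sub_apply, neg_apply, ContinuousLinearMap.comp_apply, zero_apply, map_zero,
      ContinuousLinearMap.flip_apply, smul_apply, ContinuousLinearMap.smulRight_apply,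
      innerSL_apply_apply, zero_add, zero_sub] at e1
    have e2 : A (fderiv ℝ F y v) = -fderiv ℝ N y v := hf.ambShape_map v
    have e3 : inner ℝ (N y) b = -(inner ℝ a (F y) : ℝ) := by
      rw [real_inner_comm]
      linarith [hab y hy]
    have e4 : fderiv ℝ (localShape F N) y v b
        = fderiv ℝ (localShape F N) y v (fderiv ℝ F y (pinv (fderiv ℝ F y) b))
          + (inner ℝ (F y) b : ℝ) • fderiv ℝ N y v
          + (inner ℝ (N y) b : ℝ) • A (A (fderiv ℝ F y v)) := by
      conv_lhs => rw [hf.decomp b]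
      rw [map_add, map_add, map_smul, map_smul, h.fderiv_localShape_left hy,
        h.fderiv_localShape_right hy]
    -- The previous lemma was differentiated in the direction `v`. Codazzi exchanges the directions,
    -- so that the tangential part of `b` becomes the direction of differentiation and `v` the
    -- argument.
    rw [h.fderiv_localShape_map_comm hy, eq_sub_of_add_eq (eq_sub_of_add_eq e4.symm), e1, e3,
      real_inner_comm (F y) b, e2, map_neg]
    module
  ext1 z
  simp only [← hf.proj_eq, ContinuousLinearMap.comp_apply, add_apply, sub_apply, smul_apply]
  rw [key]
  have p1 : ∀ z, fderiv ℝ F y (pinv (fderiv ℝ F y) (A z)) = A z :=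
    DFunLike.congr_fun hf.proj_comp_ambShape
  have p2 : A (fderiv ℝ F y (pinv (fderiv ℝ F y) z)) = A z :=
    DFunLike.congr_fun (IsFrame.ambShape_comp_proj _ _ hf.inj) z
  simp only [map_sub, map_add, map_smul, p1, p2, pinv_apply_map hf.inj, hf.pinv_left,
    hf.pinv_right, smul_zero, sub_zero]

lemma hasFDerivAt_opTrace_sq (h : IsLocalHypersurface U F N) (hy : y ∈ U)
    (w : EuclideanSpace ℝ (Fin n)) :
    ∃ L : EuclideanSpace ℝ (Fin n) →L[ℝ] ℝ,
      HasFDerivAt (fun z => opTrace (localShape F N z ∘L localShape F N z)) L y ∧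
        L w = 2 * opTrace (localShape F N y ∘L fderiv ℝ (localShape F N) y w) := by
  have h1 := h.hasFDerivAt_localShape hy
  refine ⟨_, (opTrace (E := EuclideanSpace ℝ (Fin (n + 2)))).hasFDerivAt.comp y (h1.clm_comp h1), ?_⟩
  simp only [ContinuousLinearMap.comp_apply, add_apply, map_add,
    ContinuousLinearMap.compL_apply, ContinuousLinearMap.flip_apply]
  rw [opTrace_comp_comm (fderiv ℝ (localShape F N) y w)]
  ring

lemma hasFDerivAt_opTrace_cube (h : IsLocalHypersurface U F N) (hy : y ∈ U)
    (w : EuclideanSpace ℝ (Fin n)) :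
    ∃ L : EuclideanSpace ℝ (Fin n) →L[ℝ] ℝ,
      HasFDerivAt (fun z => opTrace (localShape F N z ∘L localShape F N z ∘L localShape F N z))
        L y ∧ L w = 3 * opTrace ((localShape F N y ∘L localShape F N y) ∘L
          fderiv ℝ (localShape F N) y w) := by
  have h1 := h.hasFDerivAt_localShape hy
  refine ⟨_, (opTrace (E := EuclideanSpace ℝ (Fin (n + 2)))).hasFDerivAt.comp y (h1.clm_comp (h1.clm_comp h1)), ?_⟩
  set C := fderiv ℝ (localShape F N) y w with hC
  set A := localShape F N y with hA
  simp only [ContinuousLinearMap.comp_apply, add_apply, map_add,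
    ContinuousLinearMap.compL_apply, ContinuousLinearMap.flip_apply, ← hC]
  have e1 : opTrace (A ∘L (C ∘L A)) = opTrace ((A ∘L A) ∘L C) := by
    rw [opTrace_comp_comm, ContinuousLinearMap.comp_assoc, opTrace_comp_comm]
  have e2 : opTrace (C ∘L (A ∘L A)) = opTrace ((A ∘L A) ∘L C) := opTrace_comp_comm _ _
  have e3 : opTrace (A ∘L (A ∘L C)) = opTrace ((A ∘L A) ∘L C) := by
    rw [ContinuousLinearMap.comp_assoc]
  rw [e1, e2, e3]
  ring

lemma opTrace_comp_fderiv_eq_zero (h : IsLocalHypersurface U F N) (hy : y ∈ U) {s : ℝ}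
    (hs : ∀ z ∈ U, opTrace (localShape F N z ∘L localShape F N z) = s)
    (w : EuclideanSpace ℝ (Fin n)) :
    opTrace (localShape F N y ∘L fderiv ℝ (localShape F N) y w) = 0 := by
  obtain ⟨L, h1, h2⟩ := h.hasFDerivAt_opTrace_sq hy w
  have h3 := fderiv_eq_of_eqOn h.isOpen hy hs h1 (hasFDerivAt_const _ _)
  rw [h3] at h2
  simpa using h2.symm

/-- A relation `⟨a, F⟩ + ⟨b, N⟩ = 0` with `⟨a, F⟩ = 0` on an open set is trivial. -/
lemma eq_zero_of_relation (h : IsLocalHypersurface U F N) (hy : y ∈ U)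
    {a b : EuclideanSpace ℝ (Fin (n + 2))} (h1 : ∀ z ∈ U, inner ℝ a (F z) = (0 : ℝ))
    (h2 : ∀ z ∈ U, inner ℝ b (N z) = (0 : ℝ))
    (h3 : ∀ z ∈ U, inner ℝ a (N z) + inner ℝ b (F z) = (0 : ℝ))
    (hs : opTrace (localShape F N y ∘L localShape F N y) ≠ 0) : a = 0 ∧ b = 0 := by
  -- Differentiating ⟨a,F⟩ = 0 makes `a` normal to the hypersurface and to F, hence a multiple of N.
  -- Were the multiple nonzero at `y`, the constancy of `a` would force dN = 0 there, so A = 0,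
  -- against `hs`.
  have ha : ∀ z ∈ U, a = (inner ℝ a (N z) : ℝ) • N z := by
    intro z hz
    have e1 := fderiv_eq_of_eqOn h.isOpen hz h1 (h.fderiv_inner_left hz a) (hasFDerivAt_const _ _)
    refine (h.isFrame hz).ext_inner (fun v => ?_) ?_ ?_
    · have := DFunLike.congr_fun e1 v
      simp only [ContinuousLinearMap.comp_apply, innerSL_apply_apply, zero_apply] at this
      rw [this, inner_smul_left, (h.isFrame hz).right_left, mul_zero]
    · rw [h1 z hz, inner_smul_left, real_inner_comm (F z), (h.isFrame hz).orth, mul_zero]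
    · rw [inner_smul_left, (h.isFrame hz).norm_right]
      simp
  have hb : b = (inner ℝ b (F y) : ℝ) • F y := by
    have hf := h.isFrame hy
    have e1 := fderiv_eq_of_eqOn h.isOpen hy h3
      ((h.fderiv_inner_right hy a).add (h.fderiv_inner_left hy b)) (hasFDerivAt_const _ _)
    refine hf.ext_inner (fun v => ?_) ?_ ?_
    · have := DFunLike.congr_fun e1 v
      simp only [add_apply, ContinuousLinearMap.comp_apply, innerSL_apply_apply, zero_apply] at this
      have e2 : inner ℝ a (fderiv ℝ N y v) = (0 : ℝ) := by
        rw [ha y hy, inner_smul_left, hf.right_right, mul_zero]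
      rw [inner_smul_left, hf.left_left, mul_zero]
      linarith
    · rw [inner_smul_left, hf.norm_left]
      simp
    · rw [h2 y hy, inner_smul_left, hf.orth, mul_zero]
  have hg : (inner ℝ a (N y) : ℝ) = 0 := by
    by_contra hne
    apply hs
    have hN : fderiv ℝ N y = 0 := by
      ext1 v
      have e1 := fderiv_eq_of_eqOn h.isOpen hy ha (hasFDerivAt_const a y)
        ((h.fderiv_inner_right hy a).smul (h.hasFDerivAt_right hy))
      have e2 := congrArg (fun z => (inner ℝ (fderiv ℝ N y v) z : ℝ)) (DFunLike.congr_fun e1 v)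
      simp only [zero_apply, inner_zero_right, add_apply, smul_apply,
        ContinuousLinearMap.smulRight_apply, inner_add_right, inner_smul_right] at e2
      rw [real_inner_comm (N y) (fderiv ℝ N y v), (h.isFrame hy).right_right, mul_zero, add_zero] at e2
      have e3 := (mul_eq_zero.1 e2.symm).resolve_left hne
      rwa [inner_self_eq_zero] at e3
    have hA : localShape F N y = 0 := by
      simp [localShape, ambShape, hN]
    simp [hA]
  have h4 := h3 y hy
  rw [hg, zero_add] at h4
  exact ⟨by rw [ha y hy, hg, zero_smul], by rw [hb, h4, zero_smul]⟩

/-- If the shape operator satisfies a quadratic equation `A² + c A = 1`, where `c` is a function,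
then `tr A³` is locally constant. -/
lemma fderiv_opTrace_cube_eq_zero (h : IsLocalHypersurface U F N) (hy : y ∈ U) {H s c : ℝ}
    (hH : ∀ z ∈ U, opTrace (localShape F N z) = H)
    (hs : ∀ z ∈ U, opTrace (localShape F N z ∘L localShape F N z) = s)
    (hq : localShape F N y ∘L localShape F N y + c • localShape F N y = tanProj (F y) (N y)) :
    HasFDerivAt (fun z => opTrace (localShape F N z ∘L localShape F N z ∘L localShape F N z))
      (0 : EuclideanSpace ℝ (Fin n) →L[ℝ] ℝ) y := by
  have hf := h.isFrame hy
  -- Replace A² by 1 − cA on the tangent space: the two traces that arise are derivatives of tr A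
  -- and, up to the factor ½, of tr A². Thus c need not be constant here.
  have hzero : ∀ w, opTrace ((localShape F N y ∘L localShape F N y) ∘L
      fderiv ℝ (localShape F N) y w) = 0 := by
    intro w
    rw [eq_sub_of_add_eq hq, ContinuousLinearMap.sub_comp, ContinuousLinearMap.smul_comp,
      map_sub, map_smul, h.opTrace_comp_fderiv_eq_zero hy hs, tanProj,
      ContinuousLinearMap.sub_comp, ContinuousLinearMap.sub_comp, map_sub, map_sub,
      ContinuousLinearMap.id_comp, h.opTrace_fderiv_localShape hy hH]
    have e1 : ∀ p : EuclideanSpace ℝ (Fin (n + 2)), opTrace ((innerSL ℝ p).smulRight p ∘L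
        fderiv ℝ (localShape F N) y w) = inner ℝ p (fderiv ℝ (localShape F N) y w p) := by
      intro p
      have : fderiv ℝ (localShape F N) y w ∘L (innerSL ℝ p).smulRight p
          = (innerSL ℝ p).smulRight (fderiv ℝ (localShape F N) y w p) := by
        ext1 z
        simp
      rw [opTrace_comp_comm, this, opTrace_smulRight]
      rfl
    rw [e1, e1, h.fderiv_localShape_left hy, h.fderiv_localShape_right hy, hf.left_right,
      localShape, hf.inner_right_ambShape]
    simp
  obtain ⟨L, hL, -⟩ := h.hasFDerivAt_opTrace_cube hy 0
  have : L = 0 := by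
    ext1 w
    obtain ⟨L', hL', h2⟩ := h.hasFDerivAt_opTrace_cube hy w
    rw [hL.unique hL', h2, hzero]
    simp
  rwa [this] at hL

end IsLocalHypersurface

end Relation

/-! ### The transition operator -/

section Transition

variable {U : Set (EuclideanSpace ℝ (Fin n))}
  {F N : EuclideanSpace ℝ (Fin n) → EuclideanSpace ℝ (Fin (n + 2))}
  {y : EuclideanSpace ℝ (Fin n)}

/-- For a hypersurface with shape operator `A`, the ambient operator with `F ↦ N`,
`N ↦ F + c N` and `dF v ↦ dN v`. -/
def transition (c : ℝ) (A : EuclideanSpace ℝ (Fin (n + 2)) →L[ℝ] EuclideanSpace ℝ (Fin (n + 2)))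
    (p q : EuclideanSpace ℝ (Fin (n + 2))) :
    EuclideanSpace ℝ (Fin (n + 2)) →L[ℝ] EuclideanSpace ℝ (Fin (n + 2)) :=
  (innerSL ℝ p).smulRight q + (innerSL ℝ q).smulRight p + c • (innerSL ℝ q).smulRight q - A

lemma transition_apply (c : ℝ)
    (A : EuclideanSpace ℝ (Fin (n + 2)) →L[ℝ] EuclideanSpace ℝ (Fin (n + 2)))
    (p q z : EuclideanSpace ℝ (Fin (n + 2))) :
    transition c A p q z = (inner ℝ p z : ℝ) • q + (inner ℝ q z : ℝ) • p
      + (c * inner ℝ q z : ℝ) • q - A z := by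
  simp [transition, mul_smul]

namespace IsFrame

variable {D D' : EuclideanSpace ℝ (Fin n) →L[ℝ] EuclideanSpace ℝ (Fin (n + 2))}
  {p q : EuclideanSpace ℝ (Fin (n + 2))} (c : ℝ)

lemma transition_left (h : IsFrame D D' p q) : transition c (ambShape D D') p q p = q := by
  rw [transition_apply, h.norm_left, real_inner_comm, h.orth, h.ambShape_left]
  simp

lemma transition_right (h : IsFrame D D' p q) :
    transition c (ambShape D D') p q q = p + c • q := by
  rw [transition_apply, h.norm_right, h.orth, h.ambShape_right]
  simp

lemma transition_map (h : IsFrame D D' p q) (v : EuclideanSpace ℝ (Fin n)) :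
    transition c (ambShape D D') p q (D v) = D' v := by
  rw [transition_apply, h.left_left, h.right_left, h.ambShape_map]
  simp

lemma transition_symm (h : IsFrame D D' p q) (x z : EuclideanSpace ℝ (Fin (n + 2))) :
    inner ℝ (transition c (ambShape D D') p q x) z
      = (inner ℝ x (transition c (ambShape D D') p q z) : ℝ) := by
  simp only [transition_apply, inner_sub_left, inner_sub_right, inner_add_left, inner_add_right,
    inner_smul_left, inner_smul_right, h.ambShape_symm, real_inner_comm p x, real_inner_comm q x,
    RCLike.conj_to_real]
  ring

/-- On the tangent space the transition operator is −A, and there the quadratic equation is `hc`. On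
the plane of `p`, `q` its matrix is the companion matrix (0, 1; 1, c) of the same polynomial. -/
lemma transition_sq (h : IsFrame D D' p q)
    (hc : ambShape D D' ∘L ambShape D D' + c • ambShape D D' = tanProj p q) :
    transition c (ambShape D D') p q ∘L transition c (ambShape D D') p q
      = c • transition c (ambShape D D') p q + ContinuousLinearMap.id ℝ _ := by
  ext1 z
  have h1 := DFunLike.congr_fun hc z
  simp only [add_apply, smul_apply, ContinuousLinearMap.comp_apply, tanProj, sub_apply,
    ContinuousLinearMap.id_apply, ContinuousLinearMap.smulRight_apply, innerSL_apply_apply] at h1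
  have h2 : transition c (ambShape D D') p q (ambShape D D' z)
      = -ambShape D D' (ambShape D D' z) := by
    rw [transition_apply, h.inner_left_ambShape, h.inner_right_ambShape]
    simp
  rw [ContinuousLinearMap.comp_apply, transition_apply c _ p q z, map_sub, map_add, map_add,
    map_smul, map_smul, map_smul, h.transition_left, h.transition_right, h2, eq_sub_of_add_eq h1]
  simp only [add_apply, smul_apply, ContinuousLinearMap.id_apply, transition_apply c _ p q z]
  module

end IsFrame

namespace IsLocalHypersurface

lemma contDiffOn_transition (h : IsLocalHypersurface U F N) (c : ℝ) :
    ContDiffOn ℝ ∞ (fun z => transition c (localShape F N z) (F z) (N z)) U := by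
  have h1 : ∀ {f g : EuclideanSpace ℝ (Fin n) → EuclideanSpace ℝ (Fin (n + 2))},
      ContDiffOn ℝ ∞ f U → ContDiffOn ℝ ∞ g U →
      ContDiffOn ℝ ∞ (fun z => (innerSL ℝ (f z)).smulRight (g z)) U := fun hf hg =>
    ((innerSL ℝ).contDiff.comp_contDiffOn hf).smulRight hg
  exact (((h1 h.smooth_left h.smooth_right).add (h1 h.smooth_right h.smooth_left)).add
    ((h1 h.smooth_right h.smooth_right).const_smul c)).sub h.contDiffOn_localShape

/-- If the shape operator satisfies `A² + c A = 1` with a constant `c`, then the transition operator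
is locally constant. -/
lemma hasFDerivAt_transition (h : IsLocalHypersurface U F N) {c : ℝ}
    (hc : ∀ z ∈ U, localShape F N z ∘L localShape F N z + c • localShape F N z
      = tanProj (F z) (N z)) (hy : y ∈ U) :
    HasFDerivAt (fun z => transition c (localShape F N z) (F z) (N z))
      (0 : EuclideanSpace ℝ (Fin n) →L[ℝ]
        EuclideanSpace ℝ (Fin (n + 2)) →L[ℝ] EuclideanSpace ℝ (Fin (n + 2))) y := by
  set T := fun z => transition c (localShape F N z) (F z) (N z) with hT
  have hTy : HasFDerivAt T (fderiv ℝ T y) y :=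
    hasFDerivAt_of_contDiffOn h.isOpen hy (h.contDiffOn_transition c)
  have hf := h.isFrame hy
  have hleft : ∀ v, fderiv ℝ T y v (F y) = 0 := fun v => by
    have e := DFunLike.congr_fun (fderiv_eq_of_eqOn h.isOpen hy
      (fun z hz => (h.isFrame hz).transition_left c)
      (hTy.clm_apply (h.hasFDerivAt_left hy)) (h.hasFDerivAt_right hy)) v
    have e2 : T y (fderiv ℝ F y v) = fderiv ℝ N y v := hf.transition_map c v
    simpa [e2] using e
  have hmap : ∀ v, T y (fderiv ℝ F y v) = fderiv ℝ N y v := hf.transition_map c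
  have hmap2 : ∀ v, T y (fderiv ℝ N y v) = c • fderiv ℝ N y v + fderiv ℝ F y v := fun v => by
    have e := DFunLike.congr_fun (hf.transition_sq c (hc y hy)) (fderiv ℝ F y v)
    simp only [ContinuousLinearMap.comp_apply, add_apply, smul_apply,
      ContinuousLinearMap.id_apply, hf.transition_map] at e
    exact e
  have hright : ∀ v, fderiv ℝ T y v (N y) = 0 := fun v => by
    have e := DFunLike.congr_fun (fderiv_eq_of_eqOn h.isOpen hy
      (fun z hz => (h.isFrame hz).transition_right c)
      (hTy.clm_apply (h.hasFDerivAt_right hy))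
      ((h.hasFDerivAt_left hy).add ((h.hasFDerivAt_right hy).const_smul c))) v
    simp only [add_apply, smul_apply, ContinuousLinearMap.comp_apply,
      ContinuousLinearMap.flip_apply, hmap2] at e
    rw [add_comm (fderiv ℝ F y v)] at e
    simpa using e
  -- The Codazzi equation for T, from the symmetry of the second derivatives of F and N. With the
  -- self-adjointness of T it makes the trilinear form `d` below totally symmetric.
  have hcomm : ∀ v w, fderiv ℝ T y v (fderiv ℝ F y w) = fderiv ℝ T y w (fderiv ℝ F y v) := by
    have e : ∀ v w, fderiv ℝ T y v (fderiv ℝ F y w)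
        = fderiv ℝ (fderiv ℝ N) y v w - T y (fderiv ℝ (fderiv ℝ F) y v w) := fun v w => by
      have e := DFunLike.congr_fun (fderiv_eq_of_eqOn h.isOpen hy
        (fun z hz => (h.isFrame hz).transition_map c w)
        (hTy.clm_apply ((h.hasFDerivAt_fderiv_left hy).clm_apply (hasFDerivAt_const w y)))
        ((h.hasFDerivAt_fderiv_right hy).clm_apply (hasFDerivAt_const w y))) v
      simp only [add_apply, ContinuousLinearMap.comp_apply, ContinuousLinearMap.flip_apply,
        zero_apply, map_zero, zero_add] at e
      rw [← e]
      abel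
    intro v w
    rw [e, e, h.second_symm_left hy v w, h.second_symm_right hy v w]
  have hsymm : ∀ v x z, inner ℝ (fderiv ℝ T y v x) z = (inner ℝ x (fderiv ℝ T y v z) : ℝ) := by
    intro v x z
    have e := DFunLike.congr_fun (fderiv_eq_of_eqOn h.isOpen hy
      (fun u hu => (h.isFrame hu).transition_symm c x z)
      (((hTy.clm_apply (hasFDerivAt_const x y))).inner ℝ (hasFDerivAt_const z y))
      ((hasFDerivAt_const x y).inner ℝ (hTy.clm_apply (hasFDerivAt_const z y)))) v
    simpa [fderivInnerCLM_apply] using e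
  have hsq : ∀ v x, fderiv ℝ T y v (T y x) + T y (fderiv ℝ T y v x) = c • fderiv ℝ T y v x := by
    intro v x
    have e := DFunLike.congr_fun (DFunLike.congr_fun (fderiv_eq_of_eqOn h.isOpen hy
      (fun u hu => (h.isFrame hu).transition_sq c (hc u hu))
      (hTy.clm_comp hTy) ((hTy.const_smul c).add (hasFDerivAt_const _ _))) v) x
    simp only [add_apply, ContinuousLinearMap.comp_apply, ContinuousLinearMap.compL_apply,
      ContinuousLinearMap.flip_apply, smul_apply, add_zero] at e
    exact (add_comm _ _).trans e
  set ρ : EuclideanSpace ℝ (Fin n) → EuclideanSpace ℝ (Fin n) :=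
    fun v => pinv (fderiv ℝ F y) (fderiv ℝ N y v) with hρ
  have hρ1 : ∀ v, fderiv ℝ F y (ρ v) = fderiv ℝ N y v := hf.ambShape_map_eq_map
  have hρ2 : ∀ v, fderiv ℝ F y (ρ (ρ v)) = c • fderiv ℝ F y (ρ v) + fderiv ℝ F y v := fun v => by
    rw [hρ1, ← hmap (ρ v), hρ1, hmap2]
  set d : EuclideanSpace ℝ (Fin n) → EuclideanSpace ℝ (Fin n) → EuclideanSpace ℝ (Fin n) → ℝ :=
    fun v w z => inner ℝ (fderiv ℝ T y v (fderiv ℝ F y w)) (fderiv ℝ F y z) with hd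
  have d1 : ∀ v w z, d v w z = d w v z := fun v w z => by simp only [hd, hcomm v w]
  have d2 : ∀ v w z, d v w z = d v z w := fun v w z => by
    simp only [hd]
    rw [hsymm, real_inner_comm]
  have d3 : ∀ v w z, d v (ρ w) z + d v w (ρ z) = c * d v w z := fun v w z => by
    simp only [hd]
    have hT' : ∀ x z, inner ℝ (T y x) z = (inner ℝ x (T y z) : ℝ) := hf.transition_symm c
    rw [hρ1, hρ1, ← hmap w, ← hmap z, ← hT', ← inner_add_left, hsq, inner_smul_left]
    simp
  -- Inserting ρ in one of the three slots gives three numbers. By `d3` and total symmetry any two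
  -- of them add up to c·d, so each equals (c/2)·d.
  have d4 : ∀ v w z, d v w (ρ z) = c / 2 * d v w z := fun v w z => by
    have e1 := d3 v w z
    have e2 := d3 w v z
    have e3 := d3 z v w
    rw [d1 w (ρ v) z, d1 w v (ρ z), d1 w v z] at e2
    rw [d1 z (ρ v) w, d2 (ρ v) z w, d1 z v (ρ w), d2 v z (ρ w), d1 z v w, d2 v z w] at e3
    linarith
  -- Applying this twice and using ρ² = cρ + 1 gives c²/4 · d = (c²/2 + 1) · d, impossible for d ≠
  -- 0.
  have d5 : ∀ v w z, d v w z = 0 := fun v w z => by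
    have e1 : d v w (ρ (ρ z)) = c * d v w (ρ z) + d v w z := by
      simp only [hd, hρ2, inner_add_right, inner_smul_right]
    rw [d4, d4] at e1
    have e2 : (c ^ 2 / 4 + 1) * d v w z = 0 := by linear_combination (-1) * e1
    exact (mul_eq_zero.1 e2).resolve_left (by positivity)
  have hzero : fderiv ℝ T y = 0 := by
    ext1 v
    ext1 z
    rw [hf.decomp z]
    simp only [map_add, map_smul, hleft, hright, smul_zero, add_zero, zero_apply]
    refine hf.ext_inner (fun u => ?_) ?_ ?_
    · rw [inner_zero_left]
      exact d5 _ _ _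
    · rw [hsymm, hleft]
      simp
    · rw [hsymm, hright]
      simp
  rwa [hzero] at hTy

end IsLocalHypersurface

end Transition

/-! ### Hypersurfaces whose height functions are linearly dependent -/

section Dependent

variable {M : Type*} [TopologicalSpace M] [ChartedSpace (EuclideanSpace ℝ (Fin n)) M]
  {φ ν : M → EuclideanSpace ℝ (Fin (n + 2))} {a b : EuclideanSpace ℝ (Fin (n + 2))}

/-- The sum of the cubes of the principal curvatures. -/
def traceCube (φ ν : M → EuclideanSpace ℝ (Fin (n + 2))) (x : M) : ℝ :=
  opTrace (globalShape φ ν x ∘L globalShape φ ν x ∘L globalShape φ ν x)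

/-- The covariant derivative of the shape operator in the direction of the tangential part of `b`,
if `height φ ν a b = 0`. -/
def relationOp (φ ν : M → EuclideanSpace ℝ (Fin (n + 2))) (a b : EuclideanSpace ℝ (Fin (n + 2)))
    (x : M) : EuclideanSpace ℝ (Fin (n + 2)) →L[ℝ] EuclideanSpace ℝ (Fin (n + 2)) :=
  height φ ν a 0 x • (globalShape φ ν x ∘L globalShape φ ν x - tanProj (φ x) (ν x))
    + height φ ν b a x • globalShape φ ν x

lemma gradPair_const (k : ℝ) (c d : EuclideanSpace ℝ (Fin (n + 2))) (x : M) :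
    gradPair φ ν (fun _ => k) c d x = 0 := by
  rw [gradPair, mfderiv_const]
  rfl

/-- A function whose derivative vanishes in all charts is constant. -/
lemma exists_eq_const_of_hasFDerivAt_zero [ConnectedSpace M] {Y : Type*} [NormedAddCommGroup Y]
    [NormedSpace ℝ Y] {f : M → Y} (hf : ∀ e ∈ atlas (EuclideanSpace ℝ (Fin n)) M,
      ∀ y ∈ e.target, HasFDerivAt (f ∘ e.symm) (0 : EuclideanSpace ℝ (Fin n) →L[ℝ] Y) y) :
    ∃ c, ∀ x, f x = c := by
  have hl : IsLocallyConstant f := by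
    rw [IsLocallyConstant.iff_eventually_eq]
    intro x
    set e := chartAt (EuclideanSpace ℝ (Fin n)) x with hedef
    have he : e ∈ atlas (EuclideanSpace ℝ (Fin n)) M := chart_mem_atlas _ x
    have hxs : x ∈ e.source := mem_chart_source _ x
    obtain ⟨r, hr, hball⟩ := Metric.isOpen_iff.1 e.open_target (e x) (mem_chart_target _ x)
    have h1 : ∀ z ∈ Metric.ball (e x) r, (f ∘ e.symm) z = (f ∘ e.symm) (e x) := fun z hz =>
      (convex_ball (e x) r).is_const_of_fderivWithin_eq_zero
        (fun y hy => (hf e he y (hball hy)).differentiableAt.differentiableWithinAt)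
        (fun y hy => by
          rw [fderivWithin_of_isOpen Metric.isOpen_ball hy]
          exact (hf e he y (hball hy)).fderiv) hz (Metric.mem_ball_self hr)
    filter_upwards [e.open_source.mem_nhds hxs,
      (e.continuousAt hxs).preimage_mem_nhds (Metric.ball_mem_nhds _ hr)] with z hz hz2
    have h2 := h1 (e z) hz2
    rwa [Function.comp_apply, Function.comp_apply, e.left_inv hz, e.left_inv hxs] at h2
  obtain ⟨x⟩ : Nonempty M := inferInstance
  exact ⟨f x, fun z => hl.apply_eq_of_preconnectedSpace z x⟩

variable [IsManifold (𝓡 n) ∞ M]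

/-! ### Trace identities that follow from a linear relation. -/

lemma IsOrientedHypersurface.contMDiff_traceCube (hM : IsOrientedHypersurface φ ν) :
    ContMDiff (𝓡 n) 𝓘(ℝ, ℝ) ∞ (traceCube φ ν) :=
  contMDiff_of_charts fun _ he => by
    have h1 := contDiffOn_comp_chart_symm he hM.contMDiff_globalShape
    exact opTrace.contDiff.comp_contDiffOn (h1.clm_comp (h1.clm_comp h1))

lemma coordLaplacian_zero (G : EuclideanSpace ℝ (Fin n) → Matrix (Fin n) (Fin n) ℝ)
    (y : EuclideanSpace ℝ (Fin n)) : coordLaplacian G (fun _ => 0) y = 0 := by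
  have h : ∀ j : Fin n, pderiv j (fun _ : EuclideanSpace ℝ (Fin n) => (0 : ℝ)) = fun _ => 0 := by
    intro j
    ext z
    simp [pderiv]
  simp [coordLaplacian, h]

/-- The left side is the trace of `relationOp`. It vanishes because the Laplacian of the zero
function `height φ ν a b` is zero. -/
lemma IsOrientedHypersurface.relation_opTrace (hM : IsOrientedHypersurface φ ν) {H s : ℝ}
    (hH : ∀ x, opTrace (globalShape φ ν x) = H)
    (hs : ∀ x, opTrace (globalShape φ ν x ∘L globalShape φ ν x) = s)
    (hab : height φ ν a b = 0) (x : M) :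
    height φ ν a 0 x * (s - n) + height φ ν b a x * H = 0 := by
  have hx := (chartAt (EuclideanSpace ℝ (Fin n)) x).left_inv
    (mem_chart_source (EuclideanSpace ℝ (Fin n)) x)
  have h1 := hM.coordLaplacian_height hH a b
    (chart_mem_atlas (EuclideanSpace ℝ (Fin n)) x) (mem_chart_target _ x)
  rw [hx, hs, show (fun x => inner ℝ a (φ x) + inner ℝ b (ν x)) = height φ ν a b from rfl, hab] at h1
  have h2 := h1.symm.trans (coordLaplacian_zero _ _)
  have h3 := congrFun hab x
  simp only [height, inner_sub_right, inner_smul_right, Pi.zero_apply, inner_zero_left,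
    add_zero] at h2 h3 ⊢
  linear_combination h2 + s * h3

lemma IsOrientedHypersurface.tanProj_comp_globalShape (hM : IsOrientedHypersurface φ ν) (x : M) :
    tanProj (φ x) (ν x) ∘L globalShape φ ν x = globalShape φ ν x := by
  rw [← (hM.isFrame x).proj_eq]
  exact (hM.isFrame x).proj_comp_ambShape

lemma IsOrientedHypersurface.globalShape_comp_tanProj (hM : IsOrientedHypersurface φ ν) (x : M) :
    globalShape φ ν x ∘L tanProj (φ x) (ν x) = globalShape φ ν x := by
  rw [← (hM.isFrame x).proj_eq]
  exact IsFrame.ambShape_comp_proj _ _ (hM.isFrame x).inj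

lemma IsOrientedHypersurface.opTrace_tanProj (hM : IsOrientedHypersurface φ ν) (x : M) :
    opTrace (tanProj (φ x) (ν x)) = n := by
  rw [← (hM.isFrame x).proj_eq, (hM.isFrame x).opTrace_proj]

/-- If `‖A‖²` is constant, `tr (A ∇_X A) = 0` for the tangential part `X` of `b`; and the derivative
of `tr A³` is `3 tr (A² ∇_X A)`. -/
lemma IsOrientedHypersurface.opTrace_comp_relationOp (hM : IsOrientedHypersurface φ ν) {s : ℝ}
    (hs : ∀ x, opTrace (globalShape φ ν x ∘L globalShape φ ν x) = s)
    (hab : height φ ν a b = 0) (x : M) :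
    opTrace (globalShape φ ν x ∘L relationOp φ ν a b x) = 0 ∧
      gradPair φ ν (traceCube φ ν) b 0 x
        = 3 * opTrace ((globalShape φ ν x ∘L globalShape φ ν x) ∘L relationOp φ ν a b x) := by
  set e := chartAt (EuclideanSpace ℝ (Fin n)) x with hedef
  have he : e ∈ atlas (EuclideanSpace ℝ (Fin n)) M := chart_mem_atlas _ x
  have hy : e x ∈ e.target := mem_chart_target _ x
  have hx : e.symm (e x) = x := e.left_inv (mem_chart_source _ x)
  have h := hM.chart he
  have hA : localShape (φ ∘ e.symm) (ν ∘ e.symm) (e x) = globalShape φ ν x := by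
    rw [hM.localShape_eq he hy, hx]
  have hφ : (φ ∘ e.symm) (e x) = φ x := congrArg φ hx
  have hν : (ν ∘ e.symm) (e x) = ν x := congrArg ν hx
  have hC := h.fderiv_localShape_of_relation (fun z _ => congrFun hab (e.symm z)) hy
  rw [hA, hφ, hν] at hC
  have hP : inner ℝ a (φ x) • (globalShape φ ν x ∘L globalShape φ ν x - tanProj (φ x) (ν x))
      + (inner ℝ a (ν x) + inner ℝ b (φ x) : ℝ) • globalShape φ ν x = relationOp φ ν a b x := by
    simp only [relationOp, height, inner_zero_left, add_zero]
    rw [add_comm (inner ℝ a (ν x))]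
  rw [hP] at hC
  have hA1 := hM.tanProj_comp_globalShape x
  have hA2 := hM.globalShape_comp_tanProj x
  constructor
  · rw [← IsFrame.opTrace_comp_of_sandwich hA1 hA2 hC, ← hA]
    exact h.opTrace_comp_fderiv_eq_zero hy (fun z hz => by rw [hM.localShape_eq he hz, hs]) _
  · rw [← IsFrame.opTrace_comp_of_sandwich (by rw [← ContinuousLinearMap.comp_assoc, hA1])
      (by rw [ContinuousLinearMap.comp_assoc, hA2]) hC]
    obtain ⟨L, hL, hL2⟩ := h.hasFDerivAt_opTrace_cube hy
      (pinv (fderiv ℝ (φ ∘ e.symm) (e x)) b)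
    have hL3 : HasFDerivAt (traceCube φ ν ∘ e.symm) L (e x) := by
      refine hL.congr_of_eventuallyEq ?_
      filter_upwards [e.open_target.mem_nhds hy] with z hz
      rw [hM.localShape_eq he hz]
      rfl
    have h1 := hM.gradPair_chart he hy hM.contMDiff_traceCube b 0
    rw [hx, hL3.fderiv, map_zero, sub_zero, hL2, hA] at h1
    exact h1

/-- The left side is tr(AP) for P = `relationOp`, which is half the derivative of the constant ‖A‖².
-/
lemma IsOrientedHypersurface.relation_opTrace_comp (hM : IsOrientedHypersurface φ ν) {H s : ℝ}
    (hH : ∀ x, opTrace (globalShape φ ν x) = H)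
    (hs : ∀ x, opTrace (globalShape φ ν x ∘L globalShape φ ν x) = s)
    (hab : height φ ν a b = 0) (x : M) :
    height φ ν a 0 x * (traceCube φ ν x - H) + height φ ν b a x * s = 0 := by
  have h1 := (hM.opTrace_comp_relationOp hs hab x).1
  rw [relationOp, ContinuousLinearMap.comp_add, ContinuousLinearMap.comp_smul,
    ContinuousLinearMap.comp_smul, ContinuousLinearMap.comp_sub, hM.globalShape_comp_tanProj,
    map_add, map_smul, map_smul, map_sub, hs, hH] at h1
  exact h1

/-- Expand only one factor of P² by its definition. As tr P = tr AP = 0, what remains is α tr(A²P),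
a third of α times the derivative of tr A³. -/
lemma IsOrientedHypersurface.opTrace_relationOp_sq (hM : IsOrientedHypersurface φ ν) {H s : ℝ}
    (hH : ∀ x, opTrace (globalShape φ ν x) = H)
    (hs : ∀ x, opTrace (globalShape φ ν x ∘L globalShape φ ν x) = s)
    (hab : height φ ν a b = 0) (x : M) :
    3 * opTrace (relationOp φ ν a b x ∘L relationOp φ ν a b x)
      = height φ ν a 0 x * gradPair φ ν (traceCube φ ν) b 0 x := by
  obtain ⟨h1, h2⟩ := hM.opTrace_comp_relationOp hs hab x
  have h3 : opTrace (relationOp φ ν a b x) = 0 := by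
    rw [relationOp, map_add, map_smul, map_smul, map_sub, hs, hH, hM.opTrace_tanProj]
    exact hM.relation_opTrace hH hs hab x
  have hp : tanProj (φ x) (ν x) ∘L tanProj (φ x) (ν x) = tanProj (φ x) (ν x) := by
    rw [← (hM.isFrame x).proj_eq]
    ext1 z
    simp [pinv_apply_map (hM.isFrame x).inj]
  have h4 : tanProj (φ x) (ν x) ∘L relationOp φ ν a b x = relationOp φ ν a b x := by
    rw [relationOp, ContinuousLinearMap.comp_add, ContinuousLinearMap.comp_smul,
      ContinuousLinearMap.comp_smul, ContinuousLinearMap.comp_sub,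
      ← ContinuousLinearMap.comp_assoc, hM.tanProj_comp_globalShape, hp]
  set P := relationOp φ ν a b x with hP
  have h5 : P ∘L P = height φ ν a 0 x • ((globalShape φ ν x ∘L globalShape φ ν x) ∘L P - P)
      + height φ ν b a x • (globalShape φ ν x ∘L P) := by
    nth_rewrite 1 [hP]
    rw [relationOp, ContinuousLinearMap.add_comp, ContinuousLinearMap.smul_comp,
      ContinuousLinearMap.smul_comp, ContinuousLinearMap.sub_comp, h4]
  rw [h5, map_add, map_smul, map_smul, map_sub, h1, h3, h2]
  simp only [smul_eq_mul]
  ring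

lemma IsOrientedHypersurface.globalShape_symm (hM : IsOrientedHypersurface φ ν) (x : M)
    (z w : EuclideanSpace ℝ (Fin (n + 2))) :
    inner ℝ (globalShape φ ν x z) w = (inner ℝ z (globalShape φ ν x w) : ℝ) :=
  (hM.isFrame x).ambShape_symm z w

lemma IsOrientedHypersurface.relationOp_eq_zero (hM : IsOrientedHypersurface φ ν) {H s : ℝ}
    (hH : ∀ x, opTrace (globalShape φ ν x) = H)
    (hs : ∀ x, opTrace (globalShape φ ν x ∘L globalShape φ ν x) = s)
    (hab : height φ ν a b = 0) {x : M}
    (hx : height φ ν a 0 x * gradPair φ ν (traceCube φ ν) b 0 x = 0) :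
    relationOp φ ν a b x = 0 := by
  have h1 := hM.opTrace_relationOp_sq hH hs hab x
  refine eq_zero_of_opTrace_comp_self (fun z w => ?_) (by linarith)
  have hp : inner ℝ (tanProj (φ x) (ν x) z) w = (inner ℝ z (tanProj (φ x) (ν x) w) : ℝ) := by
    rw [← (hM.isFrame x).proj_eq]
    exact (hM.isFrame x).proj_symm z w
  simp only [relationOp, add_apply, smul_apply, sub_apply, ContinuousLinearMap.comp_apply,
    inner_add_left, inner_add_right, inner_sub_left, inner_sub_right, inner_smul_left,
    inner_smul_right, hM.globalShape_symm, hp, RCLike.conj_to_real]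

/-- If the mean curvature is not zero, then `tr A³` is constant where `⟨a, φ⟩ ≠ 0`. -/
lemma IsOrientedHypersurface.height_mul_gradPair_traceCube_of_ne (hM : IsOrientedHypersurface φ ν)
    {H s : ℝ} (hH : ∀ x, opTrace (globalShape φ ν x) = H)
    (hs : ∀ x, opTrace (globalShape φ ν x ∘L globalShape φ ν x) = s)
    (hab : height φ ν a b = 0) (h0 : H ≠ 0) (c d : EuclideanSpace ℝ (Fin (n + 2))) (x : M) :
    height φ ν a 0 x * gradPair φ ν (traceCube φ ν) c d x = 0 := by
  -- Eliminating β from the two trace relations, which needs H ≠ 0, gives α tr A³ = kα. The product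
  -- rule then finishes at points with α ≠ 0.
  set k := H - s * (n - s) / H with hk
  have h1 : ∀ x, height φ ν a 0 x * traceCube φ ν x = k * height φ ν a 0 x := fun x => by
    have e1 := hM.relation_opTrace hH hs hab x
    have e2 := hM.relation_opTrace_comp hH hs hab x
    rw [hk]
    field_simp
    linear_combination H * e2 - s * e1
  have h2 := hM.gradPair_mul (hM.contMDiff_height a 0) hM.contMDiff_traceCube c d x
  have h3 := hM.gradPair_mul (contMDiff_const (c := k)) (hM.contMDiff_height a 0) c d x
  rw [funext h1, h3, gradPair_const] at h2
  rcases eq_or_ne (height φ ν a 0 x) 0 with h4 | h4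
  · rw [h4, zero_mul]
  · have h5 : traceCube φ ν x = k := mul_left_cancel₀ h4 ((h1 x).trans (mul_comm _ _))
    rw [h5] at h2
    linarith

/-- If the mean curvature is zero, the same follows by integration. -/
lemma IsOrientedHypersurface.height_mul_gradPair_traceCube_of_eq [CompactSpace M] [T2Space M]
    [MeasurableSpace M] [BorelSpace M] (hM : IsOrientedHypersurface φ ν)
    {s : ℝ} (hH : ∀ x, opTrace (globalShape φ ν x) = 0)
    (hs : ∀ x, opTrace (globalShape φ ν x ∘L globalShape φ ν x) = s)
    (hab : height φ ν a b = 0) (hn : n ≠ 0) (c d : EuclideanSpace ℝ (Fin (n + 2))) (x : M) :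
    height φ ν a 0 x * gradPair φ ν (traceCube φ ν) c d x = 0 := by
  -- With H = 0 the first trace relation is α(s − n) = 0, so only s = n leaves anything to prove.
  by_cases hsn : s = n
  swap
  · have h1 := hM.relation_opTrace hH hs hab x
    rw [mul_zero, add_zero] at h1
    rw [(mul_eq_zero.1 h1).resolve_right (sub_ne_zero.2 hsn), zero_mul]
  have := hM.isLocallyFiniteMeasure
  set α := height φ ν a 0 with hα
  set β := height φ ν b a with hβ
  set t := traceCube φ ν with ht
  have sα : ContMDiff (𝓡 n) 𝓘(ℝ, ℝ) ∞ α := hM.contMDiff_height a 0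
  have sβ : ContMDiff (𝓡 n) 𝓘(ℝ, ℝ) ∞ β := hM.contMDiff_height b a
  have st : ContMDiff (𝓡 n) 𝓘(ℝ, ℝ) ∞ t := hM.contMDiff_traceCube
  set X : EuclideanSpace ℝ (Fin (n + 2)) → EuclideanSpace ℝ (Fin (n + 2)) → M →
    EuclideanSpace ℝ (Fin (n + 2)) :=
      fun c d x => dmap φ x (pinv (dmap φ x) (heightGrad φ ν c d x)) with hX
  have hrel : ∀ x, α x * t x = -n * β x := fun x => by
    have := hM.relation_opTrace_comp hH hs hab x
    rw [hsn] at this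
    linear_combination this
  have hgrad : ∀ c d x, α x * gradPair φ ν t c d x
      = -(t x * inner ℝ (X a 0 x) (X c d x) + n * inner ℝ (X b a x) (X c d x)) := by
    intro c d x
    have e1 := hM.gradPair_mul sα st c d x
    have e2 := hM.gradPair_mul (contMDiff_const (c := (-n : ℝ))) sβ c d x
    rw [funext hrel, e2, gradPair_const, hM.gradPair_height, hM.gradPair_height] at e1
    linear_combination -e1
  -- From αt = −nβ with t = tr A³: the quantity n⟨∇t, β∇α − α∇β⟩ is the square |n∇β + t∇α|², while
  -- α∇t = −(t∇α + n∇β). So it suffices that the integral of the square is zero.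
  have hpt : ∀ x, n * (β x * gradPair φ ν t a 0 x - α x * gradPair φ ν t b a x)
      = inner ℝ ((n : ℝ) • X b a x + t x • X a 0 x) ((n : ℝ) • X b a x + t x • X a 0 x) := by
    intro x
    have e1 := hgrad b a x
    have e2 := hgrad a 0 x
    have e3 := hrel x
    simp only [inner_add_left, inner_add_right, inner_smul_left, inner_smul_right,
      RCLike.conj_to_real]
    rw [real_inner_comm (X a 0 x) (X b a x)] at *
    linear_combination (-n : ℝ) * e1 - t x * e2 + gradPair φ ν t a 0 x * e3
  have hcont : Continuous fun x => β x * gradPair φ ν t a 0 x - α x * gradPair φ ν t b a x :=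
    (sβ.continuous.mul (hM.contMDiff_gradPair st a 0).continuous).sub
      (sα.continuous.mul (hM.contMDiff_gradPair st b a).continuous)
  -- With H = 0 and s = n both α and β satisfy Δu = −nu, so the integrand is the divergence of t(β∇α
  -- − α∇β).
  have hint : ∫ x, (β x * gradPair φ ν t a 0 x - α x * gradPair φ ν t b a x)
      ∂(riemannianVolume φ) = 0 := by
    have g1 := hM.integral_green hH a 0 (st.mul sβ)
    have g2 := hM.integral_green hH b a (st.mul sα)
    have hi : ∀ c d, ∀ u : M → ℝ, ContMDiff (𝓡 n) 𝓘(ℝ, ℝ) ∞ u → Integrable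
        (fun x => u x * heightLaplacian φ ν 0 c d x + gradPair φ ν u c d x)
        (riemannianVolume φ) := fun c d u hu =>
      ((hu.continuous.mul (hM.continuous_heightLaplacian 0 c d)).add
        (hM.contMDiff_gradPair hu c d).continuous).integrable_of_hasCompactSupport
          (HasCompactSupport.of_compactSpace _)
    have g3 := integral_sub (hi a 0 _ (st.mul sβ)) (hi b a _ (st.mul sα))
    rw [g1, g2, sub_zero] at g3
    rw [← g3]
    refine integral_congr_ae (Filter.Eventually.of_forall fun x => ?_)
    have e1 := hM.gradPair_mul st sβ a 0 x
    have e2 := hM.gradPair_mul st sα b a x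
    have e3 : gradPair φ ν β a 0 x = gradPair φ ν α b a x := by
      rw [hM.gradPair_height, hM.gradPair_height, real_inner_comm]
    have e4 : heightLaplacian φ ν 0 a 0 x = -n * α x := by
      simp [heightLaplacian, hα, height, inner_smul_right]
    have e5 : heightLaplacian φ ν 0 b a x = -n * β x := by
      simp only [heightLaplacian, hβ, height, hs, hsn, inner_sub_right, inner_smul_right]
      ring
    have e6 : gradPair φ ν (t * β) a 0 x = _ := e1
    have e7 : gradPair φ ν (t * α) b a x = _ := e2
    simp only [Pi.mul_apply, e4, e5, e6, e7, e3]
    ring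
  have hn' : (0 : ℝ) < n := by exact_mod_cast Nat.pos_of_ne_zero hn
  have hz := hM.eq_zero_of_integral_eq_zero hcont (fun x => by
    have := hpt x
    refine nonneg_of_mul_nonneg_right ?_ hn'
    rw [this]
    exact real_inner_self_nonneg) hint x
  have hw := hpt x
  rw [show β x * gradPair φ ν t a 0 x - α x * gradPair φ ν t b a x = 0 from hz, mul_zero,
    eq_comm, inner_self_eq_zero] at hw
  rw [hgrad]
  have := congrArg (fun z => (inner ℝ z (X c d x) : ℝ)) hw
  simp only [inner_add_left, inner_smul_left, RCLike.conj_to_real, inner_zero_left] at this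
  linarith

/-- If the height functions are linearly dependent, then the shape operator satisfies a quadratic
equation. -/
lemma IsOrientedHypersurface.quadratic_of_height_eq_zero [CompactSpace M] [T2Space M]
    [MeasurableSpace M] [BorelSpace M] (hM : IsOrientedHypersurface φ ν)
    {H s : ℝ} (hH : ∀ x, opTrace (globalShape φ ν x) = H)
    (hs : ∀ x, opTrace (globalShape φ ν x ∘L globalShape φ ν x) = s) (hs0 : s ≠ 0) (hn : n ≠ 0)
    (hab : height φ ν a b = 0) (hne : ¬ (a = 0 ∧ b = 0)) (x : M) :
    globalShape φ ν x ∘L globalShape φ ν x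
      + ((H - traceCube φ ν x) / s) • globalShape φ ν x = tanProj (φ x) (ν x) := by
  set g : M → EuclideanSpace ℝ (Fin (n + 2)) →L[ℝ] EuclideanSpace ℝ (Fin (n + 2)) := fun x =>
    globalShape φ ν x ∘L globalShape φ ν x
      + ((H - traceCube φ ν x) / s) • globalShape φ ν x - tanProj (φ x) (ν x) with hg
  suffices g x = 0 from sub_eq_zero.1 this
  have hder : ∀ x, height φ ν a 0 x * gradPair φ ν (traceCube φ ν) b 0 x = 0 := by
    rcases eq_or_ne H 0 with rfl | h0
    · exact hM.height_mul_gradPair_traceCube_of_eq hH hs hab hn b 0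
    · exact hM.height_mul_gradPair_traceCube_of_ne hH hs hab h0 b 0
  have hzero : ∀ x, g x ≠ 0 → height φ ν a 0 x = 0 := fun x hx => by
    by_contra hα
    apply hx
    have h1 := hM.relationOp_eq_zero hH hs hab (hder x)
    have h2 := hM.relation_opTrace_comp hH hs hab x
    -- The second trace relation gives β = cα with c = (H − tr A³)/s, so `relationOp` equals α·g,
    -- which identifies the coefficient of the quadratic equation.
    have h3 : height φ ν b a x = height φ ν a 0 x * ((H - traceCube φ ν x) / s) := by
      field_simp
      linear_combination h2
    have h4 : height φ ν a 0 x • g x = 0 := by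
      rw [← h1, relationOp, h3, hg]
      module
    exact (smul_eq_zero.1 h4).resolve_left hα
  by_contra hx
  have hA := hM.contMDiff_globalShape.continuous
  have hφ := hM.contMDiff_immersion.continuous
  have hν := hM.contMDiff_gauss.continuous
  have ht := hM.contMDiff_traceCube.continuous
  have hsm : ∀ f : M → EuclideanSpace ℝ (Fin (n + 2)), Continuous f →
      Continuous fun x => (innerSL ℝ (f x)).smulRight (f x) := fun f hf =>
    isBoundedBilinearMap_smulRight.continuous.comp (((innerSL ℝ).continuous.comp hf).prodMk hf)
  have hgc : Continuous g := ((hA.clm_comp hA).add (((continuous_const.sub ht).div_const s).smul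
    hA)).sub ((continuous_const.sub (hsm φ hφ)).sub (hsm ν hν))
  have hO : IsOpen {x | g x ≠ 0} := isOpen_ne_fun hgc continuous_const
  set e := chartAt (EuclideanSpace ℝ (Fin n)) x with hedef
  have he : e ∈ atlas (EuclideanSpace ℝ (Fin n)) M := chart_mem_atlas _ x
  have hex : e.symm (e x) = x := e.left_inv (mem_chart_source _ x)
  have hW := e.symm.isOpen_inter_preimage hO
  have h := (hM.chart he).mono hW Set.inter_subset_left
  have hy : e x ∈ e.symm.source ∩ e.symm ⁻¹' {x | g x ≠ 0} :=
    ⟨mem_chart_target _ x, by rwa [Set.mem_preimage, hex]⟩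
  have hα : ∀ z ∈ e.symm.source ∩ e.symm ⁻¹' {x | g x ≠ 0},
      inner ℝ a (φ (e.symm z)) = (0 : ℝ) := fun z hz => by
    simpa [height] using hzero _ hz.2
  -- On the open set where g ≠ 0, α vanishes; hence so does ⟨b,ν⟩ by the relation, and β because s ≠
  -- 0. Such a relation is trivial.
  refine hne (h.eq_zero_of_relation hy hα (fun z hz => ?_) (fun z hz => ?_) ?_)
  · have := congrFun hab (e.symm z)
    rwa [height, hα z hz, zero_add] at this
  · have h2 := hM.relation_opTrace_comp hH hs hab (e.symm z)
    rw [hzero _ hz.2, zero_mul, zero_add] at h2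
    have h3 := (mul_eq_zero.1 h2).resolve_right hs0
    rw [height] at h3
    rw [← h3, add_comm]
    rfl
  · rw [hM.localShape_eq he hy.1, hs]
    exact hs0

/-- If the height functions are linearly dependent, then the transition operator is constant. -/
lemma IsOrientedHypersurface.exists_transition_eq [CompactSpace M] [T2Space M] [ConnectedSpace M]
    [MeasurableSpace M] [BorelSpace M] (hM : IsOrientedHypersurface φ ν)
    {H s : ℝ} (hH : ∀ x, opTrace (globalShape φ ν x) = H)
    (hs : ∀ x, opTrace (globalShape φ ν x ∘L globalShape φ ν x) = s) (hs0 : s ≠ 0) (hn : n ≠ 0)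
    (hab : height φ ν a b = 0) (hne : ¬ (a = 0 ∧ b = 0)) :
    ∃ (c : ℝ) (T : EuclideanSpace ℝ (Fin (n + 2)) →L[ℝ] EuclideanSpace ℝ (Fin (n + 2))),
      (∀ x, globalShape φ ν x ∘L globalShape φ ν x + c • globalShape φ ν x
        = tanProj (φ x) (ν x)) ∧
      ∀ x, transition c (globalShape φ ν x) (φ x) (ν x) = T := by
  have hq := hM.quadratic_of_height_eq_zero hH hs hs0 hn hab hne
  -- Constancy of tr A³ must come before that of T, whose proof requires a constant c.
  obtain ⟨t, ht⟩ := exists_eq_const_of_hasFDerivAt_zero (n := n) (f := traceCube φ ν)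
    fun e he y hy => by
      have h1 := (hM.chart he).fderiv_opTrace_cube_eq_zero hy (H := H) (s := s)
        (c := (H - traceCube φ ν (e.symm y)) / s)
        (fun z hz => by rw [hM.localShape_eq he hz, hH])
        (fun z hz => by rw [hM.localShape_eq he hz, hs])
        (by rw [hM.localShape_eq he hy]; exact hq _)
      refine h1.congr_of_eventuallyEq ?_
      filter_upwards [e.open_target.mem_nhds hy] with z hz
      rw [hM.localShape_eq he hz]
      rfl
  simp only [ht] at hq
  obtain ⟨T, hT⟩ := exists_eq_const_of_hasFDerivAt_zero (n := n)
    (f := fun x => transition ((H - t) / s) (globalShape φ ν x) (φ x) (ν x))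
    fun e he y hy => by
      refine ((hM.chart he).hasFDerivAt_transition (c := (H - t) / s) (fun z hz => by
        rw [hM.localShape_eq he hz]; exact hq _) hy).congr_of_eventuallyEq ?_
      filter_upwards [e.open_target.mem_nhds hy] with z hz
      rw [hM.localShape_eq he hz]
      rfl
  exact ⟨_, T, hq, hT⟩

end Dependent

/-! ### Clifford hypersurfaces -/

section Clifford

lemma mem_sphere_zero_iff_sum_sq {ι : Type*} [Fintype ι] {r : ℝ} (hr : 0 ≤ r)
    (u : EuclideanSpace ℝ ι) : u ∈ Metric.sphere 0 r ↔ ∑ i, u i ^ 2 = r ^ 2 := by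
  rw [mem_sphere_zero_iff_norm, ← EuclideanSpace.real_norm_sq_eq, sq_eq_sq₀ (norm_nonneg _) hr]

/-- The set is a continuous image of a product of spheres in spaces of k + 1 and n − k + 1
coordinates. Both numbers are at least 2 for 1 ≤ k < n, so both spheres are connected. -/
lemma isPreconnected_cliffordModel {k : ℕ} {r : ℝ} (hk : 1 ≤ k) (hkn : k < n) (hr : 0 ≤ r)
    (hr1 : r ≤ 1) : IsPreconnected (cliffordModel n k r) := by
  set f : EuclideanSpace ℝ {i : Fin (n + 2) // i.val < k + 1} ×
      EuclideanSpace ℝ {i : Fin (n + 2) // ¬ i.val < k + 1} → EuclideanSpace ℝ (Fin (n + 2)) :=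
    fun u => WithLp.toLp 2 fun i => if h : i.val < k + 1 then u.1 ⟨i, h⟩ else u.2 ⟨i, h⟩ with hf
  have hfc : Continuous f := by
    refine (PiLp.continuous_toLp 2 _).comp (continuous_pi fun i => ?_)
    by_cases h : i.val < k + 1
    · simp only [h, dif_pos]
      fun_prop
    · simp only [h, dif_neg, not_false_eq_true]
      fun_prop
  have hr2 : 0 ≤ 1 - r ^ 2 := by nlinarith
  have hsum1 : ∀ z : Fin (n + 2) → ℝ, ∑ i with i.val < k + 1, z i ^ 2
      = ∑ i : {i : Fin (n + 2) // i.val < k + 1}, z i ^ 2 := fun z =>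
    Finset.sum_subtype _ (by simp) _
  have hsum2 : ∀ z : Fin (n + 2) → ℝ, ∑ i with ¬ i.val < k + 1, z i ^ 2
      = ∑ i : {i : Fin (n + 2) // ¬ i.val < k + 1}, z i ^ 2 := fun z =>
    Finset.sum_subtype _ (by simp) _
  have himage : cliffordModel n k r
      = f '' (Metric.sphere 0 r ×ˢ Metric.sphere 0 (Real.sqrt (1 - r ^ 2))) := by
    ext z
    constructor
    · rintro ⟨h1, h2⟩
      refine ⟨(WithLp.toLp 2 fun i => z i, WithLp.toLp 2 fun i => z i), ⟨?_, ?_⟩, ?_⟩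
      · rw [mem_sphere_zero_iff_sum_sq hr, ← h1, hsum1]
      · rw [mem_sphere_zero_iff_sum_sq (Real.sqrt_nonneg _), Real.sq_sqrt hr2, ← h2, hsum2]
      · ext i
        simp [hf]
    · rintro ⟨⟨u, w⟩, ⟨h1, h2⟩, rfl⟩
      rw [mem_sphere_zero_iff_sum_sq hr] at h1
      rw [mem_sphere_zero_iff_sum_sq (Real.sqrt_nonneg _), Real.sq_sqrt hr2] at h2
      refine ⟨?_, ?_⟩
      · rw [hsum1, ← h1]
        exact Finset.sum_congr rfl fun i _ => by simp only [hf, dif_pos i.2]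
      · rw [hsum2, ← h2]
        exact Finset.sum_congr rfl fun i _ => by simp only [hf, dif_neg i.2]
  rw [himage]
  refine (IsPreconnected.prod (isPreconnected_sphere ?_ _ _) (isPreconnected_sphere ?_ _ _)).image
    f hfc.continuousOn
  · rw [← Module.finrank_eq_rank, finrank_euclideanSpace, Nat.one_lt_cast,
      Fintype.one_lt_card_iff]
    exact ⟨⟨⟨0, by omega⟩, by simp⟩, ⟨⟨1, by omega⟩, by simp; omega⟩, by simp⟩
  · rw [← Module.finrank_eq_rank, finrank_euclideanSpace, Nat.one_lt_cast,
      Fintype.one_lt_card_iff]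
    exact ⟨⟨⟨n, by omega⟩, by simpa using hkn⟩, ⟨⟨n + 1, by omega⟩, by simp; omega⟩, by simp⟩

/-- A symmetric operator with two eigenvalues `q < p` is diagonal in an orthonormal basis whose
first vectors belong to `p`. -/
lemma exists_orthonormalBasis_of_quadratic {N : ℕ}
    {T : EuclideanSpace ℝ (Fin N) →L[ℝ] EuclideanSpace ℝ (Fin N)}
    (hT : ∀ x z, inner ℝ (T x) z = (inner ℝ x (T z) : ℝ)) {p q : ℝ} (hqp : q < p)
    (hpq : ∀ z, T (T z) = (p + q) • T z - (p * q) • z) :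
    ∃ (m : ℕ) (b : OrthonormalBasis (Fin N) ℝ (EuclideanSpace ℝ (Fin N))), m ≤ N ∧
      ∀ z i, b.repr (T z) i = (if i.val < m then p else q) * b.repr z i := by
  have hs : T.toLinearMap.IsSymmetric := hT
  have hN : Module.finrank ℝ (EuclideanSpace ℝ (Fin N)) = N := by simp
  have hval : ∀ i, hs.eigenvalues hN i = p ∨ hs.eigenvalues hN i = q := fun i => by
    have h1 : T (hs.eigenvectorBasis hN i) = hs.eigenvalues hN i • hs.eigenvectorBasis hN i :=
      hs.apply_eigenvectorBasis hN i
    have h2 := hpq (hs.eigenvectorBasis hN i)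
    rw [h1, map_smul, h1, smul_smul, smul_smul, ← sub_smul, ← sub_eq_zero, ← sub_smul] at h2
    have h3 := (smul_eq_zero.1 h2).resolve_right ((hs.eigenvectorBasis hN).orthonormal.ne_zero i)
    have h4 : (hs.eigenvalues hN i - p) * (hs.eigenvalues hN i - q) = 0 := by
      linear_combination h3
    rcases mul_eq_zero.1 h4 with h | h
    · exact Or.inl (sub_eq_zero.1 h)
    · exact Or.inr (sub_eq_zero.1 h)
  -- The eigenvalues come in decreasing order, so those equal to p > q form an initial segment; `m`
  -- is the first index that carries q.
  have hm : ∃ m ≤ N, ∀ i : Fin N, hs.eigenvalues hN i = if i.val < m then p else q := by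
    by_cases hall : ∀ i, hs.eigenvalues hN i = p
    · exact ⟨N, le_rfl, fun i => by rw [hall, if_pos i.2]⟩
    · push Not at hall
      obtain ⟨i₀, h0, hmin⟩ := WellFounded.has_min (wellFounded_lt (α := Fin N))
        {i | hs.eigenvalues hN i ≠ p} hall
      refine ⟨i₀, i₀.2.le, fun i => ?_⟩
      split_ifs with hi
      · by_contra hne
        exact hmin i hne hi
      · refine (hval i).resolve_left fun h => ?_
        have h1 := hs.eigenvalues_antitone hN (not_lt.1 hi : i₀ ≤ i)
        rw [h, (hval i₀).resolve_left h0] at h1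
        linarith
  obtain ⟨m, hmN, hm⟩ := hm
  refine ⟨m, hs.eigenvectorBasis hN, hmN, fun z i => ?_⟩
  rw [← hm]
  exact hs.eigenvectorBasis_apply_self_apply hN z i

variable {M : Type*} [TopologicalSpace M] [ChartedSpace (EuclideanSpace ℝ (Fin n)) M]
  {φ ν : M → EuclideanSpace ℝ (Fin (n + 2))} [IsManifold (𝓡 n) ∞ M]

/-- The vectors (T − μ)φ = ν − μφ and (T − μ)dφ v = dν v − μ dφ v lie on the line of `u`. The first
is nonzero and they are orthogonal, so the second is zero. This excludes simple eigenvalues of T. -/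
lemma IsOrientedHypersurface.isTotallyUmbilical_of_rank_one (hM : IsOrientedHypersurface φ ν)
    {T : EuclideanSpace ℝ (Fin (n + 2)) →L[ℝ] EuclideanSpace ℝ (Fin (n + 2))}
    (hT : ∀ x, T (φ x) = ν x) (hT' : ∀ x v, T (dmap φ x v) = dmap ν x v) {μ : ℝ}
    {u : EuclideanSpace ℝ (Fin (n + 2))} (hu : ∀ z, ∃ t : ℝ, T z - μ • z = t • u) :
    IsTotallyUmbilical φ ν := by
  intro x
  have h := hM.isFrame x
  have key : ∀ v, dmap ν x v = μ • dmap φ x v := fun v => by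
    obtain ⟨t, ht⟩ := hu (φ x)
    obtain ⟨t', ht'⟩ := hu (dmap φ x v)
    rw [hT] at ht
    rw [hT'] at ht'
    have h1 : inner ℝ (t • u) (t' • u) = (0 : ℝ) := by
      rw [← ht, ← ht', inner_sub_left, inner_sub_right, inner_sub_right, inner_smul_left,
        inner_smul_left, inner_smul_right, inner_smul_right, h.left_left, h.left_right,
        h.right_left, h.right_right]
      simp
    have h2 : t • u ≠ 0 := fun h0 => by
      have h3 := congrArg (fun z => (inner ℝ (ν x) z : ℝ)) (ht.trans h0)
      simp only [inner_sub_right, inner_smul_right, h.norm_right, inner_zero_right] at h3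
      rw [real_inner_comm, h.orth] at h3
      norm_num at h3
    rw [smul_ne_zero_iff] at h2
    rw [inner_smul_left, inner_smul_right, RCLike.conj_to_real, mul_eq_zero, mul_eq_zero,
      inner_self_eq_zero] at h1
    have h3 : t' = 0 := (h1.resolve_left h2.1).resolve_right h2.2
    rwa [h3, zero_smul, sub_eq_zero] at ht'
  refine ⟨-μ, ?_⟩
  have h5 : shapeOperator φ ν x = _ := h.leftInverse_comp
  rw [h5]
  refine LinearMap.ext fun v => ?_
  have h6 : pinv (dmap φ x) (dmap ν x v) = μ • v := by
    rw [key, map_smul, pinv_apply_map h.inj]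
  exact (congrArg Neg.neg h6).trans (neg_smul μ v).symm

/-- The values of `φ` near `φ x` exhaust the quadric `⟨T z, z⟩ = 0` of the sphere, if `T` is the
transition operator. -/
lemma IsOrientedHypersurface.eventually_mem_range (hM : IsOrientedHypersurface φ ν) {c : ℝ}
    {T : EuclideanSpace ℝ (Fin (n + 2)) →L[ℝ] EuclideanSpace ℝ (Fin (n + 2))}
    (hT : ∀ x, T (φ x) = ν x) (hT' : ∀ x, T (ν x) = φ x + c • ν x) (x : M) :
    ∀ᶠ z in nhds (φ x), inner ℝ z z = (1 : ℝ) → inner ℝ (T z) z = (0 : ℝ) → z ∈ Set.range φ := by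
  set e := chartAt (EuclideanSpace ℝ (Fin n)) x with hedef
  have he : e ∈ atlas (EuclideanSpace ℝ (Fin n)) M := chart_mem_atlas _ x
  have hy : e x ∈ e.target := mem_chart_target _ x
  have hex : e.symm (e x) = x := e.left_inv (mem_chart_source _ x)
  have h := hM.chart he
  have hf := h.isFrame hy
  set F := φ ∘ e.symm with hF
  have hstrict : HasStrictFDerivAt F (fderiv ℝ F (e x)) (e x) :=
    (h.smooth_left.contDiffAt (e.open_target.mem_nhds hy)).hasStrictFDerivAt (by simp)
  -- At (e x, 1, 0) the derivative of Ψ is onto, as dF, F and N = TF span. So every point near φ x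
  -- has the form sφ + tν with (s,t) near (1,0).
  set Ψ : EuclideanSpace ℝ (Fin n) × ℝ × ℝ → EuclideanSpace ℝ (Fin (n + 2)) :=
    fun w => w.2.1 • F w.1 + w.2.2 • T (F w.1) with hΨ
  have hFs : HasStrictFDerivAt (fun w : EuclideanSpace ℝ (Fin n) × ℝ × ℝ => F w.1)
      (fderiv ℝ F (e x) ∘L ContinuousLinearMap.fst ℝ _ _) (e x, 1, 0) :=
    HasStrictFDerivAt.comp (f := fun w : EuclideanSpace ℝ (Fin n) × ℝ × ℝ => w.1)
      (e x, (1 : ℝ), (0 : ℝ)) hstrict hasStrictFDerivAt_fst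
  have hs1 : HasStrictFDerivAt (fun w : EuclideanSpace ℝ (Fin n) × ℝ × ℝ => w.2.1)
      (ContinuousLinearMap.fst ℝ ℝ ℝ ∘L ContinuousLinearMap.snd ℝ _ _) (e x, 1, 0) :=
    (ContinuousLinearMap.fst ℝ ℝ ℝ ∘L
      ContinuousLinearMap.snd ℝ (EuclideanSpace ℝ (Fin n)) (ℝ × ℝ)).hasStrictFDerivAt
  have hs2 : HasStrictFDerivAt (fun w : EuclideanSpace ℝ (Fin n) × ℝ × ℝ => w.2.2)
      (ContinuousLinearMap.snd ℝ ℝ ℝ ∘L ContinuousLinearMap.snd ℝ _ _) (e x, 1, 0) :=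
    (ContinuousLinearMap.snd ℝ ℝ ℝ ∘L
      ContinuousLinearMap.snd ℝ (EuclideanSpace ℝ (Fin n)) (ℝ × ℝ)).hasStrictFDerivAt
  have hTF : HasStrictFDerivAt (fun w : EuclideanSpace ℝ (Fin n) × ℝ × ℝ => T (F w.1))
      (T ∘L fderiv ℝ F (e x) ∘L ContinuousLinearMap.fst ℝ _ _) (e x, 1, 0) :=
    T.hasStrictFDerivAt.comp (e x, (1 : ℝ), (0 : ℝ)) hFs
  have hΨs : HasStrictFDerivAt Ψ _ (e x, 1, 0) := (hs1.smul hFs).add (hs2.smul hTF)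
  have hTx : T (F (e x)) = (ν ∘ e.symm) (e x) := hT _
  have hmap := hΨs.map_nhds_eq_of_surj (by
    rw [LinearMap.range_eq_top]
    intro z
    refine ⟨(pinv (fderiv ℝ F (e x)) z, inner ℝ (F (e x)) z,
      inner ℝ ((ν ∘ e.symm) (e x)) z), ?_⟩
    conv_rhs => rw [hf.decomp z]
    simp [hTx, add_assoc])
  have hΨx : Ψ (e x, 1, 0) = φ x := by
    simp [hΨ, hF, hex]
  rw [hΨx] at hmap
  rw [← hmap, Filter.eventually_map]
  have hc : Continuous fun w : EuclideanSpace ℝ (Fin n) × ℝ × ℝ => 2 * w.2.1 + c * w.2.2 := by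
    fun_prop
  have e1 : ∀ᶠ w in nhds ((e x, 1, 0) : EuclideanSpace ℝ (Fin n) × ℝ × ℝ), 0 < w.2.1 :=
    (isOpen_lt continuous_const (by fun_prop)).mem_nhds (by simp)
  have e2 : ∀ᶠ w in nhds ((e x, 1, 0) : EuclideanSpace ℝ (Fin n) × ℝ × ℝ),
      0 < 2 * w.2.1 + c * w.2.2 :=
    (isOpen_lt continuous_const hc).mem_nhds (by simp)
  filter_upwards [e1, e2] with w h1 h2 hz1 hz2
  obtain ⟨y, s, t⟩ := w
  have hfr := hM.isFrame (e.symm y)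
  have hpq := hfr.orth
  have hqp : inner ℝ (ν (e.symm y)) (φ (e.symm y)) = (0 : ℝ) := by rw [real_inner_comm, hpq]
  have hTy : T (F y) = ν (e.symm y) := hT _
  have hΨy : Ψ (y, s, t) = s • φ (e.symm y) + t • ν (e.symm y) := by
    simp only [hΨ, hTy]
    rfl
  rw [hΨy] at hz1 hz2 ⊢
  simp only [map_add, map_smul, hT, hT', inner_add_left, inner_add_right, inner_smul_left,
    inner_smul_right, RCLike.conj_to_real, hpq, hqp, hfr.norm_left, hfr.norm_right] at hz1 hz2
  -- For such a point ⟨Tz,z⟩ = t(2s + ct) and ⟨z,z⟩ = s² + t². As 2s + ct > 0 and s > 0, the two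
  -- equations leave only t = 0, s = 1.
  have ht : t = 0 := by
    have h3 : t * (2 * s + c * t) = 0 := by linear_combination hz2
    exact (mul_eq_zero.1 h3).resolve_right h2.ne'
  have hs : s = 1 := by
    subst ht
    have h3 : (s - 1) * (s + 1) = 0 := by linear_combination hz1
    have h4 : s + 1 ≠ 0 := by
      have : 0 < s := h1
      positivity
    exact sub_eq_zero.1 ((mul_eq_zero.1 h3).resolve_right h4)
  exact ⟨e.symm y, by rw [hs, ht]; simp⟩

lemma IsOrientedHypersurface.isCliffordHypersurface [CompactSpace M] [Nonempty M]
    (hM : IsOrientedHypersurface φ ν) {c : ℝ}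
    {T : EuclideanSpace ℝ (Fin (n + 2)) →L[ℝ] EuclideanSpace ℝ (Fin (n + 2))}
    (hsymm : ∀ x z, inner ℝ (T x) z = (inner ℝ x (T z) : ℝ))
    (hsq : ∀ z, T (T z) = c • T z + z)
    (hT : ∀ x, T (φ x) = ν x) (hT' : ∀ x v, T (dmap φ x v) = dmap ν x v)
    (hU : ¬ IsTotallyUmbilical φ ν) : IsCliffordHypersurface (Set.range φ) := by
  set w := Real.sqrt (c ^ 2 + 4) with hw
  have hw2 : w ^ 2 = c ^ 2 + 4 := Real.sq_sqrt (by positivity)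
  have hw0 : 0 < w := Real.sqrt_pos.2 (by positivity)
  have hwc : |c| < w := Real.lt_sqrt_of_sq_lt (by rw [sq_abs]; linarith)
  obtain ⟨hwc1, hwc2⟩ := abs_lt.1 hwc
  -- The roots of λ² = cλ + 1. Their product is −1, so q < 0 < p and the quadric is indefinite.
  set p := (c + w) / 2 with hp
  set q := (c - w) / 2 with hq
  have hqp : q < p := by rw [hp, hq]; linarith
  obtain ⟨m, b, hmN, hb⟩ := exists_orthonormalBasis_of_quadratic hsymm hqp fun z => by
    rw [hsq, show p + q = c by rw [hp, hq]; ring,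
      show p * q = -1 by rw [hp, hq]; linear_combination (-1 / 4 : ℝ) * hw2]
    module
  -- If all eigenvalues with at most one exception were equal, T would differ from a multiple of the
  -- identity by rank at most one. Hence each eigenvalue has multiplicity at least 2, which yields 1
  -- ≤ m − 1 < n.
  have hrank : ∀ (μ : ℝ) (j : Fin (n + 2)),
      (∀ i, i ≠ j → (if i.val < m then p else q) = μ) → False := fun μ j hj => by
    refine hU (hM.isTotallyUmbilical_of_rank_one hT hT' (μ := μ) (u := b j) fun z => ?_)
    refine ⟨((if j.val < m then p else q) - μ) * b.repr z j, b.repr.injective ?_⟩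
    ext i
    rw [map_sub, map_smul, map_smul, b.repr_self, PiLp.sub_apply, PiLp.smul_apply,
      PiLp.smul_apply, hb]
    rcases eq_or_ne i j with rfl | hij
    · generalize (if i.val < m then p else q) = l
      simp
      ring
    · rw [hj i hij]
      simp [hij]
  have hm2 : 2 ≤ m := by
    by_contra hlt
    refine hrank q 0 fun i hi => if_neg fun h => hi (Fin.ext ?_)
    rw [Fin.val_zero]
    omega
  have hmn : m ≤ n := by
    by_contra hlt
    refine hrank p (Fin.last _) fun i hi => if_pos ?_
    have := Fin.val_lt_last hi
    omega
  -- Solve pS + qS' = 0 and S + S' = 1 for the squared lengths S, S' of the two eigencomponents. The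
  -- first block has m = (m − 1) + 1 coordinates, so the index of the model is m − 1.
  set r := Real.sqrt (-q / (p - q)) with hr
  have hpqw : p - q = w := by rw [hp, hq]; ring
  have hr2 : r ^ 2 = -q / (p - q) := Real.sq_sqrt (by
    rw [hpqw, hq]
    refine div_nonneg ?_ hw0.le
    linarith)
  have hr0 : 0 < r := Real.sqrt_pos.2 (by
    rw [hpqw, hq]
    refine div_pos ?_ hw0
    linarith)
  have hr1 : r < 1 := by
    have : r ^ 2 < 1 := by
      rw [hr2, hpqw, div_lt_one hw0, hq]
      linarith
    nlinarith
  have hmem : ∀ z, z ∈ b.repr.symm '' cliffordModel n (m - 1) r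
      ↔ inner ℝ z z = (1 : ℝ) ∧ inner ℝ (T z) z = (0 : ℝ) := fun z => by
    have h1 : inner ℝ z z = ∑ i with i.val < m - 1 + 1, b.repr z i ^ 2
        + ∑ i with ¬ i.val < m - 1 + 1, b.repr z i ^ 2 := by
      rw [Finset.sum_filter_add_sum_filter_not, ← b.repr.inner_map_map, PiLp.inner_apply]
      exact Finset.sum_congr rfl fun i _ => by simp [sq]
    have h2 : inner ℝ (T z) z = p * ∑ i with i.val < m - 1 + 1, b.repr z i ^ 2
        + q * ∑ i with ¬ i.val < m - 1 + 1, b.repr z i ^ 2 := by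
      rw [← b.repr.inner_map_map, PiLp.inner_apply,
        ← Finset.sum_filter_add_sum_filter_not _ fun i : Fin (n + 2) => i.val < m - 1 + 1,
        Finset.mul_sum, Finset.mul_sum]
      congr 1
      · refine Finset.sum_congr rfl fun i hi => ?_
        have hi' : i.val < m := by
          have := (Finset.mem_filter.1 hi).2
          omega
        rw [hb, if_pos hi']
        simp
        ring
      · refine Finset.sum_congr rfl fun i hi => ?_
        have hi' : ¬ i.val < m := by
          have := (Finset.mem_filter.1 hi).2
          omega
        rw [hb, if_neg hi']
        simp
        ring
    have h3 : z ∈ b.repr.symm '' cliffordModel n (m - 1) r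
        ↔ b.repr z ∈ cliffordModel n (m - 1) r := by
      constructor
      · rintro ⟨u, hu, rfl⟩
        rwa [LinearIsometryEquiv.apply_symm_apply]
      · exact fun hz => ⟨_, hz, LinearIsometryEquiv.symm_apply_apply _ _⟩
    rw [h3, cliffordModel, Set.mem_ofPred_eq, h1, h2, hr2]
    set S := ∑ i with i.val < m - 1 + 1, b.repr z i ^ 2
    set S' := ∑ i with ¬ i.val < m - 1 + 1, b.repr z i ^ 2
    have hne : p - q ≠ 0 := by rw [hpqw]; exact hw0.ne'
    constructor
    · rintro ⟨h4, h5⟩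
      rw [h4, h5]
      constructor
      · ring
      · field_simp
        ring
    · rintro ⟨h4, h5⟩
      have h6 : S = -q / (p - q) := by
        rw [eq_div_iff hne]
        linear_combination h5 - q * h4
      exact ⟨h6, by rw [← h6]; linarith⟩
  refine ⟨m - 1, r, b.repr.symm, by omega, by omega, hr0, hr1, ?_⟩
  set C := b.repr.symm '' cliffordModel n (m - 1) r with hC
  have hpre : IsPreconnected C :=
    (isPreconnected_cliffordModel (by omega) (by omega) hr0.le hr1.le).image _
      b.repr.symm.continuous.continuousOn
  have hsub : Set.range φ ⊆ C := by
    rintro _ ⟨x, rfl⟩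
    rw [hmem, hT]
    exact ⟨(hM.isFrame x).norm_left, by rw [real_inner_comm, (hM.isFrame x).orth]⟩
  have hclosed : IsClosed (Set.range φ) :=
    (isCompact_range hM.contMDiff_immersion.continuous).isClosed
  -- Closed by compactness of `M`, open by `eventually_mem_range`; connectedness of the Clifford
  -- hypersurface then gives equality.
  have hclopen : IsClopen (Subtype.val ⁻¹' Set.range φ : Set C) := by
    refine ⟨hclosed.preimage continuous_subtype_val, isOpen_iff_mem_nhds.2 ?_⟩
    rintro ⟨z, hz⟩ ⟨x, hx⟩
    have h1 := hM.eventually_mem_range hT (c := c) (fun x => by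
      rw [← hT, hsq, hT]
      exact add_comm _ _) x
    rw [show φ x = z from hx] at h1
    have h2 : Filter.Tendsto (Subtype.val : C → _) (nhds ⟨z, hz⟩) (nhds z) :=
      continuous_subtype_val.continuousAt
    filter_upwards [h2.eventually h1] with u hu
    obtain ⟨h3, h4⟩ := (hmem u).1 u.2
    exact hu h3 h4
  have : PreconnectedSpace C := Subtype.preconnectedSpace hpre
  obtain ⟨x⟩ : Nonempty M := inferInstance
  have huniv := hclopen.eq_univ ⟨⟨φ x, hsub ⟨x, rfl⟩⟩, ⟨x, rfl⟩⟩
  refine hsub.antisymm fun z hz => ?_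
  have : (⟨z, hz⟩ : C) ∈ (Set.univ : Set C) := trivial
  rw [← huniv] at this
  exact this

end Clifford

/-! ### The weak index -/

theorem IsOrientedHypersurface.two_mul_add_four_le_weakIndex {M : Type*} [TopologicalSpace M]
    [ChartedSpace (EuclideanSpace ℝ (Fin n)) M] [IsManifold (𝓡 n) ∞ M] [T2Space M] [CompactSpace M]
    [ConnectedSpace M] [MeasurableSpace M] [BorelSpace M]
    {φ ν : M → EuclideanSpace ℝ (Fin (n + 2))} (hM : IsOrientedHypersurface φ ν)
    (hH : ∃ H : ℝ, ∀ x, meanCurvature φ ν x = H) (hS : ∃ S : ℝ, ∀ x, scalarCurvature φ x = S)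
    (hU : ¬ IsTotallyUmbilical φ ν) (hC : ¬ IsCliffordHypersurface (Set.range φ)) :
    ((2 * n + 4 : ℕ) : ℕ∞) ≤ weakIndex φ ν := by
  obtain ⟨H₀, hH₀⟩ := hH
  obtain ⟨S, hS⟩ := hS
  -- In dimension zero every hypersurface is umbilical. From here on H is the full trace, n times
  -- the mean curvature.
  have hn : n ≠ 0 := by
    rintro rfl
    exact hU (hM.isTotallyUmbilical fun x => by simpa using sq_nonneg _)
  have hn' : (n : ℝ) ≠ 0 := Nat.cast_ne_zero.2 hn
  set H := n * H₀ with hHdef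
  have hH : ∀ x, opTrace (globalShape φ ν x) = H := fun x => by
    rw [hHdef, ← hH₀ x, hM.meanCurvature_eq]
    field_simp
  set s := n * (n - 1) + H ^ 2 - S with hsdef
  have hs : ∀ x, opTrace (globalShape φ ν x ∘L globalShape φ ν x) = s := fun x => by
    rw [hsdef, ← hS x, hM.scalarCurvature_eq, hH]
    ring
  -- Failure of umbilicity at a single point suffices, since H and s are constant.
  have hδ : 0 < n * s - H ^ 2 := by
    by_contra hle
    refine hU (hM.isTotallyUmbilical fun x => ?_)
    rw [hs, hH]
    linarith
  have hs0 : s ≠ 0 := fun h0 => by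
    rw [h0] at hδ
    nlinarith [sq_nonneg H]
  refine hM.le_weakIndex hH hs hδ fun a b hab => ?_
  by_contra hne
  obtain ⟨c, T, hq, hT⟩ := hM.exists_transition_eq hH hs hs0 hn hab hne
  obtain ⟨x₀⟩ : Nonempty M := inferInstance
  have hf := fun x => hM.isFrame x
  refine hC (hM.isCliffordHypersurface (c := c) (T := T) ?_ ?_ ?_ ?_ hU)
  · rw [← hT x₀]
    exact (hf x₀).transition_symm c
  · intro z
    have h1 := DFunLike.congr_fun ((hf x₀).transition_sq c (hq x₀)) z
    rw [← hT x₀]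
    exact h1
  · intro x
    rw [← hT x]
    exact (hf x).transition_left c
  · intro x v
    rw [← hT x]
    exact (hf x).transition_map c v

end SphereHypersurface

end

theorem theorem4p1 {n : ℕ} {M : Type*} [TopologicalSpace M]
    [ChartedSpace (EuclideanSpace ℝ (Fin n)) M] [IsManifold (𝓡 n) ∞ M]
    [T2Space M] [CompactSpace M] [ConnectedSpace M] [MeasurableSpace M] [BorelSpace M]
    (φ ν : M → EuclideanSpace ℝ (Fin (n + 2)))
    (hM : SphereHypersurface.IsOrientedHypersurface φ ν)
    (hH : ∃ H : ℝ, ∀ x, SphereHypersurface.meanCurvature φ ν x = H)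
    (hS : ∃ S : ℝ, ∀ x, SphereHypersurface.scalarCurvature φ x = S)
    (hU : ¬ SphereHypersurface.IsTotallyUmbilical φ ν)
    (hC : ¬ SphereHypersurface.IsCliffordHypersurface (Set.range φ)) :
    ((2 * n + 4 : ℕ) : ℕ∞) ≤ SphereHypersurface.weakIndex φ ν := by
  exact hM.two_mul_add_four_le_weakIndex hH hS hU hC
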